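/- Let $(X,Y,Z)$ be real-valued, jointly Gaussian, zero-mean random variables with positive definite covariance matrix and $\mathrm{Cov}(X,Y)\neq 0$, and let $(X^n,Y^n,Z^n)$ be $n$ i.i.d. copies of $(X,Y,Z)$. A one-way key agreement protocol of block length $n$ consists of finite alphabets $\mathcal C_n,\mathcal S_n$, a message $C_n\in\mathcal C_n$ and a key $S_n\in\mathcal S_n$ that are measurable functions of $X^n$, and a key $S_n'\in\mathcal S_n$ that is a measurable function of $(Y^n,C_n)$. A pair $(R_p,R_k)\in\mathbb R^2$ is called achievable, written $(R_p,R_k)\in\mathcal R(X,Y,Z)$, if there is a sequence of such protocols with $$\lim_{n\to\infty}\Pr\{S_n\ne S_n'\}=0,\qquad \lim_{n\to\infty}\bigl(\log|\mathcal S_n|-H(S_n\mid C_n,Z^n)\bigr)=0,$$ $$\limsup_{n\to\infty}\frac1n\log|\mathcal C_n|\le R_p,\qquad \liminf_{n\to\infty}\frac1n\log|\mathcal S_n|\ge R_k .$$ All information quantities are in nats. Suppose that $(X,Y,Z)$ is degraded, i.e. $X - Y - Z$ is a Markov chain ($X$ and $Z$ are conditionally independent given $Y$). If $(R_p,R_k)\in\mathcal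 R(X,Y,Z)$, then there exists a real-valued auxiliary random variable $U$, jointly distributed with $(X,Y,Z)$ (on a possibly different probability space, the law of $(X,Y,Z)$ being unchanged), such that $U - X - Y - Z$ is a Markov chain and $$R_p\ \ge\ I(U;X\mid Y),\qquad R_k\ \le\ I(U;Y\mid Z).$$ -/

import Mathlib

open MeasureTheory ProbabilityTheory Filter Topology
open scoped ENNReal

noncomputable section

/-- The random variables `A`, `B`, `C` form a Markov chain `A – B – C` under `P`: the joint law
of `(B, A, C)` is `P_B ⊗ (P_{A|B} × P_{C|B})`, i.e. `A` and `C` are conditionally independent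
given `B`. -/
def IsMarkovChain {Ω α β γ : Type*} [MeasurableSpace Ω]
    [MeasurableSpace α] [StandardBorelSpace α] [Nonempty α] [MeasurableSpace β]
    [MeasurableSpace γ] [StandardBorelSpace γ] [Nonempty γ]
    (P : Measure Ω) [IsProbabilityMeasure P] (A : Ω → α) (B : Ω → β) (C : Ω → γ) : Prop :=
  P.map (fun ω => (B ω, A ω, C ω)) =
    (P.map B) ⊗ₘ ((condDistrib A B P) ×ₖ (condDistrib C B P))

/-- Four random variables form a Markov chain `A – B – C – D`: both `A – B – (C, D)` and
`(A, B) – C – D` are Markov chains. -/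
def IsMarkovChain₄ {Ω α β γ δ : Type*} [MeasurableSpace Ω]
    [MeasurableSpace α] [StandardBorelSpace α] [Nonempty α]
    [MeasurableSpace β] [StandardBorelSpace β] [Nonempty β]
    [MeasurableSpace γ] [StandardBorelSpace γ] [Nonempty γ]
    [MeasurableSpace δ] [StandardBorelSpace δ] [Nonempty δ]
    (P : Measure Ω) [IsProbabilityMeasure P]
    (A : Ω → α) (B : Ω → β) (C : Ω → γ) (D : Ω → δ) : Prop :=
  IsMarkovChain P A B (fun ω => (C ω, D ω)) ∧ IsMarkovChain P (fun ω => (A ω, B ω)) C D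

/-- On a standard Borel probability space, `IsMarkovChain` is Mathlib's conditional
independence. -/
theorem isMarkovChain_iff_condIndepFun {Ω α β γ : Type*} [MeasurableSpace Ω]
    [StandardBorelSpace Ω]
    [MeasurableSpace α] [StandardBorelSpace α] [Nonempty α] [MeasurableSpace β]
    [MeasurableSpace γ] [StandardBorelSpace γ] [Nonempty γ]
    (P : Measure Ω) [IsProbabilityMeasure P] (A : Ω → α) (B : Ω → β) (C : Ω → γ)
    (hA : Measurable A) (hB : Measurable B) (hC : Measurable C) :
    IsMarkovChain P A B C ↔
      CondIndepFun (MeasurableSpace.comap B inferInstance) hB.comap_le A C P := by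
  rw [condIndepFun_iff_map_prod_eq_prod_condDistrib_prod_condDistrib hA hC hB, IsMarkovChain,
    Measure.compProd_eq_comp_prod]

/-- The conditional mutual information `I(A; B | C)` in nats, as the Kullback–Leibler divergence
of the law of `(C, A, B)` from `P_C ⊗ (P_{A|C} × P_{B|C})`; it may be `∞`. -/
def condMutualInfo {Ω α β γ : Type*} [MeasurableSpace Ω]
    [MeasurableSpace α] [StandardBorelSpace α] [Nonempty α]
    [MeasurableSpace β] [StandardBorelSpace β] [Nonempty β] [MeasurableSpace γ]
    (P : Measure Ω) [IsProbabilityMeasure P] (A : Ω → α) (B : Ω → β) (C : Ω → γ) : ℝ≥0∞ :=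
  InformationTheory.klDiv (P.map (fun ω => (C ω, A ω, B ω)))
    ((P.map C) ⊗ₘ ((condDistrib A C P) ×ₖ (condDistrib B C P)))

/-- The conditional Shannon entropy `H(S | W) = E[- ∑ₛ P(S = s | W) log P(S = s | W)]` in nats of
a random variable `S` with finitely many values given an arbitrary random variable `W`. -/
def condEntropy {Ω σ τ : Type*} [MeasurableSpace Ω] [Fintype σ] [mτ : MeasurableSpace τ]
    (P : Measure Ω) (S : Ω → σ) (W : Ω → τ) : ℝ :=
  ∫ ω, ∑ s : σ, Real.negMulLog ((P⟦S ⁻¹' {s} | mτ.comap W⟧) ω) ∂P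

/-- A one-way key agreement protocol of block length `n` for real-valued sources: the message
alphabet is `{0, …, numMsg - 1}`, the key alphabet is `{0, …, numKey - 1}`. Alice computes the
message and her key from `xⁿ`, Bob computes his key from `yⁿ` and the message. -/
structure KeyProtocol (n : ℕ) where
  numMsg : ℕ
  numKey : ℕ
  msg : (Fin n → ℝ) → Fin numMsg
  keyA : (Fin n → ℝ) → Fin numKey
  keyB : (Fin n → ℝ) × Fin numMsg → Fin numKey
  measurable_msg : Measurable msg
  measurable_keyA : Measurable keyA
  measurable_keyB : Measurable keyB

/-- The law of `n` independent draws of the underlying outcome. -/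
def iidMeasure {Ω : Type*} [MeasurableSpace Ω] (P : Measure Ω) (n : ℕ) : Measure (Fin n → Ω) :=
  Measure.pi fun _ => P

/-- The block `Aⁿ` of `n` i.i.d. copies of the random variable `A`, a random variable under
`iidMeasure P n`. -/
def block {Ω α : Type*} (A : Ω → α) (n : ℕ) : (Fin n → Ω) → (Fin n → α) :=
  fun ω i => A (ω i)

namespace KeyProtocol

variable {Ω : Type*} [MeasurableSpace Ω] {n : ℕ}

/-- The error probability `Pr{Sₙ ≠ Sₙ'}`. -/
def errorProb (π : KeyProtocol n) (P : Measure Ω) (X Y : Ω → ℝ) : ℝ :=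
  (iidMeasure P n).real
    {ω | π.keyA (block X n ω) ≠ π.keyB (block Y n ω, π.msg (block X n ω))}

/-- The security parameter `log |𝒮ₙ| - H(Sₙ | Cₙ, Zⁿ)`. -/
def leakage (π : KeyProtocol n) (P : Measure Ω) (X Z : Ω → ℝ) : ℝ :=
  Real.log π.numKey -
    condEntropy (iidMeasure P n) (fun ω => π.keyA (block X n ω))
      (fun ω => (π.msg (block X n ω), block Z n ω))

end KeyProtocol

/-- The achievable rate region `ℛ(X, Y, Z)`: the pairs `(R_p, R_k)` of a public communication
rate and a key rate for which there is a sequence of protocols with vanishing error probability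
and vanishing security parameter, `limsup (1/n) log |𝒞ₙ| ≤ R_p` and
`liminf (1/n) log |𝒮ₙ| ≥ R_k`. Both limits are taken in the extended reals. -/
def achievableRegion {Ω : Type*} [MeasurableSpace Ω] (P : Measure Ω) (X Y Z : Ω → ℝ) :
    Set (ℝ × ℝ) :=
  {R | ∃ π : (n : ℕ) → KeyProtocol n,
    Tendsto (fun n => (π n).errorProb P X Y) atTop (𝓝 0) ∧
    Tendsto (fun n => (π n).leakage P X Z) atTop (𝓝 0) ∧
    limsup (fun n : ℕ => ((1 / (n : ℝ) * Real.log (π n).numMsg : ℝ) : EReal)) atTop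
      ≤ (R.1 : EReal) ∧
    (R.2 : EReal) ≤
      liminf (fun n : ℕ => ((1 / (n : ℝ) * Real.log (π n).numKey : ℝ) : EReal)) atTop}

/-- The covariance matrix of the triple `(X, Y, Z)`. -/
def tripleCov {Ω : Type*} [MeasurableSpace Ω] (P : Measure Ω) (X Y Z : Ω → ℝ) :
    Matrix (Fin 3) (Fin 3) ℝ :=
  Matrix.of fun i j => cov[![X, Y, Z] i, ![X, Y, Z] j; P]

end

/-! Joint Gaussianity and degradedness make the source a cascade Y = bZ + N₂, X = aY + N₁ with Z,
N₂, N₁ independent and Gaussian noises of variances t and r. Put τ = a²t + r, the variance of X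
given Z. The auxiliary variable U = √w X + N₀ with N₀ standard normal and independent of the source
gives I(U;X|Y) = ½ log(1 + wr) and I(U;Y|Z) = ½ log((1 + wτ)/(1 + wr)) (`condMutualInfo_gaussian`).
Since R_p ≥ 0, some w ≥ 0 makes the first quantity equal to R_p, so it is enough to bound R_k by the
second. No single-letterisation is needed: a Gaussian U always suffices.

The bound comes from a linear inequality (1 − θ) R_k ≤ θ R_p + c, where θ in [0,1) and c depend on w
and the line passes through the Gaussian point. It is the limit of a one-block inequality
(`key_length_le`). For W = (C, S), a function of Xⁿ, one has (1 − θ) H(W|Zⁿ) ≤ H(W|Yⁿ) + nc. The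
chain rule, H(C|Yⁿ) ≤ H(C|Zⁿ), H(C|Yⁿ) ≤ log|𝒞| and Fano's inequality for H(S|C,Yⁿ) turn this into a
bound on H(S|C,Zⁿ), which the security condition identifies with log|𝒮| up to o(1).

The entropy inequality for W is an entropy power inequality in linearised form. Given Z and after
centring, X has law N(0,τ) and Y = αX + N(0,ν). If an input has density h relative to N(0,τ), and g
is the density of the output relative to N(0,t), then Ent(g) ≤ θ Ent(h) + ∫ h q with q a quadratic
polynomial. Here θ = α²s/(α²s + ν), and the bound is attained by the input N(0,s). The proof is by
transport: the increasing map T carries N(0,s) to the input law, a change of variables along the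
backward channel gives `lintegral_rearranged_density_le`, and log-concavity (weighted AM–GM and x +
1 ≤ exp x) finishes.

In unnormalised form the inequality tensorises by superadditivity of entropy
(`IsEntropyContraction.prod`). Applied to the indicators of the cells of W and summed, the terms
Ent(h) vanish because indicators have zero entropy density, and the weights q add up to their
Gaussian mean c because the indicators add up to 1 (`IsEntropyContraction.partition`). -/

open scoped NNReal

/-! ### Increasing rearrangement of densities on the line -/

section Transport

/-- The distribution function of a continuous density. -/
theorem hasDerivAt_integral_Iic {f : ℝ → ℝ} (hf : Continuous f) (hfi : Integrable f) (x : ℝ) :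
    HasDerivAt (fun y => ∫ t in Set.Iic y, f t) (f x) x := by
  have h1 : (fun y => ∫ t in Set.Iic y, f t)
      = fun y => (∫ t in Set.Iic (0 : ℝ), f t) + ∫ t in (0 : ℝ)..y, f t := by
    funext y
    rw [← intervalIntegral.integral_Iic_sub_Iic hfi.integrableOn hfi.integrableOn]
    ring
  rw [h1]
  exact (intervalIntegral.integral_hasDerivAt_right (hfi.intervalIntegrable)
    (hf.stronglyMeasurableAtFilter _ _) hf.continuousAt).const_add _

theorem exists_integral_Iic_eq {f : ℝ → ℝ} (hf : Continuous f) (hfi : Integrable f)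
    (hone : ∫ x, f x = 1) {c : ℝ} (h0 : 0 < c) (h1 : c < 1) :
    ∃ y, ∫ t in Set.Iic y, f t = c := by
  have hcont : Continuous (fun y => ∫ t in Set.Iic y, f t) :=
    continuous_iff_continuousAt.2 fun x => (hasDerivAt_integral_Iic hf hfi x).continuousAt
  have hsplit : ∀ y, ∫ t in Set.Iic y, f t
      = (∫ t in Set.Iic (0 : ℝ), f t) + ∫ t in (0 : ℝ)..y, f t := by
    intro y
    rw [← intervalIntegral.integral_Iic_sub_Iic hfi.integrableOn hfi.integrableOn]
    ring
  have htop : Tendsto (fun y => ∫ t in Set.Iic y, f t) atTop (𝓝 1) := by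
    rw [funext hsplit]
    have := (intervalIntegral_tendsto_integral_Ioi 0 hfi.integrableOn tendsto_id).const_add
      (∫ t in Set.Iic (0 : ℝ), f t)
    rwa [intervalIntegral.integral_Iic_add_Ioi hfi.integrableOn hfi.integrableOn, hone] at this
  have hbot : Tendsto (fun y => ∫ t in Set.Iic y, f t) atBot (𝓝 0) := by
    rw [funext hsplit]
    have := (intervalIntegral_tendsto_integral_Iic 0 hfi.integrableOn tendsto_id).const_sub
      (∫ t in Set.Iic (0 : ℝ), f t)
    rw [sub_self] at this
    refine this.congr fun y => ?_
    rw [intervalIntegral.integral_symm 0 (id y)]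
    simp
  obtain ⟨a, ha⟩ := (hbot.eventually (gt_mem_nhds h0)).exists
  obtain ⟨b, hb⟩ := (htop.eventually (lt_mem_nhds h1)).exists
  exact mem_range_of_exists_le_of_exists_ge hcont ⟨a, ha.le⟩ ⟨b, hb.le⟩

theorem strictMono_integral_Iic {f : ℝ → ℝ} (hf : Continuous f) (hfi : Integrable f)
    (hpos : ∀ x, 0 < f x) : StrictMono (fun y => ∫ t in Set.Iic y, f t) :=
  strictMono_of_deriv_pos fun x => by
    rw [(hasDerivAt_integral_Iic hf hfi x).deriv]; exact hpos x

theorem integral_Iic_mem_Ioo {f : ℝ → ℝ} (hf : Continuous f) (hfi : Integrable f)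
    (hpos : ∀ x, 0 < f x) (hone : ∫ x, f x = 1) (x : ℝ) :
    (∫ t in Set.Iic x, f t) ∈ Set.Ioo (0 : ℝ) 1 := by
  have hnn : ∀ y, 0 ≤ ∫ t in Set.Iic y, f t := fun y =>
    integral_nonneg fun t => (hpos t).le
  have hle : ∀ y, ∫ t in Set.Iic y, f t ≤ 1 := fun y => by
    rw [← hone]
    exact setIntegral_le_integral hfi (Eventually.of_forall fun t => (hpos t).le)
  have hm := strictMono_integral_Iic hf hfi hpos
  exact ⟨(hnn (x - 1)).trans_lt (hm (by linarith)), (hm (by linarith : x < x + 1)).trans_le (hle _)⟩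

/-- The increasing rearrangement of one positive continuous probability density onto another. -/
theorem exists_transport {f g : ℝ → ℝ} (hf : Continuous f) (hfi : Integrable f)
    (hfpos : ∀ x, 0 < f x) (hf1 : ∫ x, f x = 1) (hg : Continuous g) (hgi : Integrable g)
    (hgpos : ∀ x, 0 < g x) (hg1 : ∫ x, g x = 1) :
    ∃ T : ℝ → ℝ, StrictMono T ∧ Function.Surjective T ∧
      ∀ x, HasDerivAt T (f x / g (T x)) x := by
  choose T hT using fun x => exists_integral_Iic_eq hg hgi hg1
    (integral_Iic_mem_Ioo hf hfi hfpos hf1 x).1 (integral_Iic_mem_Ioo hf hfi hfpos hf1 x).2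
  have hFm := strictMono_integral_Iic hf hfi hfpos
  have hGm := strictMono_integral_Iic hg hgi hgpos
  have hmono : StrictMono T := fun x y hxy => by
    have : (∫ t in Set.Iic (T x), g t) < ∫ t in Set.Iic (T y), g t := by
      rw [hT, hT]; exact hFm hxy
    exact hGm.lt_iff_lt.1 this
  have hsurj : Function.Surjective T := fun y => by
    obtain ⟨x, hx⟩ := exists_integral_Iic_eq hf hfi hf1
      (integral_Iic_mem_Ioo hg hgi hgpos hg1 y).1 (integral_Iic_mem_Ioo hg hgi hgpos hg1 y).2
    exact ⟨x, hGm.injective ((hT x).trans hx)⟩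
  have hTc : Continuous T := hmono.monotone.continuous_of_surjective hsurj
  refine ⟨T, hmono, hsurj, fun x => ?_⟩
  let S : ℝ → ℝ := Function.surjInv hsurj
  have hS : ∀ y, T (S y) = y := Function.surjInv_eq hsurj
  have hST : ∀ x, S (T x) = x := fun x => hmono.injective (hS (T x))
  have hSm : StrictMono S := fun a b hab => by
    rw [← hmono.lt_iff_lt, hS, hS]; exact hab
  have hSc : Continuous S := hSm.monotone.continuous_of_surjective fun x => ⟨T x, hST x⟩
  -- The inverse S satisfies F(S y) = G(y) for the two distribution functions, so its slope is a
  -- slope of G over a slope of F; the derivative of T is then the reciprocal.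
  have hSd : HasDerivAt S (g (T x) / f x) (T x) := by
    have h1 : ∀ y, (∫ t in Set.Iic (S y), f t) = ∫ t in Set.Iic y, g t := fun y => by
      rw [← hT (S y), hS]
    have h2 := hasDerivAt_integral_Iic hf hfi (S (T x))
    rw [hST] at h2
    have h3 := hasDerivAt_integral_Iic hg hgi (T x)
    rw [hasDerivAt_iff_tendsto_slope] at h2 h3 ⊢
    have h4 : Tendsto S (𝓝[≠] (T x)) (𝓝[≠] x) := by
      refine tendsto_nhdsWithin_iff.2 ⟨?_, ?_⟩
      · have := hSc.tendsto (T x)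
        rw [hST] at this
        exact this.mono_left nhdsWithin_le_nhds
      · filter_upwards [self_mem_nhdsWithin] with y hy
        intro h
        apply hy
        rw [Set.mem_singleton_iff] at h ⊢
        rw [← h, hS]
    refine (h3.div (h2.comp h4) (hfpos x).ne').congr' ?_
    filter_upwards [self_mem_nhdsWithin] with y hy
    have hy' : y - T x ≠ 0 := sub_ne_zero.2 hy
    have hne : S y - x ≠ 0 := by
      intro h
      apply hy
      rw [Set.mem_singleton_iff, ← hS y, sub_eq_zero.1 h]
    have hG : (∫ t in Set.Iic y, g t) - ∫ t in Set.Iic (T x), g t ≠ 0 :=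
      sub_ne_zero.2 fun h => hy (hGm.injective h)
    simp only [Function.comp_apply, slope_def_field, Pi.div_apply, h1, hST]
    rw [← hT x] 
    field_simp
  have := HasDerivAt.of_local_left_inverse (f := S) (g := T) (a := x)  hTc.continuousAt hSd
    (div_ne_zero (hgpos _).ne' (hfpos _).ne') (Eventually.of_forall hST)
  rwa [inv_div] at this

/-- The range is kept because the map used in the entropy power argument is not shown to be
surjective; there an inequality suffices. -/
theorem lintegral_comp_mul_deriv {T T' : ℝ → ℝ} (hm : StrictMono T)
    (hd : ∀ x, HasDerivAt T (T' x) x) (u : ℝ → ℝ≥0∞) :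
    ∫⁻ x in Set.range T, u x = ∫⁻ x, ENNReal.ofReal (T' x) * u (T x) := by
  have := lintegral_image_eq_lintegral_deriv_mul_of_monotoneOn (s := Set.univ) MeasurableSet.univ
    (fun x _ => (hd x).hasDerivWithinAt) (hm.monotone.monotoneOn _) u
  simpa using this

end Transport

/-! ### Forward and backward channels of a centred Gaussian pair -/

section GaussianPair

theorem log_gaussianPDFReal {v : ℝ≥0} (hv : v ≠ 0) (x : ℝ) :
    Real.log (gaussianPDFReal 0 v x) = -(Real.log (2 * Real.pi * v) / 2) - x ^ 2 / (2 * v) := by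
  have hv' : (0 : ℝ) < v := by positivity
  rw [gaussianPDFReal, Real.log_mul (by positivity) (by positivity), Real.log_inv, Real.log_exp,
    Real.log_sqrt (by positivity)]
  simp only [sub_zero]
  ring

/-- Bayes' rule for Gaussian densities: the two ways of factoring a bivariate density. -/
theorem gaussianPDFReal_mul_comm {t s τ ν : ℝ≥0} {a α : ℝ} (ht : t ≠ 0) (hs : s ≠ 0)
    (hτ : (τ : ℝ) = a ^ 2 * t + s) (hν : (ν : ℝ) * τ = t * s) (hα : α * τ = a * t) (x v : ℝ) :
    gaussianPDFReal 0 t v * gaussianPDFReal 0 s (x - a * v)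
      = gaussianPDFReal 0 τ x * gaussianPDFReal 0 ν (v - α * x) := by
  have ht' : (0 : ℝ) < t := by positivity
  have hs' : (0 : ℝ) < s := by positivity
  have hτ' : (0 : ℝ) < τ := by rw [hτ]; positivity
  have hν' : (ν : ℝ) = t * s / τ := by field_simp; linarith
  have hα' : α = a * t / τ := by field_simp; linarith
  have hνp : (0 : ℝ) < ν := by rw [hν']; positivity
  simp only [gaussianPDFReal, sub_zero]
  have e : -v ^ 2 / (2 * (t : ℝ)) + -(x - a * v) ^ 2 / (2 * s)
      = -x ^ 2 / (2 * τ) + -(v - α * x) ^ 2 / (2 * ν) := by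
    rw [hν', hα']
    have : (τ : ℝ) ≠ 0 := hτ'.ne'
    rw [hτ] at this ⊢
    field_simp
    ring
  have c : (√(2 * Real.pi * t))⁻¹ * (√(2 * Real.pi * s))⁻¹
      = (√(2 * Real.pi * τ))⁻¹ * (√(2 * Real.pi * ν))⁻¹ := by
    rw [← mul_inv, ← mul_inv, ← Real.sqrt_mul (by positivity), ← Real.sqrt_mul (by positivity)]
    congr 2
    linear_combination (-(4 * Real.pi ^ 2)) * hν
  calc _ = ((√(2 * Real.pi * t))⁻¹ * (√(2 * Real.pi * s))⁻¹)
        * Real.exp (-v ^ 2 / (2 * (t : ℝ)) + -(x - a * v) ^ 2 / (2 * s)) := by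
        rw [Real.exp_add]; ring
    _ = _ := by rw [c, e, Real.exp_add]; ring

theorem lintegral_gaussianReal {v : ℝ≥0} (hv : v ≠ 0) {f : ℝ → ℝ≥0∞} (hf : Measurable f) :
    ∫⁻ x, f x ∂(gaussianReal 0 v) = ∫⁻ x, gaussianPDF 0 v x * f x := by
  rw [gaussianReal_of_var_ne_zero _ hv, lintegral_withDensity_eq_lintegral_mul _
    (measurable_gaussianPDF 0 v) hf]
  rfl

/-- In the coordinates (x, v) both factorisations of the pair become Lebesgue integrals, so that
Bayes' rule can be applied to the integrands pointwise. -/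
theorem lintegral_prod_gaussianReal_shift {t s : ℝ≥0} (a : ℝ) (ht : t ≠ 0) (hs : s ≠ 0)
    {f : ℝ × ℝ → ℝ≥0∞} (hf : Measurable f) :
    ∫⁻ p, f (a * p.1 + p.2, p.1) ∂((gaussianReal 0 t).prod (gaussianReal 0 s))
      = ∫⁻ v, ∫⁻ x, gaussianPDF 0 t v * (gaussianPDF 0 s (x - a * v) * f (x, v)) := by
  rw [lintegral_prod _ (by fun_prop), lintegral_gaussianReal ht
    (Measurable.lintegral_prod_right' (f := fun p : ℝ × ℝ => f (a * p.1 + p.2, p.1))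
      (by fun_prop))]
  refine lintegral_congr fun v => ?_
  have hm := measurable_gaussianPDF 0 s
  rw [lintegral_gaussianReal hs (by fun_prop), lintegral_const_mul _ (by fun_prop)]
  congr 1
  rw [← lintegral_sub_right_eq_self _ (a * v)]
  refine lintegral_congr fun x => ?_
  simp

/-- A centred Gaussian pair written through its backward and its forward channel. -/
theorem gaussian_pair_reverse {t s τ ν : ℝ≥0} {a α : ℝ} (ht : t ≠ 0) (hs : s ≠ 0)
    (hτ : (τ : ℝ) = a ^ 2 * t + s) (hν : (ν : ℝ) * τ = t * s) (hα : α * τ = a * t) :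
    ((gaussianReal 0 t).prod (gaussianReal 0 s)).map (fun p => (a * p.1 + p.2, p.1))
      = ((gaussianReal 0 τ).prod (gaussianReal 0 ν)).map (fun p => (p.1, α * p.1 + p.2)) := by
  have ht' : (0 : ℝ) < t := by positivity
  have hs' : (0 : ℝ) < s := by positivity
  have hτ' : (0 : ℝ) < τ := by rw [hτ]; positivity
  have hτ0 : τ ≠ 0 := by rintro rfl; simp at hτ'
  have hν0 : ν ≠ 0 := by
    rintro rfl
    simp only [NNReal.coe_zero, zero_mul] at hν
    have : (0 : ℝ) < t * s := by positivity
    linarith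
  refine Measure.ext_of_lintegral _ fun f hf => ?_
  rw [lintegral_map hf (by fun_prop), lintegral_map hf (by fun_prop),
    lintegral_prod_gaussianReal_shift a ht hs hf]
  have h2 := lintegral_prod_gaussianReal_shift α hτ0 hν0 (f := fun p => f (p.2, p.1))
    (by fun_prop)
  simp only at h2
  rw [h2, lintegral_lintegral_swap]
  · refine lintegral_congr fun x => lintegral_congr fun v => ?_
    rw [← mul_assoc, ← mul_assoc]
    congr 1
    simp only [gaussianPDF]
    rw [← ENNReal.ofReal_mul (gaussianPDFReal_nonneg _ _ _),
      ← ENNReal.ofReal_mul (gaussianPDFReal_nonneg _ _ _),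
      gaussianPDFReal_mul_comm ht hs hτ hν hα]
  · have h1 := measurable_gaussianPDF 0 t
    have h2 := measurable_gaussianPDF 0 s
    exact Measurable.aemeasurable (by unfold Function.uncurry; fun_prop)

theorem map_prod_gaussianReal {t s τ : ℝ≥0} {a : ℝ} (hτ : (τ : ℝ) = a ^ 2 * t + s) :
    ((gaussianReal 0 t).prod (gaussianReal 0 s)).map (fun p => a * p.1 + p.2)
      = gaussianReal 0 τ := by
  have h : (fun p : ℝ × ℝ => a * p.1 + p.2)
      = (fun p : ℝ × ℝ => p.1 + p.2) ∘ (Prod.map (fun x => a * x) id) := by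
    funext p; rfl
  rw [h, ← Measure.map_map (by fun_prop) (by fun_prop),
    ← Measure.map_prod_map _ _ (by fun_prop) (by fun_prop), Measure.map_id,
    gaussianReal_map_const_mul]
  have := gaussianReal_conv_gaussianReal (m₁ := a * 0) (m₂ := 0)
    (v₁ := NNReal.mk (a ^ 2) (sq_nonneg _) * t) (v₂ := s)
  rw [Measure.conv] at this
  rw [this]
  congr 1
  · simp
  · ext; simp [hτ]

end GaussianPair

/-! ### The change of variables behind the entropy power inequality -/

section EntropyPower

theorem integral_sq_gaussianReal (v : ℝ≥0) : ∫ x, x ^ 2 ∂(gaussianReal 0 v) = v := by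
  have := variance_fun_id_gaussianReal (μ := 0) (v := v)
  rw [variance_of_integral_eq_zero (by fun_prop) (by simp)] at this
  exact this

theorem integrable_sq_gaussianReal (v : ℝ≥0) : Integrable (fun x => x ^ 2) (gaussianReal 0 v) :=
  (memLp_id_gaussianReal' (μ := 0) (v := v) 2 (by simp)).integrable_sq

theorem integrable_id_gaussianReal (v : ℝ≥0) : Integrable (fun x => x) (gaussianReal 0 v) :=
  (memLp_id_gaussianReal' (μ := 0) (v := v) 1 (by simp)).integrable le_rfl

theorem continuous_gaussianPDFReal (v : ℝ≥0) : Continuous (gaussianPDFReal 0 v) := by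
  rw [gaussianPDFReal_def]; fun_prop

/-- The rearrangement of a centred Gaussian law onto a continuous density with respect to another
centred Gaussian law. -/
theorem exists_gaussian_transport {s τ : ℝ≥0} (hs : s ≠ 0) (hτ : τ ≠ 0) {h : ℝ → ℝ}
    (hc : Continuous h) (hpos : ∀ x, 0 < h x) (hi : Integrable h (gaussianReal 0 τ))
    (h1 : ∫ x, h x ∂(gaussianReal 0 τ) = 1) :
    ∃ T : ℝ → ℝ, StrictMono T ∧
      (∀ x, HasDerivAt T (gaussianPDFReal 0 s x / (h (T x) * gaussianPDFReal 0 τ (T x))) x) ∧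
      ∀ F : ℝ → ℝ≥0∞, Measurable F → ∫⁻ x, F (T x) ∂(gaussianReal 0 s)
        = ∫⁻ x, ENNReal.ofReal (h x) * F x ∂(gaussianReal 0 τ) := by
  have hpi : Integrable (fun x => h x * gaussianPDFReal 0 τ x) := by
    rw [gaussianReal_of_var_ne_zero _ hτ, integrable_withDensity_iff_integrable_smul'
      (measurable_gaussianPDF 0 τ) (Eventually.of_forall fun x => gaussianPDF_lt_top)] at hi
    refine hi.congr (Eventually.of_forall fun x => ?_)
    simp [mul_comm]
  have hp1 : ∫ x, h x * gaussianPDFReal 0 τ x = 1 := by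
    rw [← h1, integral_gaussianReal_eq_integral_smul hτ]
    simp [mul_comm]
  have hppos : ∀ x, 0 < h x * gaussianPDFReal 0 τ x := fun x =>
    mul_pos (hpos x) (gaussianPDFReal_pos 0 τ x hτ)
  obtain ⟨T, hm, hsurj, hd⟩ := exists_transport (continuous_gaussianPDFReal s)
    (integrable_gaussianPDFReal 0 s) (fun x => gaussianPDFReal_pos 0 s x hs)
    (integral_gaussianPDFReal_eq_one 0 hs) (hc.mul (continuous_gaussianPDFReal τ)) hpi hppos hp1
  replace hd : ∀ x, HasDerivAt T
      (gaussianPDFReal 0 s x / (h (T x) * gaussianPDFReal 0 τ (T x))) x := hd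
  refine ⟨T, hm, hd, fun F hF => ?_⟩
  have hTm : Measurable T := hm.monotone.measurable
  rw [lintegral_gaussianReal hs (f := fun x => F (T x)) (hF.comp hTm),
    lintegral_gaussianReal hτ (f := fun x => ENNReal.ofReal (h x) * F x)
      (hc.measurable.ennreal_ofReal.mul hF)]
  have := lintegral_comp_mul_deriv hm hd
    (fun y => ENNReal.ofReal (h y * gaussianPDFReal 0 τ y) * F y)
  rw [hsurj.range_eq, setLIntegral_univ] at this
  calc _ = ∫⁻ x, ENNReal.ofReal (gaussianPDFReal 0 s x / (h (T x) * gaussianPDFReal 0 τ (T x)))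
        * (ENNReal.ofReal (h (T x) * gaussianPDFReal 0 τ (T x)) * F (T x)) := by
        refine lintegral_congr fun x => ?_
        rw [← mul_assoc, ← ENNReal.ofReal_mul (div_nonneg (gaussianPDFReal_nonneg _ _ _)
          (hppos _).le), div_mul_cancel₀ _ (hppos _).ne', gaussianPDF]
    _ = _ := by
        rw [← this]
        refine lintegral_congr fun x => ?_
        rw [ENNReal.ofReal_mul (hpos _).le, gaussianPDF]
        ring

/-- Along an increasing map of the first coordinate, the Gaussian channel contracts densities: the
change of variables behind the entropy power inequality. -/
theorem lintegral_rearranged_density_le {α : ℝ} {s ν sY : ℝ≥0} (hs : s ≠ 0) (hν : ν ≠ 0)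
    (hsY : (sY : ℝ) = α ^ 2 * s + ν) {T T' : ℝ → ℝ} (hTm : StrictMono T)
    (hd : ∀ x, HasDerivAt T (T' x) x) (hT' : Measurable T') (hT'pos : ∀ x, 0 < T' x)
    {r : ℝ → ℝ} (hr : Measurable r)
    (hr1 : ∫⁻ y, ENNReal.ofReal (r y) ≤ 1) :
    ∫⁻ p, ENNReal.ofReal (r (α * T p.1 + p.2) * (α ^ 2 * s / sY * T' p.1 + (1 - α ^ 2 * s / sY))
        / gaussianPDFReal 0 sY (α * p.1 + p.2)) ∂((gaussianReal 0 s).prod (gaussianReal 0 ν))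
      ≤ 1 := by
  have hs' : (0 : ℝ) < s := by positivity
  have hν' : (0 : ℝ) < ν := by positivity
  have hsY' : (0 : ℝ) < sY := by rw [hsY]; positivity
  have hsY0 : sY ≠ 0 := by rintro rfl; simp at hsY'
  set θ : ℝ := α ^ 2 * s / sY with hθ
  have hθ0 : 0 ≤ θ := by positivity
  have hθ1 : 0 < 1 - θ := by
    rw [hθ, sub_pos, div_lt_one hsY', hsY]; linarith
  -- Backward channel of the reference pair: with X ∼ N(0,s) and Y = αX + N(0,ν) ∼ N(0,sY), one has
  -- X = aY + B with B ∼ N(0,w) independent of Y.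
  set a : ℝ := α * s / sY with ha
  let w : ℝ≥0 := s * ν / sY
  have hw : (w : ℝ) = s * ν / sY := by simp [w]
  have hw' : (0 : ℝ) < w := by rw [hw]; positivity
  have hw0 : w ≠ 0 := by intro h; simp [h] at hw'
  have hrev := gaussian_pair_reverse (t := sY) (s := w) (τ := s) (ν := ν) (a := a) (α := α) hsY0 hw0
    (by rw [hw, ha]; field_simp; rw [hsY]; ring) (by rw [hw]; field_simp)
    (by rw [ha]; field_simp)
  have hTmeas : Measurable T := hTm.monotone.measurable
  have hpm := measurable_gaussianPDFReal 0 sY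
  let F : ℝ × ℝ → ℝ≥0∞ := fun q => ENNReal.ofReal (r (α * T q.1 + (q.2 - α * q.1))
    * (θ * T' q.1 + (1 - θ)) / gaussianPDFReal 0 sY q.2)
  have hF : Measurable F := by fun_prop
  have hstart : ∫⁻ p, ENNReal.ofReal (r (α * T p.1 + p.2) * (θ * T' p.1 + (1 - θ))
        / gaussianPDFReal 0 sY (α * p.1 + p.2)) ∂((gaussianReal 0 s).prod (gaussianReal 0 ν))
      = ∫⁻ q, F q ∂(((gaussianReal 0 s).prod (gaussianReal 0 ν)).map
          (fun p => (p.1, α * p.1 + p.2))) := by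
    rw [lintegral_map hF (by fun_prop)]
    simp [F]
  -- Passing to the independent coordinates (Y, B) allows the integral over Y to be bounded for each
  -- fixed value b of B.
  rw [hstart, ← hrev, lintegral_map hF (by fun_prop), lintegral_prod_symm' _ (by fun_prop)]
  calc _ ≤ ∫⁻ _ : ℝ, 1 ∂(gaussianReal 0 w) := lintegral_mono fun b => ?_
    _ = 1 := by simp
  rw [lintegral_gaussianReal hsY0 (by fun_prop)]
  -- With B = b fixed, the new output is an increasing function Θ of the reference output. As αa =
  -- θ, its derivative is exactly the factor θT' + (1 − θ), so the integral is that of r over the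
  -- range of Θ.
  let Θ : ℝ → ℝ := fun x => α * T (a * x + b) + (x - α * (a * x + b))
  have haα : α * a = θ := by rw [ha, hθ]; ring
  have hΘd : ∀ x, HasDerivAt Θ (θ * T' (a * x + b) + (1 - θ)) x := fun x => by
    have h1 : HasDerivAt (fun x => a * x + b) a x := by
      simpa using ((hasDerivAt_id x).const_mul a).add_const b
    have h2 := ((hd (a * x + b)).comp x h1).const_mul α
    have h3 := h2.add ((hasDerivAt_id x).sub (h1.const_mul α))
    have h4 : HasDerivAt Θ (α * (T' (a * x + b) * a) + (1 - α * a)) x := h3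
    exact h4.congr_deriv (by rw [← haα]; ring)
  have hΘpos : ∀ x, 0 < θ * T' (a * x + b) + (1 - θ) := fun x =>
    add_pos_of_nonneg_of_pos (mul_nonneg hθ0 (hT'pos _).le) hθ1
  have hΘm : StrictMono Θ := strictMono_of_deriv_pos fun x => by
    rw [(hΘd x).deriv]; exact hΘpos x
  have hcv := lintegral_comp_mul_deriv hΘm hΘd (fun y => ENNReal.ofReal (r y))
  calc _ = ∫⁻ x, ENNReal.ofReal (θ * T' (a * x + b) + (1 - θ)) * ENNReal.ofReal (r (Θ x)) := by
        refine lintegral_congr fun x => ?_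
        simp only [F, Θ, gaussianPDF]
        have hp := gaussianPDFReal_pos 0 sY x hsY0
        rw [← ENNReal.ofReal_mul hp.le, ← ENNReal.ofReal_mul (hΘpos x).le]
        congr 1
        field_simp
    _ = ∫⁻ y in Set.range Θ, ENNReal.ofReal (r y) := hcv.symm
    _ ≤ ∫⁻ y, ENNReal.ofReal (r y) := setLIntegral_le_lintegral _ _
    _ ≤ 1 := hr1

end EntropyPower

/-! ### The linearised entropy inequality: moments, weights and output law -/

section EntropyContraction

/-- `V ∼ N(0, t)`, `X = a V + N(0, r) ∼ N(0, τ)`, and in the forward direction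
`V = α X + N(0, ν)`. -/
structure IsGaussianPair (t r τ ν : ℝ≥0) (a α : ℝ) : Prop where
  ht : t ≠ 0
  hr : r ≠ 0
  hτ : (τ : ℝ) = a ^ 2 * t + r
  hν : (ν : ℝ) * τ = t * r
  hα : α * τ = a * t

namespace IsGaussianPair

variable {t r τ ν : ℝ≥0} {a α : ℝ}

theorem t_pos (hP : IsGaussianPair t r τ ν a α) : (0 : ℝ) < t := by
  have := hP.ht; positivity

theorem r_pos (hP : IsGaussianPair t r τ ν a α) : (0 : ℝ) < r := by
  have := hP.hr; positivity

theorem τ_pos (hP : IsGaussianPair t r τ ν a α) : (0 : ℝ) < τ := by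
  have := hP.t_pos; have := hP.r_pos
  rw [hP.hτ]; positivity

theorem ν_pos (hP : IsGaussianPair t r τ ν a α) : (0 : ℝ) < ν := by
  have h := mul_pos hP.t_pos hP.r_pos
  rw [← hP.hν] at h
  exact pos_of_mul_pos_left h hP.τ_pos.le

theorem τ_ne (hP : IsGaussianPair t r τ ν a α) : τ ≠ 0 := by
  have := hP.τ_pos; rintro rfl; simp at this

theorem ν_ne (hP : IsGaussianPair t r τ ν a α) : ν ≠ 0 := by
  have := hP.ν_pos; rintro rfl; simp at this

theorem t_eq (hP : IsGaussianPair t r τ ν a α) : (t : ℝ) = α ^ 2 * τ + ν := by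
  have hτ := hP.τ_pos
  have h1 : α = a * t / τ := by field_simp; linarith [hP.hα]
  have h2 : (ν : ℝ) = t * r / τ := by field_simp; linarith [hP.hν]
  rw [h1, h2]
  field_simp
  rw [hP.hτ]
  ring

end IsGaussianPair

/-- The noise is centred and independent of the signal, so the cross term has mean zero. -/
theorem integral_sq_add_noise {s ν : ℝ≥0} (α : ℝ) {f : ℝ → ℝ}
    (hf : MemLp f 2 (gaussianReal 0 s)) :
    Integrable (fun p : ℝ × ℝ => (α * f p.1 + p.2) ^ 2)
        ((gaussianReal 0 s).prod (gaussianReal 0 ν)) ∧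
      ∫ p, (α * f p.1 + p.2) ^ 2 ∂((gaussianReal 0 s).prod (gaussianReal 0 ν))
        = α ^ 2 * ∫ x, f x ^ 2 ∂(gaussianReal 0 s) + ν := by
  have e : (fun p : ℝ × ℝ => (α * f p.1 + p.2) ^ 2)
      = fun p => α ^ 2 * (f p.1 ^ 2) + ((2 * α) * (f p.1 * p.2) + p.2 ^ 2) := by
    funext p; ring
  have i1 : Integrable (fun p : ℝ × ℝ => α ^ 2 * (f p.1 ^ 2))
      ((gaussianReal 0 s).prod (gaussianReal 0 ν)) :=
    (hf.integrable_sq.comp_fst _).const_mul _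
  have i2 : Integrable (fun p : ℝ × ℝ => (2 * α) * (f p.1 * p.2))
      ((gaussianReal 0 s).prod (gaussianReal 0 ν)) :=
    ((hf.integrable (by norm_num)).mul_prod (integrable_id_gaussianReal ν)).const_mul _
  have i3 : Integrable (fun p : ℝ × ℝ => p.2 ^ 2)
      ((gaussianReal 0 s).prod (gaussianReal 0 ν)) :=
    (integrable_sq_gaussianReal ν).comp_snd _
  have i23 : Integrable (fun p : ℝ × ℝ => (2 * α) * (f p.1 * p.2) + p.2 ^ 2)
      ((gaussianReal 0 s).prod (gaussianReal 0 ν)) := i2.add i3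
  rw [e]
  refine ⟨i1.add i23, ?_⟩
  rw [integral_add i1 i23, integral_add i2 i3, integral_const_mul, integral_const_mul,
    integral_fun_fst (fun x => f x ^ 2), integral_fun_snd (fun x => x ^ 2),
    integral_prod_mul f (fun x => x), integral_sq_gaussianReal]
  simp

/-- The constant in the entropy contraction inequality. -/
noncomputable def contractionConst (t τ s sY θ : ℝ) : ℝ :=
  (Real.log (t / sY) - θ * Real.log (τ / s)) / 2

/-- The quadratic weight in the entropy contraction inequality. -/
noncomputable def contractionWeight (t τ s sY θ α x : ℝ) : ℝ :=
  contractionConst t τ s sY θ + (α ^ 2 / t - θ / τ) / 2 * (x ^ 2 - τ)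

/-- Feeding the law of density h through the forward channel gives an output whose density relative
to N(0,t) is the average of h over the backward channel; this is self-adjointness of the Gaussian
pair. It identifies the law of αT + N, where T is evaluated at the reference input. -/
theorem integral_output_eq {t r τ ν s : ℝ≥0} {a α : ℝ} (hP : IsGaussianPair t r τ ν a α)
    {h T φ : ℝ → ℝ} {M B : ℝ} (hh : Measurable h) (hh0 : ∀ x, 0 ≤ h x) (hhM : ∀ x, h x ≤ M)
    (hT : Measurable T)
    (hmap : (gaussianReal 0 s).map T
      = (gaussianReal 0 τ).withDensity (fun x => ENNReal.ofReal (h x)))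
    (hφ : Measurable φ) (hφB : ∀ y, ‖φ y‖ ≤ B) :
    ∫ p, φ (α * T p.1 + p.2) ∂((gaussianReal 0 s).prod (gaussianReal 0 ν))
      = ∫ v, (∫ u, h (a * v + u) ∂(gaussianReal 0 r)) * φ v ∂(gaussianReal 0 t) := by
  have hb1 : Integrable (fun p : ℝ × ℝ => φ (α * T p.1 + p.2))
      ((gaussianReal 0 s).prod (gaussianReal 0 ν)) :=
    Integrable.of_bound (Measurable.aestronglyMeasurable (by fun_prop)) B (Eventually.of_forall fun p => hφB _)
  have hbd : ∀ x y, ‖h x * φ y‖ ≤ M * B := fun x y => by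
    rw [norm_mul, Real.norm_of_nonneg (hh0 x)]
    exact mul_le_mul (hhM x) (hφB y) (norm_nonneg _) ((hh0 x).trans (hhM x))
  have hb2 : Integrable (fun p : ℝ × ℝ => h p.1 * φ (α * p.1 + p.2))
      ((gaussianReal 0 τ).prod (gaussianReal 0 ν)) :=
    Integrable.of_bound (Measurable.aestronglyMeasurable (by fun_prop)) (M * B) (Eventually.of_forall fun p => hbd _ _)
  have hb3 : Integrable (fun p : ℝ × ℝ => h (a * p.1 + p.2) * φ p.1)
      ((gaussianReal 0 t).prod (gaussianReal 0 r)) :=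
    Integrable.of_bound (Measurable.aestronglyMeasurable (by fun_prop)) (M * B) (Eventually.of_forall fun p => hbd _ _)
  have hsm : StronglyMeasurable fun x => ∫ n, φ (α * x + n) ∂(gaussianReal 0 ν) :=
    StronglyMeasurable.integral_prod_right' (f := fun p : ℝ × ℝ => φ (α * p.1 + p.2))
      (Measurable.stronglyMeasurable (by fun_prop))
  rw [integral_prod _ hb1]
  calc ∫ x, (∫ n, φ (α * T x + n) ∂(gaussianReal 0 ν)) ∂(gaussianReal 0 s)
      = ∫ x, (∫ n, φ (α * x + n) ∂(gaussianReal 0 ν)) ∂((gaussianReal 0 s).map T) :=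
        (integral_map hT.aemeasurable hsm.aestronglyMeasurable).symm
    _ = ∫ x, h x * (∫ n, φ (α * x + n) ∂(gaussianReal 0 ν)) ∂(gaussianReal 0 τ) := by
        rw [hmap, integral_withDensity_eq_integral_toReal_smul hh.ennreal_ofReal
          (Eventually.of_forall fun x => ENNReal.ofReal_lt_top)]
        refine integral_congr_ae (Eventually.of_forall fun x => ?_)
        simp [ENNReal.toReal_ofReal (hh0 x)]
    _ = ∫ p, h p.1 * φ (α * p.1 + p.2) ∂((gaussianReal 0 τ).prod (gaussianReal 0 ν)) := by
        rw [integral_prod _ hb2]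
        refine integral_congr_ae (Eventually.of_forall fun x => ?_)
        simp only [integral_const_mul]
    _ = ∫ q : ℝ × ℝ, h q.1 * φ q.2 ∂(((gaussianReal 0 τ).prod (gaussianReal 0 ν)).map
          (fun p => (p.1, α * p.1 + p.2))) := by
        rw [integral_map (by fun_prop) (Measurable.aestronglyMeasurable (by fun_prop))]
    _ = ∫ p, h (a * p.1 + p.2) * φ p.1 ∂((gaussianReal 0 t).prod (gaussianReal 0 r)) := by
        rw [← gaussian_pair_reverse hP.ht hP.hr hP.hτ hP.hν hP.hα,
          integral_map (by fun_prop) (Measurable.aestronglyMeasurable (by fun_prop))]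
    _ = _ := by
        rw [integral_prod _ hb3]
        refine integral_congr_ae (Eventually.of_forall fun x => ?_)
        simp only [integral_mul_const]

end EntropyContraction

/-! ### The entropy inequality for continuous probability densities -/

section EntropyContractionContinuous

/-- Weighted AM–GM in the form T^θ ≤ θT + (1 − θ). It replaces the Jacobian of the output map by a
power of the Jacobian of the transport, whose logarithm is a difference of log-densities. -/
theorem exp_log_combination_le {g p q T θ : ℝ} (hg : 0 < g) (hp : 0 < p) (hq : 0 < q) (hT : 0 < T)
    (hθ0 : 0 ≤ θ) (hθ1 : θ ≤ 1) :
    Real.exp (Real.log g + Real.log p + θ * Real.log T - Real.log q)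
      ≤ g * p * (θ * T + (1 - θ)) / q := by
  rw [Real.exp_sub, Real.exp_add, Real.exp_add, Real.exp_log hg, Real.exp_log hp, Real.exp_log hq]
  have h : Real.exp (θ * Real.log T) ≤ θ * T + (1 - θ) := by
    have := Real.geom_mean_le_arith_mean2_weighted hθ0 (sub_nonneg.2 hθ1) hT.le zero_le_one
      (by ring)
    rw [Real.one_rpow, mul_one, mul_one, Real.rpow_def_of_pos hT] at this
    rwa [mul_comm θ]
  gcongr

/-- Let X ∼ N(0,s) be the reference input, T(X) the given input, and N the noise. The logarithm V of
the ratio in `lintegral_rearranged_density_le`, with T^θ in place of the arithmetic mean, has E exp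
V ≤ 1 and hence E V ≤ 0. Expanding E V gives the entropies of the output and of the input, and
second moments which make up the quadratic weight. Equality holds when T is the identity, that is,
when the input law is N(0,s). -/
theorem IsGaussianPair.entropy_contraction_of_continuous_of_integral_eq_one
    {t r τ ν s sY : ℝ≥0} {a α : ℝ} (hP : IsGaussianPair t r τ ν a α)
    (hs : s ≠ 0) (hsY : (sY : ℝ) = α ^ 2 * s + ν) {h : ℝ → ℝ} (hc : Continuous h) {ε M : ℝ}
    (hε : 0 < ε) (hεh : ∀ x, ε ≤ h x) (hM : ∀ x, h x ≤ M)
    (h1 : ∫ x, h x ∂(gaussianReal 0 τ) = 1) :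
    ∫ v, (∫ u, h (a * v + u) ∂(gaussianReal 0 r))
        * Real.log (∫ u, h (a * v + u) ∂(gaussianReal 0 r)) ∂(gaussianReal 0 t)
      ≤ α ^ 2 * s / sY * ∫ x, h x * Real.log (h x) ∂(gaussianReal 0 τ)
        + ∫ x, h x * contractionWeight t τ s sY (α ^ 2 * s / sY) α x ∂(gaussianReal 0 τ) := by
  have hs' : (0 : ℝ) < s := by positivity
  have hsY' : (0 : ℝ) < sY := by have := hP.ν_pos; rw [hsY]; positivity
  have hsY0 : sY ≠ 0 := by rintro rfl; simp at hsY'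
  have hτ0 := hP.τ_ne
  have hν0 := hP.ν_ne
  have hτ' := hP.τ_pos
  have ht' := hP.t_pos
  have hteq := hP.t_eq
  set θ : ℝ := α ^ 2 * s / sY with hθ
  have hθ0 : 0 ≤ θ := by positivity
  have hθ1 : θ ≤ 1 := by
    rw [hθ, div_le_one hsY', hsY]; linarith [hP.ν_pos]
  have hhpos : ∀ x, 0 < h x := fun x => hε.trans_le (hεh x)
  have hhm : Measurable h := hc.measurable
  have hi : ∀ (m : Measure ℝ) [IsProbabilityMeasure m] (b : ℝ), Integrable (fun u => h (b + u)) m :=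
    fun m _ b => Integrable.of_bound (Measurable.aestronglyMeasurable (by fun_prop)) M
      (Eventually.of_forall fun u => by rw [Real.norm_of_nonneg (hhpos _).le]; exact hM _)
  have hi0 : ∀ (m : Measure ℝ) [IsProbabilityMeasure m], Integrable h m := fun m _ => by
    simpa using hi m 0
  obtain ⟨T, hTm, hTd, hTl⟩ := exists_gaussian_transport hs hτ0 hc hhpos (hi0 _) h1
  have hTmeas : Measurable T := hTm.monotone.measurable
  have hmap : (gaussianReal 0 s).map T
      = (gaussianReal 0 τ).withDensity (fun x => ENNReal.ofReal (h x)) := by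
    refine Measure.ext_of_lintegral _ fun F hF => ?_
    rw [lintegral_map hF hTmeas, hTl F hF, lintegral_withDensity_eq_lintegral_mul _
      hhm.ennreal_ofReal hF]
    rfl
  set g : ℝ → ℝ := fun v => ∫ u, h (a * v + u) ∂(gaussianReal 0 r) with hgdef
  have hgm : Measurable g := StronglyMeasurable.measurable <|
    StronglyMeasurable.integral_prod_right' (f := fun p : ℝ × ℝ => h (a * p.1 + p.2))
      (Measurable.stronglyMeasurable (by fun_prop))
  have hεg : ∀ v, ε ≤ g v := fun v => by
    have := integral_mono (integrable_const ε) (hi (gaussianReal 0 r) (a * v))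
      (fun u => hεh (a * v + u))
    simpa using this
  have hgM : ∀ v, g v ≤ M := fun v => by
    have := integral_mono (hi (gaussianReal 0 r) (a * v)) (integrable_const M)
      (fun u => hM (a * v + u))
    simpa using this
  have hgpos : ∀ v, 0 < g v := fun v => hε.trans_le (hεg v)
  have hlogB : ∀ y, ε ≤ y → y ≤ M → ‖Real.log y‖ ≤ |Real.log ε| + |Real.log M| := by
    intro y hy1 hy2
    have l1 := Real.log_le_log hε hy1
    have l2 := Real.log_le_log (hε.trans_le hy1) hy2
    rw [Real.norm_eq_abs, abs_le]
    constructor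
    · linarith [neg_abs_le (Real.log ε), abs_nonneg (Real.log M)]
    · linarith [le_abs_self (Real.log M), abs_nonneg (Real.log ε)]
  -- integrals over the law of the rearranged variable
  have hT_int : ∀ F : ℝ → ℝ, Measurable F →
      ∫ x, F (T x) ∂(gaussianReal 0 s) = ∫ x, h x * F x ∂(gaussianReal 0 τ) := fun F hF => by
    rw [← integral_map (f := F) hTmeas.aemeasurable hF.aestronglyMeasurable, hmap,
      integral_withDensity_eq_integral_toReal_smul hhm.ennreal_ofReal
      (Eventually.of_forall fun x => ENNReal.ofReal_lt_top)]
    refine integral_congr_ae (Eventually.of_forall fun x => ?_)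
    simp [ENNReal.toReal_ofReal (hhpos x).le]
  have hsqh : Integrable (fun x => h x * x ^ 2) (gaussianReal 0 τ) :=
    (integrable_sq_gaussianReal τ).bdd_mul (c := M) hhm.aestronglyMeasurable
      (Eventually.of_forall fun x => by rw [Real.norm_of_nonneg (hhpos _).le]; exact hM _)
  have hT_sq : Integrable (fun x => T x ^ 2) (gaussianReal 0 s) := by
    have : Integrable (fun x : ℝ => x ^ 2) ((gaussianReal 0 s).map T) := by
      rw [hmap, integrable_withDensity_iff_integrable_smul' hhm.ennreal_ofReal
        (Eventually.of_forall fun x => ENNReal.ofReal_lt_top)]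
      refine hsqh.congr (Eventually.of_forall fun x => ?_)
      simp [ENNReal.toReal_ofReal (hhpos x).le]
    exact (integrable_map_measure (by fun_prop) hTmeas.aemeasurable).1 this
  have hT2 : MemLp T 2 (gaussianReal 0 s) :=
    (memLp_two_iff_integrable_sq hTmeas.aestronglyMeasurable).2 hT_sq
  obtain ⟨iY, eY⟩ := integral_sq_add_noise (ν := ν) α hT2
  obtain ⟨iA, eA⟩ := integral_sq_add_noise (s := s) (ν := ν) α (f := fun x => x)
    (memLp_id_gaussianReal' 2 (by simp))
  rw [integral_sq_gaussianReal] at eA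
  set m2 : ℝ := ∫ x, h x * x ^ 2 ∂(gaussianReal 0 τ) with hm2
  rw [hT_int (fun x => x ^ 2) (by fun_prop), ← hm2] at eY
  set E := (gaussianReal 0 s).prod (gaussianReal 0 ν) with hE
  have iG : Integrable (fun p : ℝ × ℝ => Real.log (g (α * T p.1 + p.2))) E :=
    Integrable.of_bound (Measurable.aestronglyMeasurable (by fun_prop)) _
      (Eventually.of_forall fun p => hlogB _ (hεg _) (hgM _))
  have eG : ∫ p, Real.log (g (α * T p.1 + p.2)) ∂E
      = ∫ v, g v * Real.log (g v) ∂(gaussianReal 0 t) :=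
    integral_output_eq hP hhm (fun x => (hhpos x).le) hM hTmeas hmap
      (φ := fun y => Real.log (g y)) (by fun_prop) (fun y => hlogB _ (hεg y) (hgM y))
  have iH : Integrable (fun p : ℝ × ℝ => Real.log (h (T p.1))) E :=
    Integrable.of_bound (Measurable.aestronglyMeasurable (by fun_prop)) _
      (Eventually.of_forall fun p => hlogB _ (hεh _) (hM _))
  have eH : ∫ p, Real.log (h (T p.1)) ∂E = ∫ x, h x * Real.log (h x) ∂(gaussianReal 0 τ) := by
    rw [hE, integral_fun_fst (fun x => Real.log (h (T x)))]
    rw [hT_int (fun x => Real.log (h x)) (by fun_prop)]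
    simp
  have iX : Integrable (fun p : ℝ × ℝ => p.1 ^ 2) E := (integrable_sq_gaussianReal s).comp_fst _
  have eX : ∫ p, p.1 ^ 2 ∂E = s := by
    rw [hE, integral_fun_fst (fun x => x ^ 2), integral_sq_gaussianReal]; simp
  have iT : Integrable (fun p : ℝ × ℝ => T p.1 ^ 2) E := hT_sq.comp_fst _
  have eT : ∫ p, T p.1 ^ 2 ∂E = m2 := by
    rw [hE, integral_fun_fst (fun x => T x ^ 2), hT_int (fun x => x ^ 2) (by fun_prop)]; simp [hm2]
  -- the logarithm of the ratio
  let T' : ℝ → ℝ := fun x => gaussianPDFReal 0 s x / (h (T x) * gaussianPDFReal 0 τ (T x))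
  have hT'pos : ∀ x, 0 < T' x := fun x => div_pos (gaussianPDFReal_pos 0 s x hs)
    (mul_pos (hhpos _) (gaussianPDFReal_pos 0 τ _ hτ0))
  have mp1 := measurable_gaussianPDFReal 0 s
  have mp2 := measurable_gaussianPDFReal 0 τ
  have mp3 := measurable_gaussianPDFReal 0 t
  have mp4 := measurable_gaussianPDFReal 0 sY
  have hT'm : Measurable T' := by fun_prop
  -- Here g times the N(0,t) density is the Lebesgue density of the output αT + N.
  let V : ℝ × ℝ → ℝ := fun p => Real.log (g (α * T p.1 + p.2))
    + Real.log (gaussianPDFReal 0 t (α * T p.1 + p.2)) + θ * Real.log (T' p.1)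
    - Real.log (gaussianPDFReal 0 sY (α * p.1 + p.2))
  have hVexp : ∀ p, Real.exp (V p) ≤ g (α * T p.1 + p.2) * gaussianPDFReal 0 t (α * T p.1 + p.2)
      * (θ * T' p.1 + (1 - θ)) / gaussianPDFReal 0 sY (α * p.1 + p.2) := fun p =>
    exp_log_combination_le (hgpos _) (gaussianPDFReal_pos 0 t _ hP.ht)
      (gaussianPDFReal_pos 0 sY _ hsY0) (hT'pos _) hθ0 hθ1
  have hVm : Measurable V := by fun_prop
  have hg1 : ∫ v, g v ∂(gaussianReal 0 t) = 1 := by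
    rw [← h1, ← map_prod_gaussianReal hP.hτ, integral_map (by fun_prop)
      (Measurable.aestronglyMeasurable (by fun_prop)), integral_prod]
    exact Integrable.of_bound (Measurable.aestronglyMeasurable (by fun_prop)) M
      (Eventually.of_forall fun u => by rw [Real.norm_of_nonneg (hhpos _).le]; exact hM _)
  have hr1 : ∫⁻ y, ENNReal.ofReal (g y * gaussianPDFReal 0 t y) ≤ 1 := by
    have : ∫⁻ y, ENNReal.ofReal (g y) ∂(gaussianReal 0 t) = 1 := by
      rw [← ofReal_integral_eq_lintegral_ofReal, hg1, ENNReal.ofReal_one]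
      · exact Integrable.of_bound (Measurable.aestronglyMeasurable (by fun_prop)) M
          (Eventually.of_forall fun u => by rw [Real.norm_of_nonneg (hgpos _).le]; exact hgM _)
      · exact Eventually.of_forall fun v => (hgpos v).le
    rw [← this, lintegral_gaussianReal hP.ht (by fun_prop)]
    refine (lintegral_congr fun y => ?_).le
    rw [ENNReal.ofReal_mul (hgpos y).le, gaussianPDF, mul_comm]
  have hexp1 : ∫⁻ p, ENNReal.ofReal (Real.exp (V p)) ∂E ≤ 1 := by
    refine (lintegral_mono fun p => ENNReal.ofReal_le_ofReal (hVexp p)).trans ?_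
    exact lintegral_rearranged_density_le hs hν0 hsY hTm hTd hT'm hT'pos
      (r := fun y => g y * gaussianPDFReal 0 t y) (by fun_prop) hr1
  have hexpi : Integrable (fun p => Real.exp (V p)) E := by
    refine ⟨Measurable.aestronglyMeasurable (by fun_prop), ?_⟩
    rw [hasFiniteIntegral_iff_ofReal (Eventually.of_forall fun p => (Real.exp_pos _).le)]
    exact hexp1.trans_lt ENNReal.one_lt_top
  -- Written in this way, every summand is integrable on its own: the logarithms are bounded since ε
  -- ≤ h ≤ M, and all the rest are squares and constants.
  have hVeq : V = fun p => Real.log (g (α * T p.1 + p.2)) + ((-θ) * Real.log (h (T p.1))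
      + ((-(1 / (2 * t))) * (α * T p.1 + p.2) ^ 2 + ((-(θ / (2 * s))) * p.1 ^ 2
      + ((θ / (2 * τ)) * T p.1 ^ 2 + ((1 / (2 * sY)) * (α * p.1 + p.2) ^ 2
      + (Real.log (2 * Real.pi * sY) / 2 - Real.log (2 * Real.pi * t) / 2
        + θ * (Real.log (2 * Real.pi * τ) / 2 - Real.log (2 * Real.pi * s) / 2))))))) := by
    funext p
    have l : Real.log (T' p.1) = Real.log (gaussianPDFReal 0 s p.1)
        - (Real.log (h (T p.1)) + Real.log (gaussianPDFReal 0 τ (T p.1))) := by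
      rw [Real.log_div (gaussianPDFReal_pos 0 s _ hs).ne'
        (mul_pos (hhpos _) (gaussianPDFReal_pos 0 τ _ hτ0)).ne', Real.log_mul (hhpos _).ne'
        (gaussianPDFReal_pos 0 τ _ hτ0).ne']
    simp only [V, l, log_gaussianPDFReal hP.ht, log_gaussianPDFReal hs, log_gaussianPDFReal hτ0,
      log_gaussianPDFReal hsY0]
    field_simp
    ring
  have j6 := iA.const_mul (1 / (2 * (sY : ℝ)))
  have j5 := iT.const_mul (θ / (2 * τ))
  have j4 := iX.const_mul (-(θ / (2 * s)))
  have j3 := iY.const_mul (-(1 / (2 * (t : ℝ))))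
  have j2 := iH.const_mul (-θ)
  have k7 := integrable_const (μ := E) (Real.log (2 * Real.pi * sY) / 2
    - Real.log (2 * Real.pi * t) / 2
    + θ * (Real.log (2 * Real.pi * τ) / 2 - Real.log (2 * Real.pi * s) / 2))
  have hVi : Integrable V E := by
    rw [hVeq]
    exact iG.add (j2.add (j3.add (j4.add (j5.add (j6.add k7)))))
  -- Jensen's inequality, through V ≤ exp V − 1.
  have hV0 : ∫ p, V p ∂E ≤ 0 := by
    have hle : ∫ p, V p ∂E ≤ ∫ p, (Real.exp (V p) - 1) ∂E :=
      integral_mono hVi (hexpi.sub (integrable_const 1)) fun p => by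
        have := Real.add_one_le_exp (V p); simp only; linarith
    have he : ∫ p, Real.exp (V p) ∂E ≤ 1 := by
      rw [integral_eq_lintegral_of_nonneg_ae (Eventually.of_forall fun p => (Real.exp_pos _).le)
        hexpi.aestronglyMeasurable]
      exact ENNReal.toReal_le_of_le_ofReal zero_le_one (by simpa using hexp1)
    rw [integral_sub hexpi (integrable_const 1)] at hle
    simp at hle
    linarith
  have hVint : ∫ p, V p ∂E = ∫ v, g v * Real.log (g v) ∂(gaussianReal 0 t)
      + ((-θ) * ∫ x, h x * Real.log (h x) ∂(gaussianReal 0 τ)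
      + ((-(1 / (2 * t))) * (α ^ 2 * m2 + ν) + ((-(θ / (2 * s))) * s
      + ((θ / (2 * τ)) * m2 + ((1 / (2 * sY)) * (α ^ 2 * s + ν)
      + (Real.log (2 * Real.pi * sY) / 2 - Real.log (2 * Real.pi * t) / 2
        + θ * (Real.log (2 * Real.pi * τ) / 2 - Real.log (2 * Real.pi * s) / 2))))))) := by
    rw [hVeq]
    refine (integral_add' iG (j2.add (j3.add (j4.add (j5.add (j6.add k7)))))).trans ?_
    rw [integral_add' j2 (j3.add (j4.add (j5.add (j6.add k7)))),
      integral_add' j3 (j4.add (j5.add (j6.add k7))), integral_add' j4 (j5.add (j6.add k7)),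
      integral_add' j5 (j6.add k7), integral_add' j6 k7, integral_const_mul, integral_const_mul,
      integral_const_mul, integral_const_mul, integral_const_mul, eG, eH, eX, eT, eY, eA]
    simp
  have hw : ∫ x, h x * contractionWeight t τ s sY θ α x ∂(gaussianReal 0 τ)
      = contractionConst t τ s sY θ + (α ^ 2 / t - θ / τ) / 2 * (m2 - τ) := by
    have : (fun x => h x * contractionWeight t τ s sY θ α x)
        = fun x => (contractionConst t τ s sY θ - (α ^ 2 / t - θ / τ) / 2 * τ) * h x
          + (α ^ 2 / t - θ / τ) / 2 * (h x * x ^ 2) := by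
      funext x; rw [contractionWeight]; ring
    rw [this, integral_add ((hi0 _).const_mul _) (hsqh.const_mul _), integral_const_mul,
      integral_const_mul, h1]
    ring
  rw [hw, contractionConst, Real.log_div ht'.ne' hsY'.ne', Real.log_div hτ'.ne' hs'.ne']
  rw [hVint] at hV0
  have lg : ∀ {x : ℝ}, 0 < x → Real.log (2 * Real.pi * x) = Real.log (2 * Real.pi) + Real.log x :=
    fun {x} hx => Real.log_mul (by positivity) hx.ne'
  rw [lg ht', lg hs', lg hτ', lg hsY'] at hV0
  have e1 : (1 / (2 * (sY : ℝ))) * (α ^ 2 * s + ν) = 1 / 2 := by rw [← hsY]; field_simp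
  have e2 : (-(θ / (2 * (s : ℝ)))) * s = -θ / 2 := by field_simp
  have e3 : (-(1 / (2 * (t : ℝ)))) * (α ^ 2 * m2 + ν)
      = -(1 / 2) - α ^ 2 / t / 2 * (m2 - τ) := by
    field_simp
    rw [hteq]; ring
  have e4 : θ / (2 * (τ : ℝ)) * m2 = θ / τ / 2 * (m2 - τ) + θ / 2 := by field_simp; ring
  rw [e1, e2, e3, e4] at hV0
  linarith

end EntropyContractionContinuous

/-! ### Unnormalised and measurable densities -/

section EntropyContractionMeasurable

theorem negMulLog_mem_Icc {x : ℝ} (h0 : 0 ≤ x) (h1 : x ≤ 1) : ‖Real.negMulLog x‖ ≤ 1 := by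
  rw [Real.norm_of_nonneg (Real.negMulLog_nonneg h0 h1)]
  linarith [Real.negMulLog_le_one_sub_self h0]

theorem integral_mem_Icc {α : Type*} [MeasurableSpace α] {μ : Measure α} [IsProbabilityMeasure μ]
    {f : α → ℝ} (hf : Measurable f) {a b : ℝ} (ha : ∀ x, a ≤ f x) (hb : ∀ x, f x ≤ b) :
    Integrable f μ ∧ a ≤ ∫ x, f x ∂μ ∧ ∫ x, f x ∂μ ≤ b := by
  have hi : Integrable f μ := Integrable.of_bound hf.aestronglyMeasurable (|a| + |b|)
    (Eventually.of_forall fun x => by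
      rw [Real.norm_eq_abs, abs_le]
      constructor
      · linarith [ha x, neg_abs_le a, abs_nonneg b]
      · linarith [hb x, le_abs_self b, abs_nonneg a])
  refine ⟨hi, ?_, ?_⟩
  · simpa using integral_mono (integrable_const a) hi ha
  · simpa using integral_mono hi (integrable_const b) hb

theorem integrable_negMulLog {α : Type*} [MeasurableSpace α] {μ : Measure α}
    [IsProbabilityMeasure μ] {f : α → ℝ} (hf : Measurable f) (h0 : ∀ x, 0 ≤ f x)
    (h1 : ∀ x, f x ≤ 1) : Integrable (fun x => Real.negMulLog (f x)) μ :=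
  Integrable.of_bound (Measurable.aestronglyMeasurable (by fun_prop)) 1
    (Eventually.of_forall fun x => negMulLog_mem_Icc (h0 x) (h1 x))

/-- Bounded continuous functions are dense in L¹, and an L¹-convergent sequence has an a.e.
convergent subsequence; clamping to [ε, M] preserves continuity and the limit. -/
theorem exists_continuous_seq_tendsto_ae {μ : Measure ℝ} [IsProbabilityMeasure μ] {h : ℝ → ℝ}
    (hm : Measurable h) {ε M : ℝ} (hε : ∀ x, ε ≤ h x) (hM : ∀ x, h x ≤ M) :
    ∃ f : ℕ → ℝ → ℝ, (∀ k, Continuous (f k)) ∧ (∀ k x, ε ≤ f k x) ∧ (∀ k x, f k x ≤ M) ∧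
      ∀ᵐ x ∂μ, Tendsto (fun k => f k x) atTop (𝓝 (h x)) := by
  have hi : MemLp h 1 μ := memLp_one_iff_integrable.2 (integral_mem_Icc hm hε hM).1
  have hex : ∀ k : ℕ, ∃ g : BoundedContinuousFunction ℝ ℝ,
      eLpNorm (h - ⇑g) 1 μ ≤ ((k : ℝ≥0∞) + 1)⁻¹ ∧ MemLp (⇑g) 1 μ := fun k =>
    hi.exists_boundedContinuous_eLpNorm_sub_le (by simp) (by simp)
  choose g hg hgL using hex
  have htend : Tendsto (fun k => eLpNorm (⇑(g k) - h) 1 μ) atTop (𝓝 0) := by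
    refine tendsto_of_tendsto_of_tendsto_of_le_of_le tendsto_const_nhds ?_ (fun _ => zero_le)
      (fun k => by simpa only [eLpNorm_sub_comm] using hg k)
    have := ENNReal.tendsto_inv_nat_nhds_zero.comp (tendsto_add_atTop_nat 1)
    simpa [Function.comp_def] using this
  obtain ⟨ns, -, hns⟩ := (tendstoInMeasure_of_tendsto_eLpNorm one_ne_zero
    (fun k => (g k).continuous.aestronglyMeasurable) hm.aestronglyMeasurable
      htend).exists_seq_tendsto_ae
  refine ⟨fun k x => max ε (min M (g (ns k) x)), fun k => ?_, fun k x => le_max_left _ _,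
    fun k x => max_le ((hε x).trans (hM x)) (min_le_left _ _), ?_⟩
  · exact continuous_const.max (continuous_const.min (g (ns k)).continuous)
  · filter_upwards [hns] with x hx
    have := (tendsto_const_nhds (x := ε)).max ((tendsto_const_nhds (x := M)).min hx)
    rwa [min_eq_right (hM x), max_eq_right (hε x)] at this

/-- The normalised inequality for h / c, with c = ∫ h, multiplied by c. The normalising terms
contribute (1 − θ) c log c, which is the left-hand side. In this form it is linear in the weight and
can be summed over a partition. -/
theorem IsGaussianPair.entropy_contraction_of_continuous
    {t r τ ν s sY : ℝ≥0} {a α : ℝ} (hP : IsGaussianPair t r τ ν a α)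
    (hs : s ≠ 0) (hsY : (sY : ℝ) = α ^ 2 * s + ν) {h : ℝ → ℝ} (hc : Continuous h) {ε : ℝ}
    (hε : 0 < ε) (hεh : ∀ x, ε ≤ h x) (hM : ∀ x, h x ≤ 1) :
    (1 - α ^ 2 * s / sY) * Real.negMulLog (∫ x, h x ∂(gaussianReal 0 τ))
      ≤ ∫ v, Real.negMulLog (∫ u, h (a * v + u) ∂(gaussianReal 0 r)) ∂(gaussianReal 0 t)
        - α ^ 2 * s / sY * ∫ x, Real.negMulLog (h x) ∂(gaussianReal 0 τ)
        + ∫ x, h x * contractionWeight t τ s sY (α ^ 2 * s / sY) α x ∂(gaussianReal 0 τ) := by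
  obtain ⟨hi, hc1, hc2⟩ := integral_mem_Icc (μ := gaussianReal 0 τ) hc.measurable hεh hM
  set c : ℝ := ∫ x, h x ∂(gaussianReal 0 τ) with hcdef
  have hcpos : 0 < c := hε.trans_le hc1
  have hgm : Measurable fun v => ∫ u, h (a * v + u) ∂(gaussianReal 0 r) :=
    StronglyMeasurable.measurable <|
    StronglyMeasurable.integral_prod_right' (f := fun p : ℝ × ℝ => h (a * p.1 + p.2))
      (Measurable.stronglyMeasurable (by fun_prop))
  have hg : ∀ v, Integrable (fun u => h (a * v + u)) (gaussianReal 0 r) ∧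
      ε ≤ ∫ u, h (a * v + u) ∂(gaussianReal 0 r) ∧ ∫ u, h (a * v + u) ∂(gaussianReal 0 r) ≤ 1 :=
    fun v => integral_mem_Icc (by fun_prop) (fun _ => hεh _) (fun _ => hM _)
  have key := hP.entropy_contraction_of_continuous_of_integral_eq_one hs hsY
    (h := fun x => h x / c) (hc.div_const c) (ε := ε / c) (M := 1 / c) (by positivity)
    (fun x => by gcongr; exact hεh x) (fun x => by gcongr; exact hM x)
    (by rw [integral_div, ← hcdef, div_self hcpos.ne'])
  simp only [integral_div] at key
  have e : ∀ y, 0 < y → y / c * Real.log (y / c)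
      = (-(1 / c)) * Real.negMulLog y - Real.log c / c * y := fun y hy => by
    rw [Real.log_div hy.ne' hcpos.ne', Real.negMulLog]; ring
  have e1 : ∫ v, (∫ u, h (a * v + u) ∂(gaussianReal 0 r)) / c
        * Real.log ((∫ u, h (a * v + u) ∂(gaussianReal 0 r)) / c) ∂(gaussianReal 0 t)
      = (-(1 / c)) * ∫ v, Real.negMulLog (∫ u, h (a * v + u) ∂(gaussianReal 0 r))
          ∂(gaussianReal 0 t) - Real.log c / c * c := by
    have hcg : ∫ v, (∫ u, h (a * v + u) ∂(gaussianReal 0 r)) ∂(gaussianReal 0 t) = c := by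
      rw [hcdef, ← map_prod_gaussianReal hP.hτ, integral_map (by fun_prop)
        (Measurable.aestronglyMeasurable (by fun_prop)), integral_prod]
      exact (integral_mem_Icc (by fun_prop) (fun _ => hεh _) (fun _ => hM _)).1
    rw [integral_congr_ae (Eventually.of_forall fun v => e _ (hε.trans_le (hg v).2.1)),
      integral_sub, integral_const_mul, integral_const_mul, hcg]
    · exact (integrable_negMulLog hgm (fun v => hε.le.trans (hg v).2.1)
        (fun v => (hg v).2.2)).const_mul _
    · exact (integral_mem_Icc hgm (fun v => (hg v).2.1) (fun v => (hg v).2.2)).1.const_mul _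
  have e2 : ∫ x, h x / c * Real.log (h x / c) ∂(gaussianReal 0 τ)
      = (-(1 / c)) * ∫ x, Real.negMulLog (h x) ∂(gaussianReal 0 τ) - Real.log c / c * c := by
    rw [integral_congr_ae (Eventually.of_forall fun v => e _ (hε.trans_le (hεh v))),
      integral_sub, integral_const_mul, integral_const_mul]
    · exact (integrable_negMulLog hc.measurable (fun v => hε.le.trans (hεh v)) hM).const_mul _
    · exact hi.const_mul _
  have e3 : ∀ w : ℝ → ℝ, ∫ x, h x / c * w x ∂(gaussianReal 0 τ)
      = 1 / c * ∫ x, h x * w x ∂(gaussianReal 0 τ) := fun w => by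
    rw [← integral_const_mul]
    refine integral_congr_ae (Eventually.of_forall fun v => ?_)
    simp only; ring
  rw [e1, e2, e3] at key
  generalize α ^ 2 * (s : ℝ) / sY = θ at key ⊢
  have := mul_le_mul_of_nonneg_left key hcpos.le
  have hη : Real.negMulLog c = -(c * Real.log c) := by rw [Real.negMulLog]; ring
  rw [hη]
  field_simp at this ⊢
  linarith

theorem contractionWeight_continuous (t τ s sY θ α : ℝ) :
    Continuous (contractionWeight t τ s sY θ α) := by
  unfold contractionWeight; fun_prop

theorem integrable_contractionWeight (τ : ℝ≥0) (t s sY θ α : ℝ) :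
    Integrable (contractionWeight t τ s sY θ α) (gaussianReal 0 τ) := by
  unfold contractionWeight
  exact (integrable_const _).add (((integrable_sq_gaussianReal τ).sub
    (integrable_const _)).const_mul _)

/-- The quadratic part is proportional to x² − τ, which is centred under N(0,τ). -/
theorem integral_contractionWeight (τ : ℝ≥0) (t s sY θ α : ℝ) :
    ∫ x, contractionWeight t τ s sY θ α x ∂(gaussianReal 0 τ) = contractionConst t τ s sY θ := by
  unfold contractionWeight
  have hi : Integrable (fun x : ℝ => (α ^ 2 / t - θ / τ) / 2 * (x ^ 2 - τ)) (gaussianReal 0 τ) :=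
    ((integrable_sq_gaussianReal τ).sub (integrable_const _)).const_mul _
  rw [integral_add (integrable_const _) hi, integral_const_mul,
    integral_sub (integrable_sq_gaussianReal τ) (integrable_const _), integral_sq_gaussianReal]
  simp

/-- Every term is continuous under bounded a.e. convergence of h, so the continuous case passes to
the limit. -/
theorem IsGaussianPair.entropy_contraction
    {t r τ ν s sY : ℝ≥0} {a α : ℝ} (hP : IsGaussianPair t r τ ν a α)
    (hs : s ≠ 0) (hsY : (sY : ℝ) = α ^ 2 * s + ν) {h : ℝ → ℝ} (hm : Measurable h) {ε : ℝ}
    (hε : 0 < ε) (hεh : ∀ x, ε ≤ h x) (hM : ∀ x, h x ≤ 1) :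
    (1 - α ^ 2 * s / sY) * Real.negMulLog (∫ x, h x ∂(gaussianReal 0 τ))
      ≤ ∫ v, Real.negMulLog (∫ u, h (a * v + u) ∂(gaussianReal 0 r)) ∂(gaussianReal 0 t)
        - α ^ 2 * s / sY * ∫ x, Real.negMulLog (h x) ∂(gaussianReal 0 τ)
        + ∫ x, h x * contractionWeight t τ s sY (α ^ 2 * s / sY) α x ∂(gaussianReal 0 τ) := by
  obtain ⟨f, hfc, hfε, hfM, hlim⟩ :=
    exists_continuous_seq_tendsto_ae (μ := gaussianReal 0 τ) hm hεh hM
  have hf0 : ∀ k x, 0 ≤ f k x := fun k x => hε.le.trans (hfε k x)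
  have hfn : ∀ k x, ‖f k x‖ ≤ 1 := fun k x => by
    rw [Real.norm_of_nonneg (hf0 k x)]; exact hfM k x
  have hη := Real.continuous_negMulLog
  have l1 : Tendsto (fun k => ∫ x, f k x ∂(gaussianReal 0 τ)) atTop
      (𝓝 (∫ x, h x ∂(gaussianReal 0 τ))) :=
    tendsto_integral_of_dominated_convergence (fun _ => 1)
      (fun k => (hfc k).aestronglyMeasurable) (integrable_const _)
      (fun k => Eventually.of_forall (hfn k)) hlim
  have l2 : Tendsto (fun k => ∫ x, Real.negMulLog (f k x) ∂(gaussianReal 0 τ)) atTop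
      (𝓝 (∫ x, Real.negMulLog (h x) ∂(gaussianReal 0 τ))) :=
    tendsto_integral_of_dominated_convergence (fun _ => 1)
      (fun k => (hη.comp (hfc k)).aestronglyMeasurable) (integrable_const _)
      (fun k => Eventually.of_forall fun x => negMulLog_mem_Icc (hf0 k x) (hfM k x))
      (hlim.mono fun x hx => (hη.tendsto _).comp hx)
  have l3 : Tendsto (fun k => ∫ x, f k x * contractionWeight t τ s sY (α ^ 2 * s / sY) α x
      ∂(gaussianReal 0 τ)) atTop
      (𝓝 (∫ x, h x * contractionWeight t τ s sY (α ^ 2 * s / sY) α x ∂(gaussianReal 0 τ))) := by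
    refine tendsto_integral_of_dominated_convergence
      (fun x => ‖contractionWeight t τ s sY (α ^ 2 * s / sY) α x‖)
      (fun k => ((hfc k).mul (contractionWeight_continuous _ _ _ _ _ _)).aestronglyMeasurable)
      (integrable_contractionWeight τ _ _ _ _ _).norm
      (fun k => Eventually.of_forall fun x => ?_)
      (hlim.mono fun x hx => hx.mul_const _)
    rw [norm_mul]
    exact mul_le_of_le_one_left (norm_nonneg _) (hfn k x)
  -- Convergence almost everywhere for N(0,τ) descends to almost every backward fibre, because
  -- N(0,τ) is the law of av + u.
  have hlim' : ∀ᵐ v ∂(gaussianReal 0 t), ∀ᵐ u ∂(gaussianReal 0 r),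
      Tendsto (fun k => f k (a * v + u)) atTop (𝓝 (h (a * v + u))) := by
    rw [← map_prod_gaussianReal hP.hτ] at hlim
    exact Measure.ae_ae_of_ae_prod (ae_of_ae_map (by fun_prop) hlim)
  have hgm : ∀ φ : ℝ → ℝ, Measurable φ →
      Measurable fun v => ∫ u, φ (a * v + u) ∂(gaussianReal 0 r) := fun φ hφ =>
    StronglyMeasurable.measurable <|
    StronglyMeasurable.integral_prod_right' (f := fun p : ℝ × ℝ => φ (a * p.1 + p.2))
      (Measurable.stronglyMeasurable (by fun_prop))
  have l4 : Tendsto (fun k => ∫ v, Real.negMulLog (∫ u, f k (a * v + u) ∂(gaussianReal 0 r))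
      ∂(gaussianReal 0 t)) atTop
      (𝓝 (∫ v, Real.negMulLog (∫ u, h (a * v + u) ∂(gaussianReal 0 r)) ∂(gaussianReal 0 t))) := by
    refine tendsto_integral_of_dominated_convergence (fun _ => 1)
      (fun k => (hη.measurable.comp (hgm _ (hfc k).measurable)).aestronglyMeasurable)
      (integrable_const _) (fun k => Eventually.of_forall fun v => ?_)
      (hlim'.mono fun v hv => (hη.tendsto _).comp ?_)
    · obtain ⟨-, h1, h2⟩ := integral_mem_Icc (μ := gaussianReal 0 r)
        (f := fun u => f k (a * v + u)) ((hfc k).measurable.comp (by fun_prop))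
        (fun _ => hf0 k _) (fun _ => hfM k _)
      exact negMulLog_mem_Icc h1 h2
    · exact tendsto_integral_of_dominated_convergence (fun _ => 1)
        (fun k => ((hfc k).measurable.comp (by fun_prop)).aestronglyMeasurable)
        (integrable_const _) (fun k => Eventually.of_forall fun u => hfn k _) hv
  refine le_of_tendsto_of_tendsto' (((hη.tendsto _).comp l1).const_mul _)
    ((l4.sub (l2.const_mul _)).add l3) fun k => ?_
  exact hP.entropy_contraction_of_continuous hs hsY (hfc k) hε (hfε k) (hfM k)

end EntropyContractionMeasurable

/-! ### Tensorisation of the entropy inequality -/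

section Tensorization

theorem Measurable.integral_section {α β : Type*} [MeasurableSpace α] [MeasurableSpace β]
    {ν : Measure β} [SFinite ν] {f : α × β → ℝ} (hf : Measurable f) :
    Measurable fun x => ∫ y, f (x, y) ∂ν :=
  (StronglyMeasurable.integral_prod_right' hf.stronglyMeasurable).measurable

theorem Measurable.integral_section_fst {α β : Type*} [MeasurableSpace α] [MeasurableSpace β]
    {μ : Measure α} [SFinite μ] {f : α × β → ℝ} (hf : Measurable f) :
    Measurable fun y => ∫ x, f (x, y) ∂μ :=
  (StronglyMeasurable.integral_prod_left' hf.stronglyMeasurable).measurable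

/-- Superadditivity of entropy under a product reference measure. -/
theorem negMulLog_integral_add_le {α β : Type*} [MeasurableSpace α] [MeasurableSpace β]
    {μ : Measure α} {ν : Measure β} [IsProbabilityMeasure μ] [IsProbabilityMeasure ν]
    {h : α × β → ℝ} (hm : Measurable h) {ε : ℝ} (hε : 0 < ε) (hεh : ∀ x, ε ≤ h x)
    (hM : ∀ x, h x ≤ 1) :
    Real.negMulLog (∫ p, h p ∂(μ.prod ν)) + ∫ p, Real.negMulLog (h p) ∂(μ.prod ν)
      ≤ ∫ x, Real.negMulLog (∫ y, h (x, y) ∂ν) ∂μ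
        + ∫ y, Real.negMulLog (∫ x, h (x, y) ∂μ) ∂ν := by
  obtain ⟨hi, hM1, hM2⟩ := integral_mem_Icc (μ := μ.prod ν) hm hεh hM
  set m := ∫ p, h p ∂(μ.prod ν) with hmdef
  let F : α → ℝ := fun x => ∫ y, h (x, y) ∂ν
  let G : β → ℝ := fun y => ∫ x, h (x, y) ∂μ
  have hFm : Measurable F := hm.integral_section
  have hGm : Measurable G := hm.integral_section_fst
  have hF := fun x => (integral_mem_Icc (μ := ν) (f := fun y => h (x, y)) (by fun_prop)
    (fun y => hεh (x, y)) (fun y => hM (x, y))).2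
  have hG := fun y => (integral_mem_Icc (μ := μ) (f := fun x => h (x, y)) (by fun_prop)
    (fun x => hεh (x, y)) (fun x => hM (x, y))).2
  have hmpos : 0 < m := hε.trans_le hM1
  have hFpos : ∀ x, 0 < F x := fun x => hε.trans_le (hF x).1
  have hGpos : ∀ x, 0 < G x := fun x => hε.trans_le (hG x).1
  have hhpos : ∀ x, 0 < h x := fun x => hε.trans_le (hεh x)
  -- Nonnegativity of the mutual information of the law h / m: log x ≤ x − 1 at the ratio x =
  -- FG/(mh) of the product of the marginals to the joint density.
  have hptw : ∀ p : α × β, Real.negMulLog (h p) + h p * Real.log (F p.1) + h p * Real.log (G p.2)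
      ≤ Real.log m * h p + (F p.1 * G p.2 / m - h p) := fun p => by
    have hx : 0 < F p.1 * G p.2 / (m * h p) :=
      div_pos (mul_pos (hFpos _) (hGpos _)) (mul_pos hmpos (hhpos p))
    have h1 := mul_le_mul_of_nonneg_left (Real.log_le_sub_one_of_pos hx) (hhpos p).le
    rw [Real.log_div (mul_pos (hFpos _) (hGpos _)).ne' (mul_pos hmpos (hhpos p)).ne',
      Real.log_mul (hFpos _).ne' (hGpos _).ne', Real.log_mul hmpos.ne' (hhpos p).ne'] at h1
    have h2 : h p * (F p.1 * G p.2 / (m * h p) - 1) = F p.1 * G p.2 / m - h p := by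
      have := (hhpos p).ne'
      field_simp
    rw [h2] at h1
    rw [Real.negMulLog]
    linarith
  -- The lower bound ε serves to make the logarithms of the marginals bounded, hence the products
  -- integrable.
  have hlog : ∀ y, ε ≤ y → y ≤ 1 → ‖Real.log y‖ ≤ -Real.log ε := fun y h1 h2 => by
    rw [Real.norm_of_nonpos (Real.log_nonpos (hε.le.trans h1) h2)]
    linarith [Real.log_le_log hε h1]
  have i1 : Integrable (fun p => Real.negMulLog (h p)) (μ.prod ν) :=
    integrable_negMulLog hm (fun p => (hhpos p).le) hM
  have i2 : Integrable (fun p : α × β => h p * Real.log (F p.1)) (μ.prod ν) :=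
    hi.mul_bdd (c := -Real.log ε) (Measurable.aestronglyMeasurable (by fun_prop))
      (Eventually.of_forall fun p => hlog _ (hF _).1 (hF _).2)
  have i3 : Integrable (fun p : α × β => h p * Real.log (G p.2)) (μ.prod ν) :=
    hi.mul_bdd (c := -Real.log ε) (Measurable.aestronglyMeasurable (by fun_prop))
      (Eventually.of_forall fun p => hlog _ (hG _).1 (hG _).2)
  have iF : Integrable F μ := (integral_mem_Icc hFm (fun x => (hF x).1) (fun x => (hF x).2)).1
  have iG : Integrable G ν := (integral_mem_Icc hGm (fun x => (hG x).1) (fun x => (hG x).2)).1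
  have i4 : Integrable (fun p : α × β => F p.1 * G p.2 / m) (μ.prod ν) := (iF.mul_prod iG).div_const m
  have e2 : ∫ p : α × β, h p * Real.log (F p.1) ∂(μ.prod ν)
      = -∫ x, Real.negMulLog (F x) ∂μ := by
    rw [integral_prod _ i2, ← integral_neg]
    refine integral_congr_ae (Eventually.of_forall fun x => ?_)
    simp only [integral_mul_const, Real.negMulLog, F]
    ring
  have e3 : ∫ p : α × β, h p * Real.log (G p.2) ∂(μ.prod ν)
      = -∫ x, Real.negMulLog (G x) ∂ν := by
    rw [integral_prod_symm _ i3, ← integral_neg]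
    refine integral_congr_ae (Eventually.of_forall fun x => ?_)
    simp only [integral_mul_const, Real.negMulLog, G]
    ring
  have e4 : ∫ p : α × β, F p.1 * G p.2 / m ∂(μ.prod ν) = m := by
    rw [integral_div, integral_prod_mul]
    have f1 : ∫ x, F x ∂μ = m := (integral_prod _ hi).symm
    have f2 : ∫ x, G x ∂ν = m := (integral_prod_symm _ hi).symm
    rw [f1, f2]; field_simp
  have hint := integral_mono ((i1.add i2).add i3) ((hi.const_mul (Real.log m)).add (i4.sub hi)) hptw
  rw [integral_add' (i1.add i2) i3, integral_add' i1 i2, integral_add' (hi.const_mul _) (i4.sub hi),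
    integral_sub' i4 hi, integral_const_mul, e2, e3, e4, ← hmdef] at hint
  have : Real.negMulLog m = -(Real.log m * m) := by rw [Real.negMulLog]; ring
  rw [this]
  simp only [F, G] at hint
  linarith

/-- The contraction inequality for the entropies of a density of `m (V, U)`, when only `V` is
kept. -/
def IsEntropyContraction {V U X : Type*} [MeasurableSpace V] [MeasurableSpace U]
    [MeasurableSpace X] (β : Measure V) (ρ : Measure U) (m : V × U → X) (θ : ℝ) (q : X → ℝ) :
    Prop :=
  ∀ h : X → ℝ, Measurable h → ∀ ε : ℝ, 0 < ε → (∀ x, ε ≤ h x) → (∀ x, h x ≤ 1) →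
    (1 - θ) * Real.negMulLog (∫ p, h (m p) ∂(β.prod ρ))
      ≤ ∫ v, Real.negMulLog (∫ u, h (m (v, u)) ∂ρ) ∂β
        - θ * ∫ p, Real.negMulLog (h (m p)) ∂(β.prod ρ) + ∫ p, h (m p) * q (m p) ∂(β.prod ρ)

theorem map_prod_prod_comm {V₁ U₁ V₂ U₂ : Type*} [MeasurableSpace V₁]
    [MeasurableSpace U₁] [MeasurableSpace V₂] [MeasurableSpace U₂]
    (β₁ : Measure V₁) (ρ₁ : Measure U₁) (β₂ : Measure V₂) (ρ₂ : Measure U₂)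
    [SFinite β₁] [SFinite ρ₁] [SFinite β₂] [SFinite ρ₂] :
    ((β₁.prod ρ₁).prod (β₂.prod ρ₂)).map (fun p => ((p.1.1, p.2.1), (p.1.2, p.2.2)))
      = (β₁.prod β₂).prod (ρ₁.prod ρ₂) := by
  refine Measure.ext_of_lintegral _ fun F hF => ?_
  rw [lintegral_map hF (by fun_prop), lintegral_prod _ (by fun_prop),
    lintegral_prod _ (by fun_prop), lintegral_prod _ (by fun_prop),
    lintegral_prod _ (by fun_prop)]
  refine lintegral_congr fun v₁ => ?_
  have h1 : ∀ u₁, ∫⁻ p : V₂ × U₂, F ((v₁, p.1), (u₁, p.2)) ∂(β₂.prod ρ₂)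
      = ∫⁻ v₂, ∫⁻ u₂, F ((v₁, v₂), (u₁, u₂)) ∂ρ₂ ∂β₂ := fun u₁ =>
    lintegral_prod _ (by fun_prop)
  have h2 : ∀ v₂, ∫⁻ p : U₁ × U₂, F ((v₁, v₂), p) ∂(ρ₁.prod ρ₂)
      = ∫⁻ u₁, ∫⁻ u₂, F ((v₁, v₂), (u₁, u₂)) ∂ρ₂ ∂ρ₁ := fun v₂ =>
    lintegral_prod _ (by fun_prop)
  simp only [h1, h2]
  rw [lintegral_lintegral_swap]
  refine Measurable.aemeasurable ?_
  exact Measurable.lintegral_prod_right' (f := fun q : (U₁ × V₂) × U₂ =>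
    F ((v₁, q.1.2), (q.1.1, q.2))) (by fun_prop)

/-- Use the first inequality on F, the average of h over the second pair, and, for each v in V₁, the
second inequality on G v, the average of h over U₁ at v. Superadditivity of entropy on U₁ × (V₂ ×
U₂), taken θ times, trades the entropy of G v for that of F; the entropies of F then cancel between
the two inequalities. -/
theorem IsEntropyContraction.prod {V₁ U₁ X₁ V₂ U₂ X₂ : Type*} [MeasurableSpace V₁]
    [MeasurableSpace U₁] [MeasurableSpace X₁] [MeasurableSpace V₂] [MeasurableSpace U₂]
    [MeasurableSpace X₂]
    {β₁ : Measure V₁} {ρ₁ : Measure U₁} {β₂ : Measure V₂} {ρ₂ : Measure U₂}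
    [IsProbabilityMeasure β₁] [IsProbabilityMeasure ρ₁] [IsProbabilityMeasure β₂]
    [IsProbabilityMeasure ρ₂] {m₁ : V₁ × U₁ → X₁} {m₂ : V₂ × U₂ → X₂} {θ : ℝ} (hθ : 0 ≤ θ)
    {q₁ : X₁ → ℝ} {q₂ : X₂ → ℝ} (hm₁ : Measurable m₁) (hm₂ : Measurable m₂)
    (hq₁ : Measurable q₁) (hq₂ : Measurable q₂)
    (hi₁ : Integrable (fun p => q₁ (m₁ p)) (β₁.prod ρ₁))
    (hi₂ : Integrable (fun p => q₂ (m₂ p)) (β₂.prod ρ₂))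
    (H₁ : IsEntropyContraction β₁ ρ₁ m₁ θ q₁) (H₂ : IsEntropyContraction β₂ ρ₂ m₂ θ q₂) :
    IsEntropyContraction (β₁.prod β₂) (ρ₁.prod ρ₂)
      (fun p => (m₁ (p.1.1, p.2.1), m₂ (p.1.2, p.2.2))) θ (fun x => q₁ x.1 + q₂ x.2) := by
  intro h hm ε hε hεh hM
  have hh0 : ∀ x, 0 ≤ h x := fun x => hε.le.trans (hεh x)
  have hhn : ∀ x, ‖h x‖ ≤ 1 := fun x => by rw [Real.norm_of_nonneg (hh0 x)]; exact hM x
  have hswap : ∀ G : X₁ × X₂ → ℝ, Measurable G →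
      ∫ p : (V₁ × V₂) × (U₁ × U₂), G (m₁ (p.1.1, p.2.1), m₂ (p.1.2, p.2.2))
        ∂((β₁.prod β₂).prod (ρ₁.prod ρ₂))
      = ∫ p : (V₁ × U₁) × (V₂ × U₂), G (m₁ p.1, m₂ p.2) ∂((β₁.prod ρ₁).prod (β₂.prod ρ₂)) :=
    fun G hG => by
      rw [← map_prod_prod_comm, integral_map (by fun_prop)
        (Measurable.aestronglyMeasurable (by fun_prop))]
  let F : X₁ → ℝ := fun x => ∫ p, h (x, m₂ p) ∂(β₂.prod ρ₂)
  let G : V₁ → X₂ → ℝ := fun v x => ∫ u, h (m₁ (v, u), x) ∂ρ₁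
  have hFm : Measurable F := Measurable.integral_section (f := fun z : X₁ × (V₂ × U₂) =>
    h (z.1, m₂ z.2)) (by fun_prop)
  have hGm2 : Measurable (fun z : V₁ × X₂ => G z.1 z.2) :=
    Measurable.integral_section (f := fun z : (V₁ × X₂) × U₁ => h (m₁ (z.1.1, z.2), z.1.2))
      (by fun_prop)
  have hGm : ∀ v, Measurable (G v) := fun v => hGm2.comp (by fun_prop : Measurable fun x => (v, x))
  have hF := fun x => (integral_mem_Icc (μ := β₂.prod ρ₂) (f := fun p => h (x, m₂ p))
    (by fun_prop) (fun _ => hεh _) (fun _ => hM _)).2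
  have hG := fun v x => (integral_mem_Icc (μ := ρ₁) (f := fun u => h (m₁ (v, u), x))
    (by fun_prop) (fun _ => hεh _) (fun _ => hM _)).2
  have K₁ := H₁ F hFm ε hε (fun x => (hF x).1) (fun x => (hF x).2)
  have K₂ := fun v => H₂ (G v) (hGm v) ε hε (fun x => (hG v x).1) (fun x => (hG v x).2)
  let S₂ : V₁ → ℝ := fun v => ∫ v₂, Real.negMulLog (∫ u, G v (m₂ (v₂, u)) ∂ρ₂) ∂β₂
  let S₃ : V₁ → ℝ := fun v => ∫ p, Real.negMulLog (G v (m₂ p)) ∂(β₂.prod ρ₂)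
  let S₄ : V₁ → ℝ := fun v => ∫ p, G v (m₂ p) * q₂ (m₂ p) ∂(β₂.prod ρ₂)
  let S₅ : V₁ → ℝ := fun v => ∫ z : U₁ × (V₂ × U₂), Real.negMulLog (h (m₁ (v, z.1), m₂ z.2))
    ∂(ρ₁.prod (β₂.prod ρ₂))
  let S₆ : V₁ → ℝ := fun v => ∫ u, Real.negMulLog (F (m₁ (v, u))) ∂ρ₁
  let M : V₁ → ℝ := fun v => ∫ u, F (m₁ (v, u)) ∂ρ₁
  have hint : ∀ v, Integrable (fun z : U₁ × (V₂ × U₂) => h (m₁ (v, z.1), m₂ z.2))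
      (ρ₁.prod (β₂.prod ρ₂)) := fun v =>
    (integral_mem_Icc (by fun_prop) (fun _ => hεh _) (fun _ => hM _)).1
  have hMz : ∀ v, M v = ∫ z : U₁ × (V₂ × U₂), h (m₁ (v, z.1), m₂ z.2)
      ∂(ρ₁.prod (β₂.prod ρ₂)) := fun v => (integral_prod _ (hint v)).symm
  have hMG : ∀ v, M v = ∫ p, G v (m₂ p) ∂(β₂.prod ρ₂) := fun v => by
    rw [hMz, integral_prod_symm _ (hint v)]
  -- The second inequality bounds (1 − θ) η(M v), with η = `Real.negMulLog`; superadditivity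
  -- supplies the missing θ η(M v) and removes S₃.
  have hptw : ∀ v, Real.negMulLog (M v) ≤ S₂ v + θ * S₆ v - θ * S₅ v + S₄ v := fun v => by
    have k2 := K₂ v
    rw [← hMG v] at k2
    have k3 := negMulLog_integral_add_le (μ := ρ₁) (ν := β₂.prod ρ₂)
      (h := fun z : U₁ × (V₂ × U₂) => h (m₁ (v, z.1), m₂ z.2)) (by fun_prop) hε
      (fun _ => hεh _) (fun _ => hM _)
    rw [← hMz v] at k3
    have k4 : Real.negMulLog (M v) + S₅ v ≤ S₆ v + S₃ v := k3
    have k2' : (1 - θ) * Real.negMulLog (M v) ≤ S₂ v - θ * S₃ v + S₄ v := k2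
    have := mul_le_mul_of_nonneg_left k4 hθ
    linarith
  -- measurability and integrability of the sections
  have mS₂ : Measurable fun z : V₁ × V₂ => Real.negMulLog (∫ u, G z.1 (m₂ (z.2, u)) ∂ρ₂) := by
    refine Real.continuous_negMulLog.measurable.comp (Measurable.integral_section
      (f := fun y : (V₁ × V₂) × U₂ => G y.1.1 (m₂ (y.1.2, y.2))) ?_)
    exact hGm2.comp (by fun_prop : Measurable fun y : (V₁ × V₂) × U₂ => (y.1.1, m₂ (y.1.2, y.2)))
  have bS₂ : ∀ z : V₁ × V₂, ‖Real.negMulLog (∫ u, G z.1 (m₂ (z.2, u)) ∂ρ₂)‖ ≤ 1 := fun z => by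
    obtain ⟨-, h1, h2⟩ := integral_mem_Icc (μ := ρ₂) (f := fun u => G z.1 (m₂ (z.2, u)))
      ((hGm _).comp (by fun_prop)) (fun u => hε.le.trans (hG _ _).1) (fun u => (hG _ _).2)
    exact negMulLog_mem_Icc h1 h2
  have iS₂' : Integrable (fun z : V₁ × V₂ => Real.negMulLog (∫ u, G z.1 (m₂ (z.2, u)) ∂ρ₂))
      (β₁.prod β₂) := Integrable.of_bound mS₂.aestronglyMeasurable 1 (Eventually.of_forall bS₂)
  have iS₂ : Integrable S₂ β₁ := iS₂'.integral_prod_left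
  have iη : Integrable (fun z : (V₁ × U₁) × (V₂ × U₂) => Real.negMulLog (h (m₁ z.1, m₂ z.2)))
      ((β₁.prod ρ₁).prod (β₂.prod ρ₂)) :=
    integrable_negMulLog (by fun_prop) (fun _ => hh0 _) (fun _ => hM _)
  have iη' : Integrable (fun z : V₁ × (U₁ × (V₂ × U₂)) =>
      Real.negMulLog (h (m₁ (z.1, z.2.1), m₂ z.2.2))) (β₁.prod (ρ₁.prod (β₂.prod ρ₂))) :=
    integrable_negMulLog (by fun_prop) (fun _ => hh0 _) (fun _ => hM _)
  have iS₅ : Integrable S₅ β₁ := iη'.integral_prod_left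
  have iF : Integrable (fun p => Real.negMulLog (F (m₁ p))) (β₁.prod ρ₁) :=
    integrable_negMulLog (hFm.comp hm₁) (fun _ => hε.le.trans (hF _).1) (fun _ => (hF _).2)
  have iS₆ : Integrable S₆ β₁ := iF.integral_prod_left
  have hGq : Integrable (fun z : V₁ × (V₂ × U₂) => G z.1 (m₂ z.2) * q₂ (m₂ z.2))
      (β₁.prod (β₂.prod ρ₂)) := by
    refine (hi₂.comp_snd β₁).bdd_mul (c := 1)
      (hGm2.comp (by fun_prop : Measurable fun z : V₁ × (V₂ × U₂) => (z.1, m₂ z.2))).aestronglyMeasurable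
      (Eventually.of_forall fun z => ?_)
    rw [Real.norm_of_nonneg (hε.le.trans (hG _ _).1)]
    exact (hG _ _).2
  have iS₄ : Integrable S₄ β₁ := hGq.integral_prod_left
  have iM : Integrable (fun v => Real.negMulLog (M v)) β₁ := by
    have hMm : Measurable M := Measurable.integral_section (f := fun z => F (m₁ z)) (hFm.comp hm₁)
    have hMb := fun v => (integral_mem_Icc (μ := ρ₁) (f := fun u => F (m₁ (v, u)))
      (hFm.comp (by fun_prop)) (fun _ => (hF _).1) (fun _ => (hF _).2)).2
    exact integrable_negMulLog hMm (fun v => hε.le.trans (hMb v).1) (fun v => (hMb v).2)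
  have hIM : ∫ v, Real.negMulLog (M v) ∂β₁
      ≤ ∫ v, S₂ v ∂β₁ + θ * ∫ v, S₆ v ∂β₁ - θ * ∫ v, S₅ v ∂β₁ + ∫ v, S₄ v ∂β₁ := by
    refine (integral_mono iM (((iS₂.add (iS₆.const_mul θ)).sub (iS₅.const_mul θ)).add iS₄)
      hptw).trans (le_of_eq ?_)
    rw [integral_add' ((iS₂.add (iS₆.const_mul θ)).sub (iS₅.const_mul θ)) iS₄,
      integral_sub' (iS₂.add (iS₆.const_mul θ)) (iS₅.const_mul θ),
      integral_add' iS₂ (iS₆.const_mul θ), integral_const_mul, integral_const_mul]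
  -- identification of the terms
  have T₁ : ∫ p : (V₁ × V₂) × (U₁ × U₂), h (m₁ (p.1.1, p.2.1), m₂ (p.1.2, p.2.2))
        ∂((β₁.prod β₂).prod (ρ₁.prod ρ₂)) = ∫ p, F (m₁ p) ∂(β₁.prod ρ₁) := by
    rw [hswap h hm, integral_prod _
      (integral_mem_Icc (by fun_prop) (fun _ => hεh _) (fun _ => hM _)).1]
  have T₂ : ∫ v : V₁ × V₂, Real.negMulLog (∫ u : U₁ × U₂, h (m₁ (v.1, u.1), m₂ (v.2, u.2))
        ∂(ρ₁.prod ρ₂)) ∂(β₁.prod β₂) = ∫ v, S₂ v ∂β₁ := by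
    have : ∀ v : V₁ × V₂, ∫ u : U₁ × U₂, h (m₁ (v.1, u.1), m₂ (v.2, u.2)) ∂(ρ₁.prod ρ₂)
        = ∫ u, G v.1 (m₂ (v.2, u)) ∂ρ₂ := fun v =>
      integral_prod_symm _ (integral_mem_Icc (by fun_prop) (fun _ => hεh _) (fun _ => hM _)).1
    simp only [this]
    exact integral_prod _ iS₂'
  have T₃ : ∫ p : (V₁ × V₂) × (U₁ × U₂), Real.negMulLog (h (m₁ (p.1.1, p.2.1), m₂ (p.1.2, p.2.2)))
        ∂((β₁.prod β₂).prod (ρ₁.prod ρ₂)) = ∫ v, S₅ v ∂β₁ := by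
    rw [hswap (fun x => Real.negMulLog (h x)) (by fun_prop), integral_prod _ iη,
      integral_prod _ iη.integral_prod_left]
    refine integral_congr_ae (Eventually.of_forall fun v => ?_)
    have iv : Integrable (fun z : U₁ × (V₂ × U₂) => Real.negMulLog (h (m₁ (v, z.1), m₂ z.2)))
        (ρ₁.prod (β₂.prod ρ₂)) :=
      integrable_negMulLog (by fun_prop) (fun _ => hh0 _) (fun _ => hM _)
    exact (integral_prod _ iv).symm
  have T₆ : ∫ p, Real.negMulLog (F (m₁ p)) ∂(β₁.prod ρ₁) = ∫ v, S₆ v ∂β₁ := integral_prod _ iF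
  have iq₁ : Integrable (fun z : (V₁ × U₁) × (V₂ × U₂) => h (m₁ z.1, m₂ z.2) * q₁ (m₁ z.1))
      ((β₁.prod ρ₁).prod (β₂.prod ρ₂)) :=
    (hi₁.comp_fst _).bdd_mul (c := 1) (Measurable.aestronglyMeasurable (by fun_prop))
      (Eventually.of_forall fun z => hhn _)
  have iq₂ : Integrable (fun z : (V₁ × U₁) × (V₂ × U₂) => h (m₁ z.1, m₂ z.2) * q₂ (m₂ z.2))
      ((β₁.prod ρ₁).prod (β₂.prod ρ₂)) :=
    (hi₂.comp_snd _).bdd_mul (c := 1) (Measurable.aestronglyMeasurable (by fun_prop))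
      (Eventually.of_forall fun z => hhn _)
  have T₄ : ∫ p : (V₁ × V₂) × (U₁ × U₂), h (m₁ (p.1.1, p.2.1), m₂ (p.1.2, p.2.2))
        * (q₁ (m₁ (p.1.1, p.2.1)) + q₂ (m₂ (p.1.2, p.2.2))) ∂((β₁.prod β₂).prod (ρ₁.prod ρ₂))
      = ∫ p, F (m₁ p) * q₁ (m₁ p) ∂(β₁.prod ρ₁) + ∫ v, S₄ v ∂β₁ := by
    rw [hswap (fun x => h x * (q₁ x.1 + q₂ x.2)) (by fun_prop)]
    simp only [mul_add]
    rw [integral_add iq₁ iq₂, integral_prod _ iq₁, integral_prod _ iq₂,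
      integral_prod _ iq₂.integral_prod_left]
    congr 1
    · refine integral_congr_ae (Eventually.of_forall fun p => ?_)
      simp only [integral_mul_const, F]
    · refine integral_congr_ae (Eventually.of_forall fun v => ?_)
      have iv : Integrable (fun z : U₁ × (V₂ × U₂) => h (m₁ (v, z.1), m₂ z.2) * q₂ (m₂ z.2))
          (ρ₁.prod (β₂.prod ρ₂)) :=
        (hi₂.comp_snd _).bdd_mul (c := 1) (Measurable.aestronglyMeasurable (by fun_prop))
          (Eventually.of_forall fun z => hhn _)
      simp only [S₄, G]
      refine (integral_integral_swap (μ := ρ₁) (ν := β₂.prod ρ₂)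
        (f := fun u z => h (m₁ (v, u), m₂ z) * q₂ (m₂ z)) iv).trans ?_
      simp only [integral_mul_const]
  have K₁' : (1 - θ) * Real.negMulLog (∫ p, F (m₁ p) ∂(β₁.prod ρ₁))
      ≤ ∫ v, Real.negMulLog (M v) ∂β₁ - θ * ∫ p, Real.negMulLog (F (m₁ p)) ∂(β₁.prod ρ₁)
        + ∫ p, F (m₁ p) * q₁ (m₁ p) ∂(β₁.prod ρ₁) := K₁
  rw [T₆] at K₁'
  rw [T₁, T₂, T₃, T₄]
  linarith

end Tensorization

/-! ### The n-fold channel and finite partitions -/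

section TensorPower

/-- Serves to carry the product of one coordinate and n coordinates over to functions on `Fin (n +
1)`. -/
theorem IsEntropyContraction.of_measurePreserving {V U X V' U' X' : Type*} [MeasurableSpace V]
    [MeasurableSpace U] [MeasurableSpace X] [MeasurableSpace V'] [MeasurableSpace U']
    [MeasurableSpace X'] {β : Measure V} {ρ : Measure U} {β' : Measure V'} {ρ' : Measure U'}
    [IsProbabilityMeasure β] [IsProbabilityMeasure ρ] [IsProbabilityMeasure β']
    [IsProbabilityMeasure ρ'] {m : V × U → X} {m' : V' × U' → X'} {θ : ℝ} {q : X → ℝ}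
    {q' : X' → ℝ} {fV : V → V'} {fU : U → U'} {fX : X → X'} (hV : MeasurePreserving fV β β')
    (hU : MeasurePreserving fU ρ ρ') (hX : Measurable fX) (hm' : Measurable m')
    (hq' : Measurable q') (hmm : ∀ v u, m' (fV v, fU u) = fX (m (v, u)))
    (hqq : ∀ x, q' (fX x) = q x) (H : IsEntropyContraction β ρ m θ q) :
    IsEntropyContraction β' ρ' m' θ q' := by
  intro h hm ε hε hεh hM
  have K := H (fun x => h (fX x)) (hm.comp hX) ε hε (fun _ => hεh _) (fun _ => hM _)
  have hI : ∀ G : V' × U' → ℝ, Measurable G →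
      ∫ p, G p ∂(β'.prod ρ') = ∫ p : V × U, G (fV p.1, fU p.2) ∂(β.prod ρ) := fun G hG => by
    have hp := hV.prod hU
    rw [← hp.map_eq, integral_map hp.measurable.aemeasurable hG.aestronglyMeasurable]
    rfl
  have hη := Real.continuous_negMulLog.measurable
  have e1 := hI (fun p => h (m' p)) (by fun_prop)
  have e3 := hI (fun p => Real.negMulLog (h (m' p))) (by fun_prop)
  have e4 := hI (fun p => h (m' p) * q' (m' p)) (by fun_prop)
  have e2 : ∫ v, Real.negMulLog (∫ u, h (m' (v, u)) ∂ρ') ∂β'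
      = ∫ v, Real.negMulLog (∫ u, h (fX (m (v, u))) ∂ρ) ∂β := by
    have hmeas : Measurable fun v => Real.negMulLog (∫ u, h (m' (v, u)) ∂ρ') :=
      hη.comp (Measurable.integral_section (f := fun p => h (m' p)) (by fun_prop))
    rw [← hV.map_eq, integral_map hV.measurable.aemeasurable
      (by rw [hV.map_eq]; exact hmeas.aestronglyMeasurable)]
    refine integral_congr_ae (Eventually.of_forall fun v => ?_)
    simp only
    congr 1
    have : Measurable fun u => h (m' (fV v, u)) := by fun_prop
    rw [← hU.map_eq, integral_map hU.measurable.aemeasurable this.aestronglyMeasurable]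
    simp only [hmm]
  rw [e1, e2, e3, e4]
  simpa only [hmm, hqq] using K

/-- Induction on n, adding one coordinate at a time. The factor θ stays the same and the weights
add, so the additive constant grows linearly in n. -/
theorem IsEntropyContraction.pi {β ρ : Measure ℝ} [IsProbabilityMeasure β]
    [IsProbabilityMeasure ρ] {a θ : ℝ} {q : ℝ → ℝ} (hθ0 : 0 ≤ θ) (hq : Measurable q)
    (hi : Integrable (fun p : ℝ × ℝ => q (a * p.1 + p.2)) (β.prod ρ))
    (H : IsEntropyContraction β ρ (fun p : ℝ × ℝ => a * p.1 + p.2) θ q) (n : ℕ) :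
    IsEntropyContraction (Measure.pi fun _ : Fin n => β) (Measure.pi fun _ : Fin n => ρ)
      (fun p i => a * p.1 i + p.2 i) θ (fun x => ∑ i, q (x i)) ∧
    Integrable (fun p : (Fin n → ℝ) × (Fin n → ℝ) => ∑ i, q (a * p.1 i + p.2 i))
      ((Measure.pi fun _ : Fin n => β).prod (Measure.pi fun _ : Fin n => ρ)) ∧
    ∫ p : (Fin n → ℝ) × (Fin n → ℝ), ∑ i, q (a * p.1 i + p.2 i)
      ∂((Measure.pi fun _ : Fin n => β).prod (Measure.pi fun _ : Fin n => ρ))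
      = n * ∫ p, q (a * p.1 + p.2) ∂(β.prod ρ) := by
  have hev : ∀ n : ℕ, ∀ i : Fin n, MeasurePreserving
      (fun p : (Fin n → ℝ) × (Fin n → ℝ) => (p.1 i, p.2 i))
      ((Measure.pi fun _ : Fin n => β).prod (Measure.pi fun _ : Fin n => ρ)) (β.prod ρ) :=
    fun n i => (measurePreserving_eval (fun _ : Fin n => β) i).prod
      (measurePreserving_eval (fun _ : Fin n => ρ) i)
  have hsi : ∀ n : ℕ, ∀ i : Fin n,
      Integrable (fun p : (Fin n → ℝ) × (Fin n → ℝ) => q (a * p.1 i + p.2 i))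
      ((Measure.pi fun _ : Fin n => β).prod (Measure.pi fun _ : Fin n => ρ)) := fun n i =>
    (hev n i).integrable_comp_of_integrable hi
  refine ⟨?_, integrable_finsetSum _ fun i _ => hsi n i, ?_⟩
  · induction n with
    | zero =>
      intro h hm ε hε hεh hM
      have : ∀ p : (Fin 0 → ℝ) × (Fin 0 → ℝ), (fun i => a * p.1 i + p.2 i) = (0 : Fin 0 → ℝ) :=
        fun p => Subsingleton.elim _ _
      have h2 : ∀ p q : Fin 0 → ℝ, (fun i => a * p i + q i) = (0 : Fin 0 → ℝ) :=
        fun p q => Subsingleton.elim _ _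
      -- On the one-point space every average is the value of h and the weight is an empty sum, so
      -- the two sides agree.
      simp [this, h2]
      linarith
    | succ n ih =>
      have K := IsEntropyContraction.prod (m₁ := fun p : ℝ × ℝ => a * p.1 + p.2)
        (m₂ := fun (p : (Fin n → ℝ) × (Fin n → ℝ)) i => a * p.1 i + p.2 i)
        hθ0 (by fun_prop) (by fun_prop) hq
        (q₂ := fun x : Fin n → ℝ => ∑ i, q (x i)) (by fun_prop) hi
        (integrable_finsetSum _ fun i _ => hsi n i) H ih
      refine K.of_measurePreserving (fX := (MeasurableEquiv.piFinSuccAbove (fun _ => ℝ) 0).symm)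
        (measurePreserving_piFinSuccAbove (fun _ : Fin (n + 1) => β) 0).symm
        (measurePreserving_piFinSuccAbove (fun _ : Fin (n + 1) => ρ) 0).symm
        (by fun_prop) (by fun_prop) (by fun_prop) ?_ ?_
      · rintro ⟨v, vs⟩ ⟨u, us⟩
        funext i
        refine Fin.cases ?_ (fun j => ?_) i <;> simp [MeasurableEquiv.piFinSuccAbove]
      · rintro ⟨x, xs⟩
        simp [Fin.sum_univ_succ, MeasurableEquiv.piFinSuccAbove]
  · rw [integral_finsetSum _ fun i _ => hsi n i]
    have : ∀ i : Fin n, ∫ p : (Fin n → ℝ) × (Fin n → ℝ), q (a * p.1 i + p.2 i)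
        ∂((Measure.pi fun _ : Fin n => β).prod (Measure.pi fun _ : Fin n => ρ))
        = ∫ p, q (a * p.1 + p.2) ∂(β.prod ρ) := fun i => by
      rw [← (hev n i).map_eq, integral_map (hev n i).measurable.aemeasurable
        (Measurable.aestronglyMeasurable (by fun_prop))]
    simp [this]

/-- Lower bounds on the density can be dropped by continuity. -/
theorem IsEntropyContraction.of_nonneg {V U X : Type*} [MeasurableSpace V] [MeasurableSpace U]
    [MeasurableSpace X] {β : Measure V} {ρ : Measure U} [IsProbabilityMeasure β]
    [IsProbabilityMeasure ρ] {m : V × U → X} {θ : ℝ} {q : X → ℝ} (hm : Measurable m)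
    (hq : Measurable q) (hi : Integrable (fun p => q (m p)) (β.prod ρ))
    (H : IsEntropyContraction β ρ m θ q) {h : X → ℝ} (hh : Measurable h) (h0 : ∀ x, 0 ≤ h x)
    (h1 : ∀ x, h x ≤ 1) :
    (1 - θ) * Real.negMulLog (∫ p, h (m p) ∂(β.prod ρ))
      ≤ ∫ v, Real.negMulLog (∫ u, h (m (v, u)) ∂ρ) ∂β
        - θ * ∫ p, Real.negMulLog (h (m p)) ∂(β.prod ρ)
        + ∫ p, h (m p) * q (m p) ∂(β.prod ρ) := by
  have hη := Real.continuous_negMulLog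
  let ε : ℕ → ℝ := fun k => 1 / ((k : ℝ) + 1)
  have hε0 : ∀ k, 0 < ε k := fun k => by positivity
  have hε1 : ∀ k, ε k ≤ 1 := fun k => by
    simp only [ε]; rw [div_le_one (by positivity)]; linarith [(k.cast_nonneg : (0 : ℝ) ≤ k)]
  have hεl : Tendsto ε atTop (𝓝 0) := tendsto_one_div_add_atTop_nhds_zero_nat
  let f : ℕ → X → ℝ := fun k x => ε k + (1 - ε k) * h x
  have hfm : ∀ k, Measurable (f k) := fun k => by fun_prop
  have hfε : ∀ k x, ε k ≤ f k x := fun k x => by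
    have := mul_nonneg (sub_nonneg.2 (hε1 k)) (h0 x); simp only [f]; linarith
  have hf1 : ∀ k x, f k x ≤ 1 := fun k x => by
    have := mul_le_mul_of_nonneg_left (h1 x) (sub_nonneg.2 (hε1 k)); simp only [f]; linarith
  have hf0 : ∀ k x, 0 ≤ f k x := fun k x => (hε0 k).le.trans (hfε k x)
  have hfn : ∀ k x, ‖f k x‖ ≤ 1 := fun k x => by
    rw [Real.norm_of_nonneg (hf0 k x)]; exact hf1 k x
  have hfl : ∀ x, Tendsto (fun k => f k x) atTop (𝓝 (h x)) := fun x => by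
    have := hεl.add ((hεl.const_sub 1).mul_const (h x))
    simpa using this
  have l1 : Tendsto (fun k => ∫ p, f k (m p) ∂(β.prod ρ)) atTop
      (𝓝 (∫ p, h (m p) ∂(β.prod ρ))) :=
    tendsto_integral_of_dominated_convergence (fun _ => 1)
      (fun k => ((hfm k).comp hm).aestronglyMeasurable) (integrable_const _)
      (fun k => Eventually.of_forall fun p => hfn k _) (Eventually.of_forall fun p => hfl _)
  have l2 : Tendsto (fun k => ∫ p, Real.negMulLog (f k (m p)) ∂(β.prod ρ)) atTop
      (𝓝 (∫ p, Real.negMulLog (h (m p)) ∂(β.prod ρ))) :=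
    tendsto_integral_of_dominated_convergence (fun _ => 1)
      (fun k => (hη.measurable.comp ((hfm k).comp hm)).aestronglyMeasurable) (integrable_const _)
      (fun k => Eventually.of_forall fun x => negMulLog_mem_Icc (hf0 k _) (hf1 k _))
      (Eventually.of_forall fun p => (hη.tendsto _).comp (hfl _))
  have l3 : Tendsto (fun k => ∫ p, f k (m p) * q (m p) ∂(β.prod ρ)) atTop
      (𝓝 (∫ p, h (m p) * q (m p) ∂(β.prod ρ))) := by
    refine tendsto_integral_of_dominated_convergence (fun p => ‖q (m p)‖)
      (fun k => (((hfm k).comp hm).mul (hq.comp hm)).aestronglyMeasurable) hi.norm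
      (fun k => Eventually.of_forall fun x => ?_)
      (Eventually.of_forall fun p => (hfl _).mul_const _)
    rw [norm_mul]
    exact mul_le_of_le_one_left (norm_nonneg _) (hfn k _)
  have l4 : Tendsto (fun k => ∫ v, Real.negMulLog (∫ u, f k (m (v, u)) ∂ρ) ∂β) atTop
      (𝓝 (∫ v, Real.negMulLog (∫ u, h (m (v, u)) ∂ρ) ∂β)) := by
    refine tendsto_integral_of_dominated_convergence (fun _ => 1)
      (fun k => (hη.measurable.comp (Measurable.integral_section (f := fun p => f k (m p))
        ((hfm k).comp hm))).aestronglyMeasurable)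
      (integrable_const _) (fun k => Eventually.of_forall fun v => ?_)
      (Eventually.of_forall fun v => (hη.tendsto _).comp ?_)
    · obtain ⟨-, h1, h2⟩ := integral_mem_Icc (μ := ρ)
        (f := fun u => f k (m (v, u))) ((hfm k).comp (by fun_prop))
        (fun _ => hf0 k _) (fun _ => hf1 k _)
      exact negMulLog_mem_Icc h1 h2
    · exact tendsto_integral_of_dominated_convergence (fun _ => 1)
        (fun k => ((hfm k).comp (by fun_prop)).aestronglyMeasurable)
        (integrable_const _) (fun k => Eventually.of_forall fun u => hfn k _)
        (Eventually.of_forall fun u => hfl _)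
  exact le_of_tendsto_of_tendsto' (((hη.tendsto _).comp l1).const_mul _)
    ((l4.sub (l2.const_mul _)).add l3) fun k =>
      H (f k) (hfm k) (ε k) (hε0 k) (hfε k) (hf1 k)

/-- The contraction inequality for the entropies of a partition. -/
theorem IsEntropyContraction.partition {V U X ι : Type*} [MeasurableSpace V] [MeasurableSpace U]
    [MeasurableSpace X] [Fintype ι] {β : Measure V} {ρ : Measure U}
    [IsProbabilityMeasure β] [IsProbabilityMeasure ρ] {m : V × U → X} {θ : ℝ} {q : X → ℝ}
    (hm : Measurable m) (hq : Measurable q) (hi : Integrable (fun p => q (m p)) (β.prod ρ))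
    (H : IsEntropyContraction β ρ m θ q) {W : X → ι} (hW : ∀ w, MeasurableSet (W ⁻¹' {w})) :
    (1 - θ) * ∑ w, Real.negMulLog (∫ p, (W ⁻¹' {w}).indicator 1 (m p) ∂(β.prod ρ))
      ≤ ∫ v, ∑ w, Real.negMulLog (∫ u, (W ⁻¹' {w}).indicator 1 (m (v, u)) ∂ρ) ∂β
        + ∫ p, q (m p) ∂(β.prod ρ) := by
  classical
  have hfm : ∀ w, Measurable ((W ⁻¹' {w}).indicator (1 : X → ℝ)) := fun w =>
    measurable_one.indicator (hW w)
  have hf0 : ∀ w x, 0 ≤ (W ⁻¹' {w}).indicator (1 : X → ℝ) x := fun w x =>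
    Set.indicator_nonneg (fun _ _ => zero_le_one) x
  have hf1 : ∀ w x, (W ⁻¹' {w}).indicator (1 : X → ℝ) x ≤ 1 := fun w x =>
    Set.indicator_le_self' (fun _ _ => zero_le_one) x
  -- An indicator takes only the values 0 and 1, where `Real.negMulLog` vanishes: W is determined by
  -- X, so the entropy term carrying the factor θ drops out.
  have hη : ∀ w x, Real.negMulLog ((W ⁻¹' {w}).indicator (1 : X → ℝ) x) = 0 := fun w x => by
    by_cases h : x ∈ W ⁻¹' {w} <;> simp [h]
  have K := fun w => H.of_nonneg hm hq hi (hfm w) (hf0 w) (hf1 w)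
  simp only [hη, integral_zero, mul_zero, sub_zero] at K
  have hs := Finset.sum_le_sum fun w (_ : w ∈ Finset.univ) => K w
  rw [← Finset.mul_sum, Finset.sum_add_distrib, ← integral_finsetSum, ← integral_finsetSum] at hs
  -- The cells of W add up to 1, so the weight is averaged over the original law, whatever W is.
  · have : ∀ p, ∑ w, (W ⁻¹' {w}).indicator (1 : X → ℝ) (m p) * q (m p) = q (m p) := fun p => by
      rw [← Finset.sum_mul]
      simp [Set.indicator_apply]
    simpa only [this] using hs
  · intro w _
    exact hi.bdd_mul (c := 1) ((hfm w).comp hm).aestronglyMeasurable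
      (Eventually.of_forall fun p => by rw [Real.norm_of_nonneg (hf0 _ _)]; exact hf1 _ _)
  · intro w _
    have hI := fun v => (integral_mem_Icc (μ := ρ)
      (f := fun u => (W ⁻¹' {w}).indicator (1 : X → ℝ) (m (v, u))) ((hfm w).comp (by fun_prop))
      (fun _ => hf0 w _) (fun _ => hf1 w _)).2
    exact integrable_negMulLog (Measurable.integral_section
      (f := fun p => (W ⁻¹' {w}).indicator (1 : X → ℝ) (m p)) ((hfm w).comp hm))
      (fun v => (hI v).1) (fun v => (hI v).2)

theorem IsGaussianPair.isEntropyContraction {t r τ ν s sY : ℝ≥0} {a α : ℝ}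
    (hP : IsGaussianPair t r τ ν a α) (hs : s ≠ 0) (hsY : (sY : ℝ) = α ^ 2 * s + ν) :
    IsEntropyContraction (gaussianReal 0 t) (gaussianReal 0 r) (fun p : ℝ × ℝ => a * p.1 + p.2)
      (α ^ 2 * s / sY) (contractionWeight t τ s sY (α ^ 2 * s / sY) α) := by
  intro h hm ε hε hεh hM
  have K := hP.entropy_contraction hs hsY hm hε hεh hM
  have hw := (contractionWeight_continuous t τ s sY (α ^ 2 * s / sY) α).measurable
  have hη := Real.continuous_negMulLog.measurable
  have e : ∀ F : ℝ → ℝ, Measurable F → ∫ x, F x ∂(gaussianReal 0 τ)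
      = ∫ p : ℝ × ℝ, F (a * p.1 + p.2) ∂((gaussianReal 0 t).prod (gaussianReal 0 r)) :=
    fun F hF => by
      rw [← map_prod_gaussianReal hP.hτ, integral_map (by fun_prop) hF.aestronglyMeasurable]
  rwa [e h hm, e (fun x => Real.negMulLog (h x)) (by fun_prop),
    e (fun x => h x * contractionWeight t τ s sY (α ^ 2 * s / sY) α x) (by fun_prop)] at K

end TensorPower

/-! ### Conditional entropy through fibre probabilities -/

section CondEntropy

/-- The defining property of conditional expectation, stated with indicators so that it can be
checked by integrating over a product measure. -/
theorem condExp_indicator_ae_eq_comp {Ω τ : Type*} [MeasurableSpace Ω] [mτ : MeasurableSpace τ]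
    {P : Measure Ω} [IsProbabilityMeasure P] {T : Ω → τ} (hT : Measurable T) {E : Set Ω}
    (hE : MeasurableSet E) {φ : τ → ℝ} (hφ : Measurable φ) (h0 : ∀ x, 0 ≤ φ x) (h1 : ∀ x, φ x ≤ 1)
    (h : ∀ B, MeasurableSet B → ∫ ω, (T ⁻¹' B).indicator (fun ω => φ (T ω)) ω ∂P
      = ∫ ω, (T ⁻¹' B).indicator (E.indicator fun _ => (1 : ℝ)) ω ∂P) :
    P⟦E | mτ.comap T⟧ =ᵐ[P] fun ω => φ (T ω) := by
  symm
  refine ae_eq_condExp_of_forall_setIntegral_eq hT.comap_le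
    ((integrable_const (1 : ℝ)).indicator hE) (fun s _ _ => ?_) ?_ ?_
  · exact (integral_mem_Icc (hφ.comp hT) (fun _ => h0 _) (fun _ => h1 _)).1.integrableOn
  · rintro s ⟨B, hB, rfl⟩ -
    rw [← integral_indicator (hT hB), ← integral_indicator (hT hB)]
    exact h B hB
  · exact (hφ.comp (comap_measurable T)).stronglyMeasurable.aestronglyMeasurable

/-- The conditional probability, given the first coordinate, that `w = i`. -/
noncomputable def fiberProb {V U ι : Type*} [MeasurableSpace U] (ρ : Measure U) (w : V × U → ι)
    (i : ι) (v : V) : ℝ :=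
  ρ.real {u | w (v, u) = i}

theorem fiberProb_measurable {V U ι : Type*} [MeasurableSpace V] [MeasurableSpace U]
    [MeasurableSpace ι] [MeasurableSingletonClass ι] {ρ : Measure U} [IsProbabilityMeasure ρ]
    {w : V × U → ι} (hw : Measurable w) (i : ι) : Measurable (fiberProb ρ w i) :=
  (measurable_measure_prodMk_left (ν := ρ) (hw (measurableSet_singleton i))).ennreal_toReal

theorem fiberProb_nonneg {V U ι : Type*} [MeasurableSpace U] {ρ : Measure U}
    {w : V × U → ι} (i : ι) (v : V) : 0 ≤ fiberProb ρ w i v := measureReal_nonneg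

theorem fiberProb_le_one {V U ι : Type*} [MeasurableSpace U] {ρ : Measure U}
    [IsProbabilityMeasure ρ] {w : V × U → ι} (i : ι) (v : V) : fiberProb ρ w i v ≤ 1 :=
  measureReal_le_one

theorem sum_fiberProb_prod {V U κ σ : Type*} [MeasurableSpace V] [MeasurableSpace U]
    [MeasurableSpace κ] [MeasurableSingletonClass κ] [MeasurableSpace σ]
    [MeasurableSingletonClass σ] [Fintype σ] {ρ : Measure U} [IsProbabilityMeasure ρ]
    {c : V × U → κ} {s : V × U → σ} (hc : Measurable c) (hs : Measurable s) (i : κ) (v : V) :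
    ∑ j, fiberProb ρ (fun p => (c p, s p)) (i, j) v = fiberProb ρ c i v := by
  unfold fiberProb
  rw [← measureReal_biUnion_finset]
  · congr 1; ext u; simp
  · intro j _ k _ hjk
    refine Set.disjoint_left.2 fun u hu hu' => hjk ?_
    simp only [Set.mem_ofPred_eq, Prod.mk.injEq] at hu hu'
    exact hu.2.symm.trans hu'.2
  · intro j _
    exact ((hc.prodMk hs).comp (by fun_prop : Measurable fun u => (v, u)))
      (measurableSet_singleton (i, j))

theorem sum_fiberProb {V U ι : Type*} [MeasurableSpace V] [MeasurableSpace U] [Fintype ι]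
    [MeasurableSpace ι] [MeasurableSingletonClass ι] {ρ : Measure U} [IsProbabilityMeasure ρ]
    {w : V × U → ι} (hw : Measurable w) (v : V) : ∑ i, fiberProb ρ w i v = 1 := by
  unfold fiberProb
  rw [← measureReal_biUnion_finset]
  · have : (⋃ i ∈ Finset.univ, {u | w (v, u) = i}) = Set.univ := by ext; simp
    rw [this, probReal_univ]
  · intro j _ k _ hjk
    refine Set.disjoint_left.2 fun u hu hu' => hjk ?_
    simp only [Set.mem_ofPred_eq] at hu hu'
    exact hu.symm.trans hu'
  · intro j _
    exact (hw.comp (by fun_prop : Measurable fun u => (v, u))) (measurableSet_singleton j)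

theorem integral_fiberProb_mul {V U ι : Type*} [MeasurableSpace V] [MeasurableSpace U]
    [MeasurableSpace ι] [MeasurableSingletonClass ι] {ρ : Measure U} [IsProbabilityMeasure ρ]
    {w : V × U → ι} (hw : Measurable w) (i : ι) (v : V) (x : ℝ) :
    ∫ u, (w ⁻¹' {i}).indicator (fun _ => x) (v, u) ∂ρ = fiberProb ρ w i v * x := by
  classical
  have hm : MeasurableSet {u | w (v, u) = i} :=
    (hw.comp (by fun_prop : Measurable fun u => (v, u))) (measurableSet_singleton i)
  have : (fun u => (w ⁻¹' {i}).indicator (fun _ => x) (v, u))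
      = {u | w (v, u) = i}.indicator fun _ => x := by
    funext u; simp [Set.indicator_apply]
  rw [this, integral_indicator_const _ hm, smul_eq_mul, fiberProb]

section Chain

theorem integral_comp_of_map_eq_prod {Ω V U : Type*} [MeasurableSpace Ω] [MeasurableSpace V]
    [MeasurableSpace U] {P : Measure Ω} {β : Measure V} [IsProbabilityMeasure β] {ρ : Measure U}
    [IsProbabilityMeasure ρ] {Y : Ω → V} {N : Ω → U} (hY : Measurable Y) (hN : Measurable N)
    (hlaw : P.map (fun ω => (Y ω, N ω)) = β.prod ρ) {G : V × U → ℝ} (hG : Measurable G) {B : ℝ}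
    (hB : ∀ p, ‖G p‖ ≤ B) : ∫ ω, G (Y ω, N ω) ∂P = ∫ v, ∫ u, G (v, u) ∂ρ ∂β := by
  rw [← integral_prod _ (Integrable.of_bound hG.aestronglyMeasurable B (Eventually.of_forall hB)),
    ← hlaw, integral_map (by fun_prop) hG.aestronglyMeasurable]

variable {Ω V U : Type*} [MeasurableSpace Ω] [MeasurableSpace V] [MeasurableSpace U]
  {P : Measure Ω} [IsProbabilityMeasure P] {β : Measure V} [IsProbabilityMeasure β]
  {ρ : Measure U} [IsProbabilityMeasure ρ] {Y : Ω → V} {N : Ω → U}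

/-- The chain rule `H(S | C, Y) = H(C, S | Y) - H(C | Y)`. -/
theorem condEntropy_prod_eq_integral_fiberProb {κ σ : Type*} [Fintype κ] [Fintype σ]
    [MeasurableSpace κ] [MeasurableSingletonClass κ] [MeasurableSpace σ]
    [MeasurableSingletonClass σ] (hY : Measurable Y) (hN : Measurable N)
    (hlaw : P.map (fun ω => (Y ω, N ω)) = β.prod ρ) {c : V × U → κ} {s : V × U → σ}
    (hc : Measurable c) (hs : Measurable s) :
    condEntropy P (fun ω => s (Y ω, N ω)) (fun ω => (c (Y ω, N ω), Y ω))
      = ∫ v, ∑ i, (∑ j, Real.negMulLog (fiberProb ρ (fun p => (c p, s p)) (i, j) v)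
          - Real.negMulLog (fiberProb ρ c i v)) ∂β := by
  classical
  set R : κ → σ → V → ℝ := fun i j v => fiberProb ρ (fun p => (c p, s p)) (i, j) v with hR
  set Q : κ → V → ℝ := fun i v => fiberProb ρ c i v with hQ
  have hRm : ∀ i j, Measurable (R i j) := fun i j => fiberProb_measurable (hc.prodMk hs) _
  have hQm : ∀ i, Measurable (Q i) := fun i => fiberProb_measurable hc _
  have hR0 : ∀ i j v, 0 ≤ R i j v := fun i j v => fiberProb_nonneg _ _
  have hsumR : ∀ i v, ∑ j, R i j v = Q i v := fun i v => sum_fiberProb_prod hc hs i v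
  have hRQ : ∀ i j v, R i j v ≤ Q i v := fun i j v => by
    rw [← hsumR i v]
    exact Finset.single_le_sum (f := fun j => R i j v) (fun j _ => hR0 i j v) (Finset.mem_univ j)
  have hQ0 : ∀ i v, 0 ≤ Q i v := fun i v => fiberProb_nonneg _ _
  have hQ1 : ∀ i v, Q i v ≤ 1 := fun i v => fiberProb_le_one _ _
  -- The conditional probability of S = j given C and Y. Where Q vanishes the quotient is 0 by
  -- convention; this is harmless since R ≤ Q keeps Qφ = R.
  let φ : σ → κ × V → ℝ := fun j p => R p.1 j p.2 / Q p.1 p.2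
  have hφm : ∀ j, Measurable (φ j) := fun j =>
    measurable_from_prod_countable_right fun i => (hRm i j).div (hQm i)
  have hφ0 : ∀ j p, 0 ≤ φ j p := fun j p => div_nonneg (hR0 _ _ _) (hQ0 _ _)
  have hφ1 : ∀ j p, φ j p ≤ 1 := fun j p => div_le_one_of_le₀ (hRQ _ _ _) (hQ0 _ _)
  have hQφ : ∀ i j v, Q i v * φ j (i, v) = R i j v := fun i j v => by
    by_cases h : Q i v = 0
    · have : R i j v = 0 := le_antisymm (h ▸ hRQ i j v) (hR0 i j v)
      simp [h, this]
    · exact mul_div_cancel₀ _ h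
  -- integrals of functions of `(C, Y)`
  have hint : ∀ F : κ × V → ℝ, Measurable F → ∀ B, (∀ p, ‖F p‖ ≤ B) →
      ∫ ω, F (c (Y ω, N ω), Y ω) ∂P = ∫ v, ∑ i, Q i v * F (i, v) ∂β := fun F hF B hB => by
    rw [integral_comp_of_map_eq_prod hY hN hlaw (G := fun p => F (c p, p.1))
      (hF.comp (hc.prodMk measurable_fst)) fun p => hB _]
    refine integral_congr_ae (Eventually.of_forall fun v => ?_)
    have e : ∀ u, F (c (v, u), v) = ∑ i, (c ⁻¹' {i}).indicator (fun _ => F (i, v)) (v, u) :=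
      fun u => by simp [Set.indicator_apply]
    simp only [e]
    rw [integral_finsetSum]
    · simp only [integral_fiberProb_mul hc, hQ]
    · intro i _
      have : Measurable fun u => (c ⁻¹' {i}).indicator (fun _ => F (i, v)) (v, u) :=
        (measurable_const.indicator (hc (measurableSet_singleton i))).comp
          (by fun_prop : Measurable fun u => (v, u))
      refine Integrable.of_bound this.aestronglyMeasurable B (Eventually.of_forall fun u => ?_)
      exact (norm_indicator_le_norm_self _ _).trans (hB _)
  have hT : Measurable fun ω => (c (Y ω, N ω), Y ω) := by fun_prop
  have hE : ∀ j, MeasurableSet ((fun ω => s (Y ω, N ω)) ⁻¹' {j}) := fun j =>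
    (hs.comp (hY.prodMk hN)) (measurableSet_singleton j)
  have hcond : ∀ j, P⟦(fun ω => s (Y ω, N ω)) ⁻¹' {j} |
      MeasurableSpace.comap (fun ω => (c (Y ω, N ω), Y ω)) inferInstance⟧
      =ᵐ[P] fun ω => φ j (c (Y ω, N ω), Y ω) := fun j => by
    refine condExp_indicator_ae_eq_comp hT (hE j) (hφm j) (hφ0 j) (hφ1 j) fun B hB => ?_
    have m1 : Measurable (B.indicator (φ j)) := (hφm j).indicator hB
    have e1 := hint _ m1 1 fun p => (norm_indicator_le_norm_self _ _).trans (by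
      rw [Real.norm_of_nonneg (hφ0 j p)]; exact hφ1 j p)
    have hB' : MeasurableSet {p : V × U | (c p, p.1) ∈ B} := (hc.prodMk measurable_fst) hB
    have m2 : Measurable fun p : V × U => {p : V × U | (c p, p.1) ∈ B}.indicator
        ((s ⁻¹' {j}).indicator fun _ => (1 : ℝ)) p :=
      (measurable_const.indicator (hs (measurableSet_singleton j))).indicator hB'
    have e2 := integral_comp_of_map_eq_prod hY hN hlaw m2 (B := 1) fun p => by
      refine (norm_indicator_le_norm_self _ _).trans ((norm_indicator_le_norm_self _ _).trans ?_)
      simp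
    calc _ = ∫ ω, B.indicator (φ j) (c (Y ω, N ω), Y ω) ∂P := by
          refine integral_congr_ae (Eventually.of_forall fun ω => ?_)
          simp [Set.indicator_apply]
      _ = ∫ ω, {p : V × U | (c p, p.1) ∈ B}.indicator
            ((s ⁻¹' {j}).indicator fun _ => (1 : ℝ)) (Y ω, N ω) ∂P := by
          rw [e1, e2]
          refine integral_congr_ae (Eventually.of_forall fun v => ?_)
          have e : ∀ u, {p : V × U | (c p, p.1) ∈ B}.indicator
              ((s ⁻¹' {j}).indicator fun _ => (1 : ℝ)) (v, u)
              = ∑ i, ((fun p => (c p, s p)) ⁻¹' {(i, j)}).indicator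
                (fun _ => B.indicator (fun _ => (1 : ℝ)) (i, v)) (v, u) := fun u => by
            rw [Finset.sum_eq_single (c (v, u))]
            · simp [Set.indicator_apply]
              by_cases h1 : (c (v, u), v) ∈ B <;> by_cases h2 : s (v, u) = j <;> simp [h1, h2]
            · intro i _ hi
              simp [Set.indicator_apply, Ne.symm hi]
            · simp
          simp only [e]
          rw [integral_finsetSum]
          · refine Finset.sum_congr rfl fun i _ => ?_
            rw [integral_fiberProb_mul (hc.prodMk hs)]
            by_cases h1 : (i, v) ∈ B
            · simp [h1, hQφ, hR]
            · simp [h1]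
          · intro i _
            have : Measurable fun u => ((fun p => (c p, s p)) ⁻¹' {(i, j)}).indicator
                (fun _ => B.indicator (fun _ => (1 : ℝ)) (i, v)) (v, u) :=
              (measurable_const.indicator ((hc.prodMk hs) (measurableSet_singleton (i, j)))).comp
                (by fun_prop : Measurable fun u => (v, u))
            refine Integrable.of_bound this.aestronglyMeasurable 1 (Eventually.of_forall fun u => ?_)
            refine (norm_indicator_le_norm_self _ _).trans
              ((norm_indicator_le_norm_self _ _).trans ?_)
            simp
      _ = _ := by
          refine integral_congr_ae (Eventually.of_forall fun ω => ?_)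
          simp [Set.indicator_apply]
  have hη := Real.continuous_negMulLog.measurable
  have hsum : (fun ω => ∑ j, Real.negMulLog ((P⟦(fun ω => s (Y ω, N ω)) ⁻¹' {j} |
      MeasurableSpace.comap (fun ω => (c (Y ω, N ω), Y ω)) inferInstance⟧) ω))
      =ᵐ[P] fun ω => ∑ j, Real.negMulLog (φ j (c (Y ω, N ω), Y ω)) := by
    have := ae_all_iff.2 hcond
    filter_upwards [this] with ω hω
    exact Finset.sum_congr rfl fun i _ => by rw [hω i]
  have hFm : Measurable fun p => ∑ j, Real.negMulLog (φ j p) :=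
    Finset.measurable_fun_sum _ fun j _ => hη.comp (hφm j)
  rw [condEntropy, integral_congr_ae hsum, hint (fun p => ∑ j, Real.negMulLog (φ j p)) hFm
    (Fintype.card σ) fun p => (norm_sum_le _ _).trans ((Finset.sum_le_sum fun j _ =>
      negMulLog_mem_Icc (hφ0 j p) (hφ1 j p)).trans (by simp))]
  refine integral_congr_ae (Eventually.of_forall fun v => Finset.sum_congr rfl fun i _ => ?_)
  rw [Finset.mul_sum]
  -- The chain rule pointwise: Q η(R/Q) = η(R) + R log Q, where η = `Real.negMulLog`, and the second
  -- term sums over j to −η(Q).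
  have e : ∀ j, Q i v * Real.negMulLog (φ j (i, v))
      = Real.negMulLog (R i j v) + R i j v * Real.log (Q i v) := fun j => by
    have h1 := Real.negMulLog_mul (Q i v) (φ j (i, v))
    rw [hQφ] at h1
    have h2 : φ j (i, v) * Real.negMulLog (Q i v) = -(R i j v * Real.log (Q i v)) := by
      rw [← hQφ i j v, Real.negMulLog]; ring
    linarith
  simp only [e]
  rw [Finset.sum_add_distrib, ← Finset.sum_mul, hsumR, Real.negMulLog]
  ring

end Chain

end CondEntropy

/-! ### The converse for one block -/

section OneShot

/-- Gibbs' inequality for an unnormalised p: relative entropy to the comparison weights t is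
nonnegative. Uniform weights give the logarithm of the cardinality, and weights favouring one guess
give Fano's inequality. -/
theorem sum_negMulLog_sub_le {ι : Type*} (S : Finset ι) {p t : ι → ℝ} (hp : ∀ i ∈ S, 0 ≤ p i)
    (ht : ∀ i ∈ S, 0 < t i) (ht1 : ∑ i ∈ S, t i ≤ 1) :
    ∑ i ∈ S, Real.negMulLog (p i) - Real.negMulLog (∑ i ∈ S, p i)
      ≤ ∑ i ∈ S, p i * (-Real.log (t i)) := by
  set q := ∑ i ∈ S, p i with hq
  have hq0 : 0 ≤ q := Finset.sum_nonneg hp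
  rcases hq0.eq_or_lt with h | h
  · have hz : ∀ i ∈ S, p i = 0 := (Finset.sum_eq_zero_iff_of_nonneg hp).1 h.symm
    have z1 : ∑ i ∈ S, Real.negMulLog (p i) = 0 := Finset.sum_eq_zero fun i hi => by simp [hz i hi]
    have z2 : ∑ i ∈ S, p i * (-Real.log (t i)) = 0 :=
      Finset.sum_eq_zero fun i hi => by simp [hz i hi]
    rw [z1, z2, ← h]; simp
  · have key : ∀ i ∈ S, Real.negMulLog (p i)
        ≤ p i * (-Real.log (t i)) + p i * (-Real.log q) + (t i * q - p i) := fun i hi => by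
      rcases (hp i hi).eq_or_lt with h0 | h0
      · rw [← h0]; simp; exact mul_nonneg (ht i hi).le h.le
      · have h1 := Real.log_le_sub_one_of_pos (div_pos (mul_pos (ht i hi) h) h0)
        rw [Real.log_div (mul_pos (ht i hi) h).ne' h0.ne', Real.log_mul (ht i hi).ne' h.ne'] at h1
        have h2 := mul_le_mul_of_nonneg_left h1 h0.le
        have h3 : p i * (t i * q / p i - 1) = t i * q - p i := by field_simp
        rw [h3] at h2
        rw [Real.negMulLog]
        linarith
    have hs := Finset.sum_le_sum key
    rw [Finset.sum_add_distrib, Finset.sum_add_distrib, Finset.sum_sub_distrib, ← Finset.sum_mul,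
      ← Finset.sum_mul, ← hq] at hs
    have h4 : (∑ i ∈ S, t i) * q ≤ 1 * q := mul_le_mul_of_nonneg_right ht1 hq0
    have h5 : Real.negMulLog q = q * (-Real.log q) := by rw [Real.negMulLog]; ring
    rw [h5]
    linarith

theorem sum_negMulLog_le_log_card {ι : Type*} [Fintype ι] [Nonempty ι] {p : ι → ℝ}
    (hp : ∀ i, 0 ≤ p i) (hp1 : ∑ i, p i = 1) :
    ∑ i, Real.negMulLog (p i) ≤ Real.log (Fintype.card ι) := by
  have hc : (0 : ℝ) < Fintype.card ι := by exact_mod_cast Fintype.card_pos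
  have := sum_negMulLog_sub_le Finset.univ (p := p) (t := fun _ => 1 / (Fintype.card ι : ℝ))
    (fun i _ => hp i) (fun _ _ => by positivity) (by simp)
  rw [hp1, ← Finset.sum_mul, hp1] at this
  simpa using this

/-- Fano's inequality for a finite measure. -/
theorem sum_negMulLog_sub_le_fano {σ : Type*} [Fintype σ] {p : σ → ℝ}
    (hp : ∀ i, 0 ≤ p i) (j : σ) :
    ∑ i, Real.negMulLog (p i) - Real.negMulLog (∑ i, p i)
      ≤ (∑ i, p i) * Real.log 2 + (∑ i, p i - p j) * Real.log (Fintype.card σ) := by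
  classical
  have : Nonempty σ := ⟨j⟩
  have hc : (0 : ℝ) < Fintype.card σ := by exact_mod_cast Fintype.card_pos
  have hsplit : ∀ f : σ → ℝ, ∑ i, f i = f j + ∑ i ∈ Finset.univ.erase j, f i := fun f =>
    (Finset.add_sum_erase _ f (Finset.mem_univ j)).symm
  -- Half of the comparison mass goes on the guess j and at most half is spread uniformly over the
  -- other values. This yields log 2 instead of the binary entropy of the error, which is enough for
  -- the asymptotics.
  have h := sum_negMulLog_sub_le Finset.univ (p := p)
    (t := fun i => if i = j then 1 / 2 else 1 / (2 * (Fintype.card σ : ℝ))) (fun i _ => hp i)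
    (fun i _ => by split_ifs <;> positivity) (by
      rw [hsplit, if_pos rfl, Finset.sum_congr rfl fun i hi => if_neg (Finset.ne_of_mem_erase hi)]
      rw [Finset.sum_const, nsmul_eq_mul]
      have : ((Finset.univ.erase j).card : ℝ) ≤ Fintype.card σ := by
        exact_mod_cast Finset.card_le_univ _
      calc (1 : ℝ) / 2 + ((Finset.univ.erase j).card : ℝ) * (1 / (2 * (Fintype.card σ : ℝ)))
          ≤ 1 / 2 + (Fintype.card σ : ℝ) * (1 / (2 * (Fintype.card σ : ℝ))) := by gcongr
        _ = 1 := by field_simp; norm_num)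
  refine h.trans (le_of_eq ?_)
  rw [hsplit (fun i => p i * _), if_pos rfl, Finset.sum_congr rfl
    (fun i hi => by rw [if_neg (Finset.ne_of_mem_erase hi)]), ← Finset.sum_mul, hsplit p]
  rw [one_div, one_div, Real.log_inv, Real.log_inv, Real.log_mul two_ne_zero hc.ne']
  ring

theorem integral_indicator_comp_eq {α ι X : Type*} [MeasurableSpace α] {μ : Measure α}
    {W : X → ι} {m : α → X} (i : ι) (h : MeasurableSet {x | W (m x) = i}) :
    ∫ x, (W ⁻¹' {i}).indicator 1 (m x) ∂μ = μ.real {x | W (m x) = i} := by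
  classical
  rw [← integral_indicator_one h]
  refine integral_congr_ae (Eventually.of_forall fun x => ?_)
  simp [Set.indicator_apply]

theorem integrable_negMulLog_fiberProb {V U ι : Type*} [MeasurableSpace V] [MeasurableSpace U]
    [MeasurableSpace ι] [MeasurableSingletonClass ι] {β : Measure V} [IsProbabilityMeasure β]
    {ρ : Measure U} [IsProbabilityMeasure ρ] {w : V × U → ι} (hw : Measurable w) (i : ι) :
    Integrable (fun v => Real.negMulLog (fiberProb ρ w i v)) β :=
  integrable_negMulLog (fiberProb_measurable hw i) (fiberProb_nonneg i) (fiberProb_le_one i)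

theorem measurable_sum_negMulLog_fiberProb {V U ι : Type*} [MeasurableSpace V] [MeasurableSpace U]
    [Fintype ι] [MeasurableSpace ι] [MeasurableSingletonClass ι] {ρ : Measure U}
    [IsProbabilityMeasure ρ] {w : V × U → ι} (hw : Measurable w) :
    Measurable fun v => ∑ i, Real.negMulLog (fiberProb ρ w i v) :=
  Finset.measurable_fun_sum _ fun i _ =>
    Real.continuous_negMulLog.measurable.comp (fiberProb_measurable hw i)

theorem norm_sum_negMulLog_fiberProb_le {V U ι : Type*} [MeasurableSpace U] [Fintype ι]
    {ρ : Measure U} [IsProbabilityMeasure ρ] (w : V × U → ι) (v : V) :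
    ‖∑ i, Real.negMulLog (fiberProb ρ w i v)‖ ≤ (Fintype.card ι : ℝ) := by
  refine (norm_sum_le _ _).trans ((Finset.sum_le_sum (g := fun _ => (1 : ℝ)) fun i _ => ?_).trans
    (by simp))
  exact negMulLog_mem_Icc (fiberProb_nonneg i v) (fiberProb_le_one i v)

/-- The error probability of a guess of `s` from the first coordinate and `c`. -/
theorem measureReal_ne_eq_integral {Ω V U κ σ : Type*} [MeasurableSpace Ω] [MeasurableSpace V]
    [MeasurableSpace U] [Fintype κ] [MeasurableSpace κ] [MeasurableSingletonClass κ] [Countable σ]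
    [MeasurableSpace σ] [MeasurableSingletonClass σ] {P : Measure Ω}
    {β : Measure V} [IsProbabilityMeasure β] {ρ : Measure U} [IsProbabilityMeasure ρ]
    {Y : Ω → V} {N : Ω → U} (hY : Measurable Y) (hN : Measurable N)
    (hlaw : P.map (fun ω => (Y ω, N ω)) = β.prod ρ) {c : V × U → κ} {s : V × U → σ}
    (hc : Measurable c) (hs : Measurable s) {g : V × κ → σ} (hg : Measurable g) :
    P.real {ω | s (Y ω, N ω) ≠ g (Y ω, c (Y ω, N ω))}
      = ∫ v, ∑ i, (fiberProb ρ c i v - fiberProb ρ (fun p => (c p, s p)) (i, g (v, i)) v) ∂β := by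
  classical
  have hE : MeasurableSet {p : V × U | s p ≠ g (p.1, c p)} :=
    (measurableSet_eq_fun hs (hg.comp (measurable_fst.prodMk hc))).compl
  have hE' : MeasurableSet {ω | s (Y ω, N ω) ≠ g (Y ω, c (Y ω, N ω))} := (hY.prodMk hN) hE
  rw [← integral_indicator_one hE']
  have e := integral_comp_of_map_eq_prod hY hN hlaw
    (G := {p : V × U | s p ≠ g (p.1, c p)}.indicator 1) (measurable_one.indicator hE) (B := 1)
    fun p => (norm_indicator_le_norm_self _ _).trans (by simp)
  refine Eq.trans ?_ (e.trans ?_)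
  · refine integral_congr_ae (Eventually.of_forall fun ω => ?_)
    simp [Set.indicator_apply]
  · refine integral_congr_ae (Eventually.of_forall fun v => ?_)
    have i1 : ∀ i, Integrable (fun u => (c ⁻¹' {i}).indicator (fun _ => (1 : ℝ)) (v, u)) ρ :=
      fun i => Integrable.of_bound (((measurable_const.indicator
        (hc (measurableSet_singleton i))).comp
          (by fun_prop : Measurable fun u => (v, u))).aestronglyMeasurable) 1
        (Eventually.of_forall fun u => (norm_indicator_le_norm_self _ _).trans (by simp))
    have i2 : ∀ i, Integrable (fun u => ((fun p => (c p, s p)) ⁻¹' {(i, g (v, i))}).indicator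
        (fun _ => (1 : ℝ)) (v, u)) ρ :=
      fun i => Integrable.of_bound (((measurable_const.indicator
        ((hc.prodMk hs) (measurableSet_singleton (i, g (v, i))))).comp
          (by fun_prop : Measurable fun u => (v, u))).aestronglyMeasurable) 1
        (Eventually.of_forall fun u => (norm_indicator_le_norm_self _ _).trans (by simp))
    have hpt : ∀ u, {p : V × U | s p ≠ g (p.1, c p)}.indicator (1 : V × U → ℝ) (v, u)
        = ∑ i, ((c ⁻¹' {i}).indicator (fun _ => (1 : ℝ)) (v, u)
          - ((fun p => (c p, s p)) ⁻¹' {(i, g (v, i))}).indicator (fun _ => (1 : ℝ)) (v, u)) :=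
      fun u => by
        rw [Finset.sum_eq_single (c (v, u))]
        · by_cases h : s (v, u) = g (v, c (v, u)) <;> simp [h]
        · intro i _ hi
          simp [Ne.symm hi]
        · simp
    simp only [hpt]
    refine (integral_finsetSum _ fun i _ => (i1 i).sub (i2 i)).trans ?_
    refine Finset.sum_congr rfl fun i _ => (integral_sub (i1 i) (i2 i)).trans ?_
    rw [integral_fiberProb_mul hc,
      integral_fiberProb_mul (hc.prodMk hs), mul_one, mul_one]

/-- The converse for one protocol over an additive-noise degraded source whose channel satisfies
an entropy contraction inequality. -/
theorem key_length_le {Ω E κ σ : Type*} [MeasurableSpace Ω] [AddCommGroup E] [Module ℝ E]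
    [MeasurableSpace E] [MeasurableAdd₂ E] [MeasurableConstSMul ℝ E]
    [Fintype κ] [MeasurableSpace κ] [MeasurableSingletonClass κ]
    [Fintype σ] [MeasurableSpace σ] [MeasurableSingletonClass σ] [Nonempty κ]
    {P : Measure Ω} [IsProbabilityMeasure P] {ζ β ρ : Measure E} [IsProbabilityMeasure ζ]
    [IsProbabilityMeasure β] [IsProbabilityMeasure ρ] {Z N₂ N₁ : Ω → E} (hZ : Measurable Z)
    (hN₂ : Measurable N₂) (hN₁ : Measurable N₁)
    (hlaw : P.map (fun ω => (Z ω, (N₂ ω, N₁ ω))) = ζ.prod (β.prod ρ)) {a b θ : ℝ}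
    (hθ0 : 0 ≤ θ) (hθ1 : θ ≤ 1) {q : E → ℝ} (hq : Measurable q)
    (hqi : Integrable (fun p : E × E => q (a • p.1 + p.2)) (β.prod ρ))
    (H : IsEntropyContraction β ρ (fun p : E × E => a • p.1 + p.2) θ q)
    {c : E → κ} {s : E → σ} {g : E × κ → σ} (hc : Measurable c) (hs : Measurable s)
    (hg : Measurable g) {X Y : Ω → E} (hY : ∀ ω, Y ω = b • Z ω + N₂ ω)
    (hX : ∀ ω, X ω = a • Y ω + N₁ ω) :
    (1 - θ) * condEntropy P (fun ω => s (X ω)) (fun ω => (c (X ω), Z ω))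
      ≤ θ * Real.log (Fintype.card κ) + ∫ p, q (a • p.1 + p.2) ∂(β.prod ρ) + Real.log 2
        + P.real {ω | s (X ω) ≠ g (Y ω, c (X ω))} * Real.log (Fintype.card σ) := by
  have hYm : Measurable Y := by
    rw [funext hY]; fun_prop
  obtain rfl : Y = _ := funext hY
  obtain rfl : X = _ := funext hX
  set μ : Measure E := P.map (fun ω => b • Z ω + N₂ ω) with hμ
  have : IsProbabilityMeasure μ := Measure.isProbabilityMeasure_map hYm.aemeasurable
  have hlawYZ : P.map (fun ω => (b • Z ω + N₂ ω, N₁ ω)) = μ.prod ρ := by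
    have e1 : P.map (fun ω => (b • Z ω + N₂ ω, N₁ ω))
        = (ζ.prod (β.prod ρ)).map (fun p : E × (E × E) => (b • p.1 + p.2.1, p.2.2)) := by
      rw [← hlaw, Measure.map_map (by fun_prop) (by fun_prop)]; rfl
    have e2 : (ζ.prod (β.prod ρ)).map (fun p : E × (E × E) => (b • p.1 + p.2.1, p.2.2))
        = ((ζ.prod β).map (fun p : E × E => b • p.1 + p.2)).prod ρ := by
      rw [← Measure.prodAssoc_prod, Measure.map_map (by fun_prop) (by fun_prop)]
      have := Measure.map_prod_map (ζ.prod β) ρ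
        (by fun_prop : Measurable fun p : E × E => b • p.1 + p.2) measurable_id
      rw [Measure.map_id] at this
      rw [this]; rfl
    have e3 : (ζ.prod β).map (fun p : E × E => b • p.1 + p.2) = μ := by
      have := congrArg (Measure.map fun p : E × (E × E) => b • p.1 + p.2.1) hlaw
      rw [Measure.map_map (by fun_prop) (by fun_prop)] at this
      rw [hμ]
      refine Eq.trans ?_ this.symm
      rw [← Measure.prodAssoc_prod, Measure.map_map (by fun_prop) (by fun_prop)]
      have h2 : (ζ.prod β) = ((ζ.prod β).prod ρ).map Prod.fst := by
        rw [Measure.map_fst_prod]; simp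
      conv_lhs => rw [h2]
      rw [Measure.map_map (by fun_prop) (by fun_prop)]; rfl
    rw [e1, e2, e3]
  have hμint : ∀ G : E → ℝ, Measurable G → ∀ B, (∀ y, ‖G y‖ ≤ B) →
      ∫ y, G y ∂μ = ∫ z, ∫ v, G (b • z + v) ∂β ∂ζ ∧
      Integrable (fun z => ∫ v, G (b • z + v) ∂β) ζ := fun G hG B hB => by
    have e : ∫ y, G y ∂μ = ∫ ω, G (b • Z ω + N₂ ω) ∂P := by
      rw [hμ, integral_map hYm.aemeasurable hG.aestronglyMeasurable]
    have e2 := integral_comp_of_map_eq_prod hZ (hN₂.prodMk hN₁) hlaw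
      (G := fun p => G (b • p.1 + p.2.1)) (by fun_prop) fun p => hB _
    refine ⟨?_, ?_⟩
    · rw [e, e2]
      refine integral_congr_ae (Eventually.of_forall fun z => ?_)
      simp only
      rw [integral_fun_fst (fun v => G (b • z + v))]; simp
    · have hi : Integrable (fun p : E × E => G (b • p.1 + p.2)) (ζ.prod β) :=
        Integrable.of_bound (Measurable.aestronglyMeasurable (by fun_prop)) B
          (Eventually.of_forall fun p => hB _)
      exact hi.integral_prod_left
  -- the entropies
  let wY : E × E → κ × σ := fun p => (c (a • p.1 + p.2), s (a • p.1 + p.2))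
  let cY : E × E → κ := fun p => c (a • p.1 + p.2)
  let wZ : E × (E × E) → κ × σ := fun p =>
    (c (a • (b • p.1 + p.2.1) + p.2.2), s (a • (b • p.1 + p.2.1) + p.2.2))
  let cZ : E × (E × E) → κ := fun p => c (a • (b • p.1 + p.2.1) + p.2.2)
  have hwY : Measurable wY := by fun_prop
  have hcY : Measurable cY := by fun_prop
  have hwZ : Measurable wZ := by fun_prop
  have hcZ : Measurable cZ := by fun_prop
  let HWY : ℝ := ∫ y, ∑ i, Real.negMulLog (fiberProb ρ wY i y) ∂μ
  let HCY : ℝ := ∫ y, ∑ i, Real.negMulLog (fiberProb ρ cY i y) ∂μ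
  let HWZ : ℝ := ∫ z, ∑ i, Real.negMulLog (fiberProb (β.prod ρ) wZ i z) ∂ζ
  let HCZ : ℝ := ∫ z, ∑ i, Real.negMulLog (fiberProb (β.prod ρ) cZ i z) ∂ζ
  have iWY : Integrable (fun y => ∑ i, Real.negMulLog (fiberProb ρ wY i y)) μ :=
    integrable_finsetSum _ fun i _ => integrable_negMulLog_fiberProb hwY i
  have iCY : Integrable (fun y => ∑ i, Real.negMulLog (fiberProb ρ cY i y)) μ :=
    integrable_finsetSum _ fun i _ => integrable_negMulLog_fiberProb hcY i
  have iWZ : Integrable (fun y => ∑ i, Real.negMulLog (fiberProb (β.prod ρ) wZ i y)) ζ :=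
    integrable_finsetSum _ fun i _ => integrable_negMulLog_fiberProb hwZ i
  have iCZ : Integrable (fun y => ∑ i, Real.negMulLog (fiberProb (β.prod ρ) cZ i y)) ζ :=
    integrable_finsetSum _ fun i _ => integrable_negMulLog_fiberProb hcZ i
  have hchain : condEntropy P (fun ω => s (a • (b • Z ω + N₂ ω) + N₁ ω))
      (fun ω => (c (a • (b • Z ω + N₂ ω) + N₁ ω), Z ω)) = HWZ - HCZ := by
    have := condEntropy_prod_eq_integral_fiberProb hZ (hN₂.prodMk hN₁) hlaw (c := cZ)
      (s := fun p => s (a • (b • p.1 + p.2.1) + p.2.2)) hcZ (by fun_prop)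
    refine this.trans ?_
    rw [← integral_sub iWZ iCZ]
    refine integral_congr_ae (Eventually.of_forall fun z => ?_)
    simp only [Finset.sum_sub_distrib, Fintype.sum_prod_type, wZ, cZ]
  obtain ⟨eWY, iWY'⟩ := hμint _ (measurable_sum_negMulLog_fiberProb (ρ := ρ) hwY) _
    (norm_sum_negMulLog_fiberProb_le (ρ := ρ) wY)
  obtain ⟨eCY, iCY'⟩ := hμint _ (measurable_sum_negMulLog_fiberProb (ρ := ρ) hcY) _
    (norm_sum_negMulLog_fiberProb_le (ρ := ρ) cY)
  -- contraction
  have hcontr : (1 - θ) * HWZ ≤ HWY + ∫ p, q (a • p.1 + p.2) ∂(β.prod ρ) := by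
    have hz : ∀ z, (1 - θ) * ∑ i, Real.negMulLog (fiberProb (β.prod ρ) wZ i z)
        ≤ ∫ v, ∑ i, Real.negMulLog (fiberProb ρ wY i (b • z + v)) ∂β
          + ∫ p, q (a • p.1 + p.2) ∂(β.prod ρ) := fun z => by
      -- Conditioning on Z = z only translates the input of the protocol. The contraction holds for
      -- arbitrary partitions, so one centred inequality covers all z.
      let W : E → κ × σ := fun x => (c (a • (b • z) + x), s (a • (b • z) + x))
      have hW : Measurable W := by fun_prop
      have K := H.partition (by fun_prop) hq hqi (W := W) fun w => hW (measurableSet_singleton w)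
      have k1 : ∀ i, ∫ p : E × E, (W ⁻¹' {i}).indicator 1 (a • p.1 + p.2) ∂(β.prod ρ)
          = fiberProb (β.prod ρ) wZ i z := fun i => by
        rw [integral_indicator_comp_eq (m := fun p : E × E => a • p.1 + p.2) i
          (measurableSet_eq_fun (hW.comp (by fun_prop)) measurable_const)]
        simp only [fiberProb, W, wZ, smul_add, add_assoc]
      have k2 : ∀ i v, ∫ u, (W ⁻¹' {i}).indicator 1 (a • v + u) ∂ρ
          = fiberProb ρ wY i (b • z + v) := fun i v => by
        rw [integral_indicator_comp_eq (m := fun u : E => a • v + u) i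
          (measurableSet_eq_fun (hW.comp (by fun_prop)) measurable_const)]
        simp only [fiberProb, W, wY, smul_add, add_assoc]
      simpa only [k1, k2] using K
    have := integral_mono (iWZ.const_mul (1 - θ)) (iWY'.add (integrable_const _)) hz
    rw [integral_const_mul, integral_add' iWY' (integrable_const _), integral_const,
      probReal_univ, one_smul, ← eWY] at this
    exact this
  -- conditioning on the degraded observation increases entropy
  have hmono : HCY ≤ HCZ := by
    change ∫ y, ∑ i, Real.negMulLog (fiberProb ρ cY i y) ∂μ ≤ _
    rw [eCY]
    refine integral_mono iCY' iCZ fun z => ?_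
    have hfm : ∀ i, Measurable fun v => fiberProb ρ cY i (b • z + v) := fun i =>
      (fiberProb_measurable hcY i).comp (by fun_prop)
    simp only
    rw [integral_finsetSum _ fun i _ => integrable_negMulLog (hfm i)
      (fun v => fiberProb_nonneg _ _) (fun v => fiberProb_le_one _ _)]
    refine Finset.sum_le_sum fun i _ => ?_
    have hi := (integral_mem_Icc (μ := β) (hfm i) (fun v => fiberProb_nonneg _ _)
      (fun v => fiberProb_le_one _ _)).1
    have hj := Real.concaveOn_negMulLog.le_map_integral
      -- Jensen's inequality: the law of C given Z is the average over N₂ of its law given Y.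
      Real.continuous_negMulLog.continuousOn isClosed_Ici
      (Eventually.of_forall fun v => fiberProb_nonneg (ρ := ρ) (w := cY) i (b • z + v)) hi
      (integrable_negMulLog (hfm i) (fun v => fiberProb_nonneg _ _) (fun v => fiberProb_le_one _ _))
    refine hj.trans (le_of_eq ?_)
    congr 1
    have hS : MeasurableSet {p : E × E | cZ (z, p) = i} :=
      (hcZ.comp (by fun_prop : Measurable fun p : E × E => (z, p))) (measurableSet_singleton i)
    have e : fiberProb (β.prod ρ) cZ i z = ∫ p, {p : E × E | cZ (z, p) = i}.indicator 1 p
        ∂(β.prod ρ) := by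
      rw [integral_indicator_one hS]; rfl
    have e' := integral_prod (μ := β) (ν := ρ) ({p : E × E | cZ (z, p) = i}.indicator 1)
      ((integrable_const (1 : ℝ)).indicator hS)
    refine Eq.trans ?_ (e.trans e').symm
    refine integral_congr_ae (Eventually.of_forall fun v => ?_)
    simp only [fiberProb]
    have hS' : MeasurableSet {u | cY (b • z + v, u) = i} :=
      (hcY.comp (by fun_prop : Measurable fun u : E => (b • z + v, u))) (measurableSet_singleton i)
    rw [← integral_indicator_one hS']
    rfl
  -- Fano
  have hcard : HCY ≤ Real.log (Fintype.card κ) := by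
    have := integral_mono iCY (integrable_const (Real.log (Fintype.card κ))) fun y =>
      sum_negMulLog_le_log_card (fun i => fiberProb_nonneg i y) (sum_fiberProb hcY y)
    simpa using this
  have hfano : HWY - HCY ≤ Real.log 2
      + P.real {ω | s (a • (b • Z ω + N₂ ω) + N₁ ω)
          ≠ g (b • Z ω + N₂ ω, c (a • (b • Z ω + N₂ ω) + N₁ ω))}
        * Real.log (Fintype.card σ) := by
    have herr := measureReal_ne_eq_integral hYm hN₁ hlawYZ hcY
      (s := fun p => s (a • p.1 + p.2)) (by fun_prop) hg
    have herr' : P.real {ω | s (a • (b • Z ω + N₂ ω) + N₁ ω)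
          ≠ g (b • Z ω + N₂ ω, c (a • (b • Z ω + N₂ ω) + N₁ ω))}
        = ∫ y, ∑ i, (fiberProb ρ cY i y - fiberProb ρ wY (i, g (y, i)) y) ∂μ := herr
    have hpt : ∀ y, ∑ i, Real.negMulLog (fiberProb ρ wY i y)
        - ∑ i, Real.negMulLog (fiberProb ρ cY i y)
        ≤ Real.log 2 + (∑ i, (fiberProb ρ cY i y - fiberProb ρ wY (i, g (y, i)) y))
          * Real.log (Fintype.card σ) := fun y => by
      have hs1 : ∀ i, ∑ j, fiberProb ρ wY (i, j) y = fiberProb ρ cY i y := fun i =>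
        sum_fiberProb_prod hcY (s := fun p => s (a • p.1 + p.2)) (by fun_prop) i y
      -- Fano for each message value i separately, with its own guess g(y, i) and total mass P(C = i
      -- | Y = y); summing over i leaves a single log 2.
      have f := fun i => sum_negMulLog_sub_le_fano (p := fun j => fiberProb ρ wY (i, j) y)
        (fun j => fiberProb_nonneg _ _) (g (y, i))
      simp only [hs1] at f
      have hs := Finset.sum_le_sum fun i (_ : i ∈ Finset.univ) => f i
      rw [Finset.sum_sub_distrib, Finset.sum_add_distrib, ← Finset.sum_mul, ← Finset.sum_mul,
        sum_fiberProb hcY y, one_mul] at hs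
      rw [Fintype.sum_prod_type]
      exact hs
    have hgm : ∀ i, Measurable fun y => fiberProb ρ wY (i, g (y, i)) y := fun i => by
      have : Measurable fun p : E × σ => fiberProb ρ wY (i, p.2) p.1 :=
        measurable_from_prod_countable_left fun j => fiberProb_measurable hwY (i, j)
      exact this.comp (measurable_id.prodMk (hg.comp (by fun_prop)))
    have ierr : Integrable (fun y => ∑ i, (fiberProb ρ cY i y - fiberProb ρ wY (i, g (y, i)) y))
        μ := integrable_finsetSum _ fun i _ =>
      (integral_mem_Icc (fiberProb_measurable hcY i) (fun _ => fiberProb_nonneg _ _)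
        (fun _ => fiberProb_le_one _ _)).1.sub
      (integral_mem_Icc (hgm i) (fun _ => fiberProb_nonneg _ _) (fun _ => fiberProb_le_one _ _)).1
    have := integral_mono (iWY.sub iCY) ((integrable_const (Real.log 2)).add
      (ierr.mul_const (Real.log (Fintype.card σ)))) hpt
    rw [integral_sub' iWY iCY, integral_add' (integrable_const _) (ierr.mul_const _),
      integral_mul_const, ← herr', integral_const, probReal_univ, one_smul] at this
    exact this
  rw [hchain]
  -- Subtracting (1 − θ) H(C|Z) ≥ (1 − θ) H(C|Y) from the contraction bound leaves H(S|C,Y) + θ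
  -- H(C|Y) plus the constant; θ H(C|Y) is what the public message costs.
  have h1 : (1 - θ) * HCY ≤ (1 - θ) * HCZ := mul_le_mul_of_nonneg_left hmono (sub_nonneg.2 hθ1)
  have h2 : θ * HCY ≤ θ * Real.log (Fintype.card κ) := mul_le_mul_of_nonneg_left hcard hθ0
  linarith

end OneShot

/-! ### Independent-noise channels and Markov chains -/

section NoiseKernel

/-- The channel `b ↦ g (b, N)` with independent noise `N` of law `ρ`. -/
noncomputable def noiseKernel {β U γ : Type*} [MeasurableSpace β] [MeasurableSpace U]
    [MeasurableSpace γ] (ρ : Measure U) (g : β × U → γ) : Kernel β γ :=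
  (Kernel.id ×ₖ Kernel.const β ρ).map g

variable {Ω β U U' γ γ' : Type*} [MeasurableSpace Ω] [MeasurableSpace β] [MeasurableSpace U]
  [MeasurableSpace U'] [MeasurableSpace γ] [MeasurableSpace γ'] {ρ : Measure U}
  [IsProbabilityMeasure ρ] {ρ' : Measure U'} [IsProbabilityMeasure ρ']

theorem isMarkovKernel_noiseKernel {g : β × U → γ} (hg : Measurable g) :
    IsMarkovKernel (noiseKernel ρ g) :=
  Kernel.IsMarkovKernel.map _ hg

theorem lintegral_noiseKernel {g : β × U → γ} (hg : Measurable g) {f : γ → ℝ≥0∞}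
    (hf : Measurable f) (b : β) :
    ∫⁻ x, f x ∂(noiseKernel ρ g b) = ∫⁻ u, f (g (b, u)) ∂ρ := by
  rw [noiseKernel, Kernel.lintegral_map _ hg _ hf, Kernel.lintegral_prod _ _ _ (by fun_prop),
    Kernel.id_apply, lintegral_dirac' _ (by fun_prop)]
  rfl

theorem map_prodMk_eq_compProd_noiseKernel {P : Measure Ω} {B : Ω → β} {N : Ω → U}
    [SFinite (P.map B)] (hB : Measurable B) (hN : Measurable N)
    (hlaw : P.map (fun ω => (B ω, N ω)) = (P.map B).prod ρ) {g : β × U → γ} (hg : Measurable g) :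
    P.map (fun ω => (B ω, g (B ω, N ω))) = P.map B ⊗ₘ noiseKernel ρ g := by
  have := isMarkovKernel_noiseKernel (ρ := ρ) hg
  refine Measure.ext_of_lintegral _ fun f hf => ?_
  rw [Measure.lintegral_compProd hf, lintegral_map hf (by fun_prop)]
  calc ∫⁻ ω, f (B ω, g (B ω, N ω)) ∂P
      = ∫⁻ p, f (p.1, g p) ∂(P.map fun ω => (B ω, N ω)) :=
        (lintegral_map (f := fun p : β × U => f (p.1, g p))
          (g := fun ω => (B ω, N ω)) (by fun_prop) (by fun_prop)).symm
    _ = ∫⁻ b, ∫⁻ u, f (b, g (b, u)) ∂ρ ∂(P.map B) := by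
        rw [hlaw]
        exact lintegral_prod (fun p : β × U => f (p.1, g p))
          (Measurable.aemeasurable (by fun_prop))
    _ = _ := lintegral_congr fun b => (lintegral_noiseKernel hg
        (f := fun x => f (b, x)) (by fun_prop) b).symm

theorem condDistrib_ae_eq_noiseKernel [StandardBorelSpace γ] [Nonempty γ] {P : Measure Ω}
    [IsProbabilityMeasure P] {B : Ω → β} {N : Ω → U} (hB : Measurable B) (hN : Measurable N)
    (hlaw : P.map (fun ω => (B ω, N ω)) = (P.map B).prod ρ) {g : β × U → γ} (hg : Measurable g)
    {A : Ω → γ} (hA : ∀ ω, A ω = g (B ω, N ω)) :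
    condDistrib A B P =ᵐ[P.map B] noiseKernel ρ g := by
  obtain rfl : A = _ := funext hA
  have := isMarkovKernel_noiseKernel (ρ := ρ) hg
  exact condDistrib_ae_eq_of_measure_eq_compProd _ (by fun_prop)
    (map_prodMk_eq_compProd_noiseKernel hB hN hlaw hg)

theorem compProd_prod_congr {μ : Measure β} [SFinite μ] {κ κ' : Kernel β γ} {η η' : Kernel β γ'}
    [IsSFiniteKernel κ] [IsSFiniteKernel κ'] [IsSFiniteKernel η] [IsSFiniteKernel η']
    (h : κ =ᵐ[μ] κ') (h' : η =ᵐ[μ] η') : μ ⊗ₘ (κ ×ₖ η) = μ ⊗ₘ (κ' ×ₖ η') := by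
  refine Measure.compProd_congr ?_
  filter_upwards [h, h'] with b hb hb'
  rw [Kernel.prod_apply, Kernel.prod_apply, hb, hb']

/-- If `A = g (B, N)` where the noise `N` is independent of `(B, C)`, then `A – B – C` is a Markov
chain. -/
theorem isMarkovChain_of_noise [StandardBorelSpace γ] [Nonempty γ] [StandardBorelSpace γ']
    [Nonempty γ'] {P : Measure Ω} [IsProbabilityMeasure P] {A : Ω → γ} {B : Ω → β} {C : Ω → γ'}
    {N : Ω → U} (hB : Measurable B) (hC : Measurable C) (hN : Measurable N)
    (hlaw : P.map (fun ω => ((B ω, C ω), N ω)) = (P.map fun ω => (B ω, C ω)).prod ρ)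
    {g : β × U → γ} (hg : Measurable g) (hA : ∀ ω, A ω = g (B ω, N ω)) :
    IsMarkovChain P A B C := by
  have : IsProbabilityMeasure (P.map B) := Measure.isProbabilityMeasure_map hB.aemeasurable
  have : IsProbabilityMeasure (P.map fun ω => (B ω, C ω)) :=
    Measure.isProbabilityMeasure_map (by fun_prop)
  have := isMarkovKernel_noiseKernel (ρ := ρ) hg
  have hlawB : P.map (fun ω => (B ω, N ω)) = (P.map B).prod ρ := by
    have h := congrArg (Measure.map fun p : (β × γ') × U => (p.1.1, p.2)) hlaw
    have h' := Measure.map_prod_map (P.map fun ω => (B ω, C ω)) ρ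
      (by fun_prop : Measurable fun p : β × γ' => p.1) measurable_id
    rw [Measure.map_id, Measure.map_map (by fun_prop) (by fun_prop)] at h'
    rw [Measure.map_map (by fun_prop) (by fun_prop)] at h
    exact h.trans h'.symm
  rw [IsMarkovChain, compProd_prod_congr (condDistrib_ae_eq_noiseKernel hB hN hlawB hg hA)
    (EventuallyEq.refl _ _)]
  obtain rfl : A = _ := funext hA
  refine Measure.ext_of_lintegral _ fun f hf => ?_
  rw [Measure.lintegral_compProd hf, lintegral_map hf (by fun_prop)]
  calc ∫⁻ ω, f (B ω, g (B ω, N ω), C ω) ∂P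
      = ∫⁻ p, f (p.1.1, g (p.1.1, p.2), p.1.2) ∂(P.map fun ω => ((B ω, C ω), N ω)) :=
        (lintegral_map (f := fun p : (β × γ') × U => f (p.1.1, g (p.1.1, p.2), p.1.2))
          (g := fun ω => ((B ω, C ω), N ω)) (by fun_prop) (by fun_prop)).symm
    _ = ∫⁻ p, ∫⁻ u, f (p.1, g (p.1, u), p.2) ∂ρ ∂(P.map fun ω => (B ω, C ω)) := by
        rw [hlaw, lintegral_prod _ (Measurable.aemeasurable (by fun_prop))]
    _ = ∫⁻ b, ∫⁻ c, ∫⁻ u, f (b, g (b, u), c) ∂ρ ∂(condDistrib C B P b) ∂(P.map B) := by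
        rw [← compProd_map_condDistrib hC.aemeasurable, Measure.lintegral_compProd
          (Measurable.lintegral_prod_right' (ν := ρ)
            (f := fun q : (β × γ') × U => f (q.1.1, g (q.1.1, q.2), q.1.2)) (by fun_prop))]
    _ = _ := lintegral_congr fun b => by
        rw [Kernel.lintegral_prod _ _ _ (by fun_prop), lintegral_lintegral_swap (by fun_prop),
          lintegral_noiseKernel hg (Measurable.lintegral_prod_right'
            (ν := condDistrib C B P b) (f := fun q : γ × γ' => f (b, q.1, q.2)) (by fun_prop))]

/-- In a Markov chain `A – B – C` where `A = g (B, N)` with `N` independent of `B`, the noise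
`N = h (B, A)` is independent of `(B, C)`. -/
theorem IsMarkovChain.map_eq_prod_of_noise [StandardBorelSpace γ] [Nonempty γ]
    [StandardBorelSpace γ'] [Nonempty γ'] {P : Measure Ω} [IsProbabilityMeasure P] {A : Ω → γ}
    {B : Ω → β} {C : Ω → γ'} {N : Ω → U} (hm : IsMarkovChain P A B C) (hA : Measurable A)
    (hB : Measurable B) (hC : Measurable C) (hN : Measurable N)
    (hlaw : P.map (fun ω => (B ω, N ω)) = (P.map B).prod ρ) {g : β × U → γ} (hg : Measurable g)
    (hAg : ∀ ω, A ω = g (B ω, N ω)) {h : β × γ → U} (hh : Measurable h)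
    (hgh : ∀ b u, h (b, g (b, u)) = u) :
    P.map (fun ω => ((B ω, C ω), N ω)) = (P.map fun ω => (B ω, C ω)).prod ρ := by
  have : IsProbabilityMeasure (P.map B) := Measure.isProbabilityMeasure_map hB.aemeasurable
  have : IsProbabilityMeasure (P.map fun ω => (B ω, C ω)) :=
    Measure.isProbabilityMeasure_map (by fun_prop)
  have := isMarkovKernel_noiseKernel (ρ := ρ) hg
  rw [IsMarkovChain, compProd_prod_congr (condDistrib_ae_eq_noiseKernel hB hN hlaw hg hAg)
    (EventuallyEq.refl _ _)] at hm
  -- The noise is a function of A and B, so its joint law with (B, C) can be read off from the joint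
  -- law that the Markov property describes.
  have hNh : ∀ ω, N ω = h (B ω, A ω) := fun ω => by rw [hAg, hgh]
  refine Measure.ext_of_lintegral _ fun f hf => ?_
  rw [lintegral_map hf (by fun_prop), lintegral_prod _ hf.aemeasurable,
    ← compProd_map_condDistrib hC.aemeasurable,
    Measure.lintegral_compProd (by exact hf.lintegral_prod_right')]
  calc ∫⁻ ω, f ((B ω, C ω), N ω) ∂P
      = ∫⁻ p, f ((p.1, p.2.2), h (p.1, p.2.1)) ∂(P.map fun ω => (B ω, A ω, C ω)) := by
        rw [lintegral_map (by fun_prop) (by fun_prop)]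
        simp only [hNh]
    _ = _ := by
        rw [hm, Measure.lintegral_compProd (by fun_prop)]
        refine lintegral_congr fun b => ?_
        rw [Kernel.lintegral_prod _ _ _ (by fun_prop),
          lintegral_lintegral_swap (by fun_prop)]
        refine lintegral_congr fun c => ?_
        rw [lintegral_noiseKernel hg (f := fun a => f ((b, c), h (b, a))) (by fun_prop)]
        simp only [hgh]

end NoiseKernel

/-! ### The degraded Gaussian source as an additive cascade -/

section Source

variable {Ω : Type*} [MeasurableSpace Ω] {P : Measure Ω}

/-- Linear regression of jointly Gaussian variables: the residual is independent Gaussian noise. -/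
theorem HasGaussianLaw.map_regression [IsProbabilityMeasure P] {A B : Ω → ℝ} (h : HasGaussianLaw (fun ω => (A ω, B ω)) P)
    (hA : Measurable A) (hB : Measurable B) (hA0 : P[A] = 0) (hB0 : P[B] = 0)
    {m : ℝ} (hm : m * Var[B; P] = cov[A, B; P]) :
    P.map (fun ω => (B ω, A ω - m * B ω))
      = (P.map B).prod (gaussianReal 0 (Var[fun ω => A ω - m * B ω; P]).toNNReal) := by
  have hpair : HasGaussianLaw (fun ω => (B ω, A ω - m * B ω)) P :=
    h.map_fun ((ContinuousLinearMap.snd ℝ ℝ ℝ).prod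
      (ContinuousLinearMap.fst ℝ ℝ ℝ - m • ContinuousLinearMap.snd ℝ ℝ ℝ))
  have hcov : cov[B, fun ω => A ω - m * B ω; P] = 0 := by
    have hA2 : MemLp A 2 P := h.fst.memLp_two
    have hB2 : MemLp B 2 P := h.snd.memLp_two
    rw [covariance_fun_sub_right hB2 hA2 (hB2.const_mul m), covariance_const_mul_right,
      covariance_self hB.aemeasurable, covariance_comm, hm, sub_self]
  have hind := HasGaussianLaw.indepFun_of_covariance_eq_zero hpair hcov
  rw [(indepFun_iff_map_prod_eq_prod_map_map (by fun_prop) (by fun_prop)).1 hind]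
  have hN : HasGaussianLaw (fun ω => A ω - m * B ω) P := hpair.snd
  rw [hN.map_eq_gaussianReal]
  congr 2
  rw [integral_sub h.fst.integrable (h.snd.integrable.const_mul m), integral_const_mul, hA0, hB0]
  simp

/-- The variance is the quadratic form of the covariance matrix at x. It makes the regressions well
defined and both residual noises nondegenerate. -/
theorem variance_pos_of_posDef_tripleCov [IsProbabilityMeasure P] {X Y Z : Ω → ℝ} (hX : MemLp X 2 P)
    (hY : MemLp Y 2 P) (hZ : MemLp Z 2 P) (hcov : (tripleCov P X Y Z).PosDef) (x : Fin 3 → ℝ)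
    (hx : x ≠ 0) : 0 < Var[fun ω => x 0 * X ω + x 1 * Y ω + x 2 * Z ω; P] := by
  have h := hcov.dotProduct_mulVec_pos hx
  have e : (fun ω => x 0 * X ω + x 1 * Y ω + x 2 * Z ω)
      = fun ω => ∑ i, (x i * ![X, Y, Z] i ω) := by
    funext ω; simp [Fin.sum_univ_three]
  have hm : ∀ i, MemLp (fun ω => x i * ![X, Y, Z] i ω) 2 P := fun i => by
    refine MemLp.const_mul ?_ _
    fin_cases i <;> assumption
  refine h.trans_eq ?_
  rw [e, ← covariance_self (memLp_finsetSum _ fun i _ => hm i).aemeasurable,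
    covariance_fun_sum_fun_sum hm hm]
  simp only [covariance_const_mul_left, covariance_const_mul_right, dotProduct, Matrix.mulVec,
    tripleCov, Matrix.of_apply, Pi.star_apply, star_trivial, Finset.mul_sum]
  exact Finset.sum_congr rfl fun i _ => Finset.sum_congr rfl fun j _ => by ring

/-- A degraded Gaussian source is a cascade of two channels with independent additive Gaussian
noises. -/
theorem exists_additive_noise [IsProbabilityMeasure P] {X Y Z : Ω → ℝ} (hX : Measurable X) (hY : Measurable Y)
    (hZ : Measurable Z) (hgauss : HasGaussianLaw (fun ω => (X ω, Y ω, Z ω)) P)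
    (hX0 : P[X] = 0) (hY0 : P[Y] = 0) (hZ0 : P[Z] = 0)
    (hcov : (tripleCov P X Y Z).PosDef) (hdeg : IsMarkovChain P X Y Z) :
    ∃ (a b : ℝ) (t r : NNReal), t ≠ 0 ∧ r ≠ 0 ∧
      P.map (fun ω => (Z ω, (Y ω - b * Z ω, X ω - a * Y ω)))
        = (P.map Z).prod ((gaussianReal 0 t).prod (gaussianReal 0 r)) := by
  have hYZ : HasGaussianLaw (fun ω => (Y ω, Z ω)) P := hgauss.snd
  have hXYg : HasGaussianLaw (fun ω => (X ω, Y ω)) P := hgauss.map_fun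
    ((ContinuousLinearMap.fst ℝ ℝ (ℝ × ℝ)).prod
      ((ContinuousLinearMap.fst ℝ ℝ ℝ).comp (ContinuousLinearMap.snd ℝ ℝ (ℝ × ℝ))))
  have hX2 : MemLp X 2 P := hXYg.fst.memLp_two
  have hY2 : MemLp Y 2 P := hYZ.fst.memLp_two
  have hZ2 : MemLp Z 2 P := hYZ.snd.memLp_two
  have pos := fun x hx => variance_pos_of_posDef_tripleCov hX2 hY2 hZ2 hcov x hx
  have vY : Var[Y; P] ≠ 0 := by
    have := (pos ![0, 1, 0] (by simp)).ne'
    simpa using this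
  have vZ : Var[Z; P] ≠ 0 := by
    have := (pos ![0, 0, 1] (by simp)).ne'
    simpa using this
  set a := cov[X, Y; P] / Var[Y; P] with ha
  set b := cov[Y, Z; P] / Var[Z; P] with hb
  have v1 : 0 < Var[fun ω => X ω - a * Y ω; P] := by
    have := pos ![1, -a, 0] (by simp)
    simpa [sub_eq_add_neg] using this
  have v2 : 0 < Var[fun ω => Y ω - b * Z ω; P] := by
    have := pos ![0, 1, -b] (by simp)
    simpa [sub_eq_add_neg] using this
  refine ⟨a, b, (Var[fun ω => Y ω - b * Z ω; P]).toNNReal, (Var[fun ω => X ω - a * Y ω; P]).toNNReal,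
    by simpa using v2, by simpa using v1, ?_⟩
  have l1 := HasGaussianLaw.map_regression hXYg hX hY hX0 hY0 (m := a) (div_mul_cancel₀ _ vY)
  have l2 := HasGaussianLaw.map_regression hYZ hY hZ hY0 hZ0 (m := b) (div_mul_cancel₀ _ vZ)
  -- Degradedness enters here: regression alone makes the residual X − aY independent of Y, and the
  -- Markov chain makes it independent of (Y, Z).
  have l3 := hdeg.map_eq_prod_of_noise hX hY hZ (N := fun ω => X ω - a * Y ω) (by fun_prop) l1
    (g := fun p => a * p.1 + p.2) (by fun_prop) (fun ω => by ring)
    (h := fun p => p.2 - a * p.1) (by fun_prop) (fun y u => by ring)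
  have l4 := congrArg (Measure.map fun p : (ℝ × ℝ) × ℝ => ((p.1.2, p.1.1 - b * p.1.2), p.2)) l3
  have := Measure.isProbabilityMeasure_map (μ := P) hZ.aemeasurable
  have := Measure.isProbabilityMeasure_map (μ := P) (hY.prodMk hZ).aemeasurable
  rw [Measure.map_map (by fun_prop) (by fun_prop)] at l4
  have h5 := Measure.map_prod_map (P.map fun ω => (Y ω, Z ω))
    (gaussianReal 0 (Var[fun ω => X ω - a * Y ω; P]).toNNReal)
    (by fun_prop : Measurable fun p : ℝ × ℝ => (p.2, p.1 - b * p.2)) measurable_id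
  rw [Measure.map_id, Measure.map_map (by fun_prop) (by fun_prop)] at h5
  have h6 := l4.trans h5.symm
  simp only [Function.comp_def] at h6
  rw [l2] at h6
  have h7 := congrArg (Measure.map MeasurableEquiv.prodAssoc) h6
  rw [Measure.map_map (by fun_prop) (by fun_prop), Measure.prodAssoc_prod] at h7
  exact h7

theorem map_block_prodMk {α β : Type*} [MeasurableSpace α] [MeasurableSpace β] {μ : Measure α}
    {ν : Measure β} [IsProbabilityMeasure μ] [IsProbabilityMeasure ν] {A : Ω → α} {B : Ω → β}
    (hA : Measurable A) (hB : Measurable B) (h : P.map (fun ω => (A ω, B ω)) = μ.prod ν) (n : ℕ) :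
    (iidMeasure P n).map (fun ω => (block A n ω, block B n ω))
      = (Measure.pi fun _ => μ).prod (Measure.pi fun _ => ν) := by
  have e := (measurePreserving_arrowProdEquivProdArrow α β (Fin n) (fun _ => μ) fun _ => ν).map_eq
  have e2 := Measure.pi_map_pi (μ := fun _ : Fin n => P) (f := fun _ ω => (A ω, B ω))
    (hμ := fun _ => by rw [h]; infer_instance) fun _ => (hA.prodMk hB).aemeasurable
  simp only [h] at e2
  rw [← e, ← e2, Measure.map_map (by fun_prop) (by fun_prop)]
  rfl

theorem map_block_additive_noise {Z N₂ N₁ : Ω → ℝ} (hZ : Measurable Z) (hN₂ : Measurable N₂)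
    (hN₁ : Measurable N₁) {ζ β ρ : Measure ℝ} [IsProbabilityMeasure ζ] [IsProbabilityMeasure β]
    [IsProbabilityMeasure ρ] (h : P.map (fun ω => (Z ω, (N₂ ω, N₁ ω))) = ζ.prod (β.prod ρ))
    (n : ℕ) :
    (iidMeasure P n).map (fun ω => (block Z n ω, (block N₂ n ω, block N₁ n ω)))
      = (Measure.pi fun _ => ζ).prod ((Measure.pi fun _ => β).prod (Measure.pi fun _ => ρ)) := by
  have e := map_block_prodMk hZ (hN₂.prodMk hN₁) h n
  have e2 := (measurePreserving_arrowProdEquivProdArrow ℝ ℝ (Fin n) (fun _ => β) fun _ => ρ).map_eq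
  have hm : ∀ {γ : Type} [MeasurableSpace γ] {A : Ω → γ}, Measurable A → Measurable (block A n) :=
    fun hA => measurable_pi_lambda _ fun i => hA.comp (measurable_pi_apply i)
  have e3 := congrArg (Measure.map (Prod.map id
    (MeasurableEquiv.arrowProdEquivProdArrow ℝ ℝ (Fin n)))) e
  rw [Measure.map_map (by fun_prop) ((hm hZ).prodMk (hm (hN₂.prodMk hN₁))),
    ← Measure.map_prod_map _ _ measurable_id (by fun_prop), Measure.map_id, e2] at e3
  exact e3

end Source

/-! ### Passage to the limit and choice of the parameters -/

section Converse

/-- The converse for one protocol over a degraded Gaussian source. -/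
theorem KeyProtocol.log_numKey_le {Ω : Type*} [MeasurableSpace Ω] {P : Measure Ω}
    [IsProbabilityMeasure P] {X Y Z : Ω → ℝ} (hX : Measurable X) (hY : Measurable Y)
    (hZ : Measurable Z) {ζ : Measure ℝ} [IsProbabilityMeasure ζ] {t r τ ν s sY : ℝ≥0}
    {a α b θ : ℝ} (hP : IsGaussianPair t r τ ν a α)
    (hlaw : P.map (fun ω => (Z ω, (Y ω - b * Z ω, X ω - a * Y ω)))
      = ζ.prod ((gaussianReal 0 t).prod (gaussianReal 0 r)))
    (hs : s ≠ 0) (hsY : (sY : ℝ) = α ^ 2 * s + ν) (hθ : θ = α ^ 2 * s / sY) (hθ1 : θ ≤ 1) {n : ℕ}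
    (π : KeyProtocol n) :
    (1 - θ) * (Real.log π.numKey - π.leakage P X Z)
      ≤ θ * Real.log π.numMsg + n * contractionConst t τ s sY θ + Real.log 2
        + π.errorProb P X Y * Real.log π.numKey := by
  have hθ0 : 0 ≤ θ := by rw [hθ]; positivity
  have H := hP.isEntropyContraction hs hsY
  rw [← hθ] at H
  set q := contractionWeight t τ s sY θ α with hqdef
  have hq : Measurable q := (contractionWeight_continuous t τ s sY θ α).measurable
  have hmap := map_prod_gaussianReal hP.hτ
  have hqi : Integrable (fun p : ℝ × ℝ => q (a * p.1 + p.2))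
      ((gaussianReal 0 t).prod (gaussianReal 0 r)) := by
    have := integrable_contractionWeight τ t s sY θ α
    rw [← hmap, integrable_map_measure hq.aestronglyMeasurable (by fun_prop)] at this
    exact this
  have hqint : ∫ p : ℝ × ℝ, q (a * p.1 + p.2) ∂((gaussianReal 0 t).prod (gaussianReal 0 r))
      = contractionConst t τ s sY θ := by
    rw [← integral_contractionWeight τ t s sY θ α, ← hmap,
      integral_map (by fun_prop) hq.aestronglyMeasurable]
  obtain ⟨Hn, hin, hintn⟩ := H.pi hθ0 hq hqi n
  rw [hqint] at hintn
  have hm : ∀ {A : Ω → ℝ}, Measurable A → Measurable (block A n) :=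
    fun hA => measurable_pi_lambda _ fun i => hA.comp (measurable_pi_apply i)
  have : IsProbabilityMeasure (iidMeasure P n) := by unfold iidMeasure; infer_instance
  have : Nonempty (Fin π.numMsg) := ⟨π.msg 0⟩
  have hbl := map_block_additive_noise hZ (by fun_prop : Measurable fun ω => Y ω - b * Z ω)
    (by fun_prop : Measurable fun ω => X ω - a * Y ω) hlaw n
  have K := key_length_le (a := a) (b := b) (q := fun x : Fin n → ℝ => ∑ i, q (x i))
    (X := block X n) (Y := block Y n) (hm hZ)
    (hm (by fun_prop : Measurable fun ω => Y ω - b * Z ω))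
    (hm (by fun_prop : Measurable fun ω => X ω - a * Y ω)) hbl hθ0 hθ1
    (Finset.measurable_fun_sum _ fun i _ => hq.comp (measurable_pi_apply i)) hin Hn
    π.measurable_msg π.measurable_keyA π.measurable_keyB
    (fun ω => by funext i; simp [block]) (fun ω => by funext i; simp [block])
  have e : ∫ p : (Fin n → ℝ) × (Fin n → ℝ), ∑ i, q ((a • p.1 + p.2) i)
      ∂((Measure.pi fun _ : Fin n => gaussianReal 0 t).prod
        (Measure.pi fun _ : Fin n => gaussianReal 0 r)) = n * contractionConst t τ s sY θ := hintn
  rw [e, Fintype.card_fin, Fintype.card_fin] at K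
  rw [KeyProtocol.leakage, sub_sub_cancel]
  exact K

/-- The Fano term e n * K n is moved to the left, so no upper bound on the key rate is needed; this
is where θ < 1 matters. -/
theorem rate_le_of_tendsto {M K e l : ℕ → ℝ} {θ c d Rp Rk : ℝ} (hθ0 : 0 ≤ θ) (hθ1 : θ < 1)
    (h : ∀ n : ℕ, (1 - θ) * (K n - l n) ≤ θ * M n + n * c + d + e n * K n)
    (he : Tendsto e atTop (𝓝 0)) (hl : Tendsto l atTop (𝓝 0))
    (hM : limsup (fun n : ℕ => ((1 / (n : ℝ) * M n : ℝ) : EReal)) atTop ≤ (Rp : EReal))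
    (hK : (Rk : EReal) ≤ liminf (fun n : ℕ => ((1 / (n : ℝ) * K n : ℝ) : EReal)) atTop) :
    (1 - θ) * Rk ≤ θ * Rp + c := by
  have hinv : Tendsto (fun n : ℕ => 1 / (n : ℝ)) atTop (𝓝 0) := tendsto_one_div_atTop_nhds_zero_nat
  have key : ∀ ε : ℝ, 0 < ε → (1 - θ) * (Rk - ε) ≤ θ * (Rp + ε) + c := fun ε hε => by
    have hM' : ∀ᶠ n : ℕ in atTop, 1 / (n : ℝ) * M n < Rp + ε := by
      have := eventually_lt_of_limsup_lt (hM.trans_lt (b := (Rp : EReal)) (c := ((Rp + ε : ℝ) : EReal))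
        (by exact_mod_cast (by linarith : Rp < Rp + ε)))
      filter_upwards [this] with n hn using by exact_mod_cast hn
    have hK' : ∀ᶠ n : ℕ in atTop, Rk - ε < 1 / (n : ℝ) * K n := by
      have := eventually_lt_of_lt_liminf ((by exact_mod_cast (by linarith : Rk - ε < Rk) :
        ((Rk - ε : ℝ) : EReal) < (Rk : EReal)).trans_le hK)
      filter_upwards [this] with n hn using by exact_mod_cast hn
    -- Keeps the coefficient 1 − θ − e n of K n positive once the error term has been absorbed.
    have hpos : ∀ᶠ n : ℕ in atTop, e n < 1 - θ := he.eventually_lt_const (by linarith)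
    refine le_of_tendsto_of_tendsto (f := fun n : ℕ => (1 - θ - e n) * (Rk - ε))
      (g := fun n : ℕ => θ * (Rp + ε) + c + 1 / (n : ℝ) * (d + (1 - θ) * l n)) ?_ ?_ ?_
      (b := atTop)
    · simpa using (tendsto_const_nhds.sub he).mul_const (Rk - ε)
    · have : Tendsto (fun n : ℕ => 1 / (n : ℝ) * (d + (1 - θ) * l n)) atTop (𝓝 (0 * (d + (1 - θ) * 0))) :=
        hinv.mul (tendsto_const_nhds.add (hl.const_mul _))
      simpa using tendsto_const_nhds.add this
    · filter_upwards [hM', hK', hpos, eventually_gt_atTop 0] with n h1 h2 h3 h4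
      have hn : (0 : ℝ) < n := by exact_mod_cast h4
      have h5 := mul_le_mul_of_nonneg_left (h n) (one_div_pos.2 hn).le
      have h6 := mul_le_mul_of_nonneg_left h2.le (by linarith : 0 ≤ 1 - θ - e n)
      have h7 := mul_le_mul_of_nonneg_left h1.le hθ0
      have h8 : 1 / (n : ℝ) * (n * c) = c := by field_simp
      nlinarith
  have h1 : Tendsto (fun ε : ℝ => (1 - θ) * (Rk - ε)) (𝓝[>] 0) (𝓝 ((1 - θ) * (Rk - 0))) :=
    ((continuous_const.mul (continuous_const.sub continuous_id)).tendsto 0).mono_left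
      nhdsWithin_le_nhds
  have h2 : Tendsto (fun ε : ℝ => θ * (Rp + ε) + c) (𝓝[>] 0) (𝓝 (θ * (Rp + 0) + c)) :=
    (((continuous_const.mul (continuous_const.add continuous_id)).add continuous_const).tendsto
      0).mono_left nhdsWithin_le_nhds
  have := le_of_tendsto_of_tendsto h1 h2 (eventually_nhdsWithin_of_forall fun ε hε => key ε hε)
  simpa using this

theorem nonneg_of_limsup_rate_le {M : ℕ → ℝ} {R : ℝ} (h0 : ∀ n, 0 ≤ M n)
    (h : limsup (fun n : ℕ => ((1 / (n : ℝ) * M n : ℝ) : EReal)) atTop ≤ (R : EReal)) : 0 ≤ R := by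
  have : (0 : EReal) ≤ limsup (fun n : ℕ => ((1 / (n : ℝ) * M n : ℝ) : EReal)) atTop :=
    le_limsup_of_frequently_le (Frequently.of_forall fun n => by
      have : 0 ≤ 1 / (n : ℝ) * M n := mul_nonneg (by positivity) (h0 n)
      exact_mod_cast this)
  exact_mod_cast this.trans h

/-- The rates of an achievable pair for a degraded Gaussian source lie in the region swept out by
Gaussian auxiliary variables. -/
theorem exists_gaussian_rate_bound {Ω : Type*} [MeasurableSpace Ω] {P : Measure Ω}
    [IsProbabilityMeasure P] {X Y Z : Ω → ℝ} (hX : Measurable X) (hY : Measurable Y)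
    (hZ : Measurable Z) {ζ : Measure ℝ} [IsProbabilityMeasure ζ] {t r : ℝ≥0} (ht : t ≠ 0)
    (hr : r ≠ 0) {a b : ℝ}
    (hlaw : P.map (fun ω => (Z ω, (Y ω - b * Z ω, X ω - a * Y ω)))
      = ζ.prod ((gaussianReal 0 t).prod (gaussianReal 0 r)))
    {Rp Rk : ℝ} (hR : (Rp, Rk) ∈ achievableRegion P X Y Z) :
    ∃ w : ℝ, 0 ≤ w ∧ Rp = 1 / 2 * Real.log (1 + w * r) ∧
      Rk ≤ 1 / 2 * Real.log ((1 + w * (a ^ 2 * t + r)) / (1 + w * r)) := by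
  obtain ⟨π, herr, hleak, hM, hK⟩ := hR
  have htp : (0 : ℝ) < t := by exact_mod_cast pos_iff_ne_zero.2 ht
  have hrp : (0 : ℝ) < r := by exact_mod_cast pos_iff_ne_zero.2 hr
  have hRp : 0 ≤ Rp := nonneg_of_limsup_rate_le (fun n => Real.log_natCast_nonneg _) hM
  -- Solves ½ log(1 + wr) = Rp, and w ≥ 0 because Rp ≥ 0.
  set w : ℝ := (Real.exp (2 * Rp) - 1) / r with hw
  have hw0 : 0 ≤ w := div_nonneg (by linarith [Real.add_one_le_exp (2 * Rp)]) hrp.le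
  have hwr : 1 + w * r = Real.exp (2 * Rp) := by rw [hw]; field_simp; ring
  have hlog : Real.log (1 + w * r) = 2 * Rp := by rw [hwr, Real.log_exp]
  refine ⟨w, hw0, by rw [hlog]; ring, ?_⟩
  set τ : ℝ≥0 := NNReal.mk (a ^ 2) (sq_nonneg a) * t + r with hτ
  have hτ' : (τ : ℝ) = a ^ 2 * t + r := by simp [hτ]
  have hτp : (0 : ℝ) < τ := by rw [hτ']; positivity
  set α : ℝ := a * t / τ with hα
  set ν : ℝ≥0 := t * r / τ with hν
  have hν' : (ν : ℝ) = t * r / τ := by simp [hν]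
  have hνp : (0 : ℝ) < ν := by rw [hν']; positivity
  have hP : IsGaussianPair t r τ ν a α :=
    ⟨ht, hr, hτ', by rw [hν']; field_simp, by rw [hα]; field_simp⟩
  -- The variance of X given (U, Z) for U = √w X + N(0,1). Then sY is the variance of Y given (U,
  -- Z), and the contraction inequality is sharp at the intended auxiliary variable.
  set s : ℝ≥0 := τ / (1 + NNReal.mk w hw0 * τ) with hs
  have hs' : (s : ℝ) = τ / (1 + w * τ) := by simp [hs]
  have hsp : (0 : ℝ) < s := by rw [hs']; positivity
  set sY : ℝ≥0 := NNReal.mk (α ^ 2) (sq_nonneg α) * s + ν with hsY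
  have hsY' : (sY : ℝ) = α ^ 2 * s + ν := by simp [hsY]
  have hsYp : (0 : ℝ) < sY := by rw [hsY']; positivity
  set θ : ℝ := α ^ 2 * s / sY with hθ
  have hθ0 : 0 ≤ θ := by positivity
  have hθ1 : θ < 1 := by
    rw [hθ, div_lt_one hsYp, hsY']; linarith
  have hs0 : s ≠ 0 := by
    intro h; rw [h] at hsp; simp at hsp
  have key := rate_le_of_tendsto hθ0 hθ1
    (fun n => (π n).log_numKey_le hX hY hZ hP hlaw hs0 hsY' hθ hθ1.le) herr hleak hM hK
  have e1 : (τ : ℝ) / s = 1 + w * τ := by rw [hs']; field_simp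
  have e2 : (t : ℝ) / sY = (1 + w * τ) / (1 + w * r) := by
    have h1 : (sY : ℝ) = t * (1 + w * r) / (1 + w * τ) := by
      rw [hsY', hs', eq_div_iff (by positivity)]
      have h2 : α ^ 2 * (τ / (1 + w * τ)) * (1 + w * τ) = α ^ 2 * τ := by field_simp
      rw [add_mul, h2]
      linear_combination -hP.t_eq + w * hP.hν
    rw [h1]; field_simp
  rw [contractionConst, e1, e2] at key
  rw [← hτ']
  have h1 : Real.log ((1 + w * τ) / (1 + w * r)) = Real.log (1 + w * τ) - 2 * Rp := by
    rw [Real.log_div (by positivity) (by positivity), hlog]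
  -- With these parameters c = ½(1 − θ) log(1 + wτ) − Rp, so θ Rp + c has the factor 1 − θ.
  have h3 : (1 - θ) * Rk ≤ (1 - θ) * (1 / 2 * Real.log ((1 + w * τ) / (1 + w * r))) := by
    rw [h1] at key ⊢
    linarith
  exact le_of_mul_le_mul_left h3 (by linarith)

end Converse

/-! ### Conditional mutual information of a Gaussian cascade -/

section GaussianInformation

/-- Change of reference measure: the ratio of densities reweights N(0,τ) into N(d,ρ). -/
theorem lintegral_gaussianReal_mul_ratio {τ ρ : ℝ≥0} (hτ : τ ≠ 0) (hρ : ρ ≠ 0) (d : ℝ)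
    {f : ℝ → ℝ≥0∞} (hf : Measurable f) :
    ∫⁻ y, ENNReal.ofReal (gaussianPDFReal 0 ρ (y - d) / gaussianPDFReal 0 τ y) * f y
      ∂(gaussianReal 0 τ) = ∫⁻ u, f (d + u) ∂(gaussianReal 0 ρ) := by
  have m1 := measurable_gaussianPDFReal 0 τ
  have m2 := measurable_gaussianPDFReal 0 ρ
  rw [lintegral_gaussianReal hτ (by fun_prop), lintegral_gaussianReal hρ (by fun_prop),
    ← lintegral_add_left_eq_self _ d]
  refine lintegral_congr fun u => ?_
  have hpos := gaussianPDFReal_pos 0 τ (d + u) hτ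
  rw [add_sub_cancel_left, ← mul_assoc, gaussianPDF, gaussianPDF, ← ENNReal.ofReal_mul hpos.le,
    mul_div_cancel₀ _ hpos.ne']

/-- The mutual information `I(U; V | W)` for the cascade `V = m W + N`, `U = c V + N'` with
independent Gaussian noises. -/
theorem condMutualInfo_gaussian {Ω : Type*} [MeasurableSpace Ω] {P : Measure Ω}
    [IsProbabilityMeasure P] {U V W N N' : Ω → ℝ} (hW : Measurable W) (hN : Measurable N)
    (hN' : Measurable N') {v ρ : ℝ≥0} (hρ : ρ ≠ 0)
    (hlaw : P.map (fun ω => (W ω, (N ω, N' ω)))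
      = (P.map W).prod ((gaussianReal 0 v).prod (gaussianReal 0 ρ))) {m c : ℝ}
    (hV : ∀ ω, V ω = m * W ω + N ω) (hU : ∀ ω, U ω = c * V ω + N' ω) :
    condMutualInfo P U V W = ENNReal.ofReal (1 / 2 * Real.log ((c ^ 2 * v + ρ) / ρ)) := by
  have hρp : (0 : ℝ) < ρ := by exact_mod_cast pos_iff_ne_zero.2 hρ
  set τ : ℝ≥0 := NNReal.mk (c ^ 2) (sq_nonneg c) * v + ρ with hτ
  have hτ' : (τ : ℝ) = c ^ 2 * v + ρ := by simp [hτ]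
  have hτp : (0 : ℝ) < τ := by rw [hτ']; positivity
  have hτ0 : τ ≠ 0 := fun h => by rw [h] at hτp; simp at hτp
  have : IsProbabilityMeasure (P.map W) := Measure.isProbabilityMeasure_map hW.aemeasurable
  have hVm : Measurable V := by rw [funext hV]; fun_prop
  have hUm : Measurable U := by rw [funext hU]; fun_prop
  have mτ := measurable_gaussianPDFReal 0 τ
  have mρ := measurable_gaussianPDFReal 0 ρ
  -- the laws of the noises
  have lN : P.map (fun ω => (W ω, N ω)) = (P.map W).prod (gaussianReal 0 v) := by
    have h := congrArg (Measure.map fun p : ℝ × (ℝ × ℝ) => (p.1, p.2.1)) hlaw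
    have h' := Measure.map_prod_map (P.map W) ((gaussianReal 0 v).prod (gaussianReal 0 ρ))
      measurable_id (measurable_fst : Measurable (Prod.fst : ℝ × ℝ → ℝ))
    rw [Measure.map_id, Measure.map_fst_prod, measure_univ, one_smul] at h'
    rw [Measure.map_map (by fun_prop) (by fun_prop)] at h
    exact h.trans h'.symm
  have lM : P.map (fun ω => (W ω, c * N ω + N' ω)) = (P.map W).prod (gaussianReal 0 τ) := by
    have h := congrArg (Measure.map fun p : ℝ × (ℝ × ℝ) => (p.1, c * p.2.1 + p.2.2)) hlaw
    have h' := Measure.map_prod_map (P.map W) ((gaussianReal 0 v).prod (gaussianReal 0 ρ))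
      measurable_id (by fun_prop : Measurable fun p : ℝ × ℝ => c * p.1 + p.2)
    rw [Measure.map_id, map_prod_gaussianReal hτ'] at h'
    rw [Measure.map_map (by fun_prop) (by fun_prop)] at h
    exact h.trans h'.symm
  have lN' : P.map N' = gaussianReal 0 ρ := by
    have h := congrArg (Measure.map fun p : ℝ × (ℝ × ℝ) => p.2.2) hlaw
    rw [Measure.map_map (by fun_prop) (by fun_prop)] at h
    refine h.trans ?_
    have h2 : (fun p : ℝ × (ℝ × ℝ) => p.2.2) = Prod.snd ∘ Prod.snd := rfl
    rw [h2, ← Measure.map_map measurable_snd measurable_snd, Measure.map_snd_prod, measure_univ,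
      one_smul, Measure.map_snd_prod, measure_univ, one_smul]
  have lM' : P.map (fun ω => c * N ω + N' ω) = gaussianReal 0 τ := by
    have h := congrArg (Measure.map Prod.snd) lM
    rw [Measure.map_map (by fun_prop) (by fun_prop), Measure.map_snd_prod, measure_univ,
      one_smul] at h
    exact h
  -- the reference measure
  have gU : Measurable fun p : ℝ × ℝ => c * m * p.1 + p.2 := by fun_prop
  have gV : Measurable fun p : ℝ × ℝ => m * p.1 + p.2 := by fun_prop
  have := isMarkovKernel_noiseKernel (ρ := gaussianReal 0 τ) gU
  have := isMarkovKernel_noiseKernel (ρ := gaussianReal 0 v) gV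
  have eU := condDistrib_ae_eq_noiseKernel (A := U) hW (by fun_prop) lM gU fun ω => by
    rw [hU, hV]; ring
  have eV := condDistrib_ae_eq_noiseKernel (A := V) hW hN lN gV hV
  rw [condMutualInfo, compProd_prod_congr eU eV]
  set μ₂ := P.map W ⊗ₘ (noiseKernel (gaussianReal 0 τ) (fun p : ℝ × ℝ => c * m * p.1 + p.2) ×ₖ
    noiseKernel (gaussianReal 0 v) fun p : ℝ × ℝ => m * p.1 + p.2) with hμ₂
  -- The likelihood ratio: given V, U is N(cV, ρ); given W alone, it is N(cmW, τ).
  let D : ℝ × ℝ × ℝ → ℝ := fun p =>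
    gaussianPDFReal 0 ρ (p.2.1 - c * p.2.2) / gaussianPDFReal 0 τ (p.2.1 - c * m * p.1)
  have hD : Measurable D := by fun_prop
  have hμ₁ : P.map (fun ω => (W ω, U ω, V ω)) = μ₂.withDensity fun p => ENNReal.ofReal (D p) := by
    refine Measure.ext_of_lintegral _ fun f hf => ?_
    rw [lintegral_withDensity_eq_lintegral_mul _ (by fun_prop) hf, lintegral_map hf (by fun_prop)]
    calc ∫⁻ ω, f (W ω, U ω, V ω) ∂P
        = ∫⁻ ω, f (W ω, c * (m * W ω + N ω) + N' ω, m * W ω + N ω) ∂P := by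
          simp only [hU, hV]
      _ = ∫⁻ p, f (p.1, c * (m * p.1 + p.2.1) + p.2.2, m * p.1 + p.2.1)
            ∂(P.map fun ω => (W ω, (N ω, N' ω))) :=
          (lintegral_map (f := fun p : ℝ × (ℝ × ℝ) =>
              f (p.1, c * (m * p.1 + p.2.1) + p.2.2, m * p.1 + p.2.1))
            (g := fun ω => (W ω, (N ω, N' ω))) (by fun_prop) (by fun_prop)).symm
      _ = ∫⁻ w, ∫⁻ n, ∫⁻ u, f (w, c * (m * w + n) + u, m * w + n)
            ∂(gaussianReal 0 ρ) ∂(gaussianReal 0 v) ∂(P.map W) := by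
          rw [hlaw, lintegral_prod _ (Measurable.aemeasurable (by fun_prop))]
          exact lintegral_congr fun w => lintegral_prod _ (Measurable.aemeasurable (by fun_prop))
      _ = _ := by
          rw [hμ₂, Measure.lintegral_compProd (by fun_prop)]
          refine lintegral_congr fun w => ?_
          rw [Kernel.lintegral_prod _ _ _ (by fun_prop)]
          refine Eq.trans ?_ (lintegral_lintegral_swap
            (f := fun x y => ((fun p => ENNReal.ofReal (D p)) * f) (w, x, y))
            (Measurable.aemeasurable (by fun_prop))).symm
          rw [lintegral_noiseKernel gV (Measurable.lintegral_prod_right'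
              (f := fun q : ℝ × ℝ => ((fun p => ENNReal.ofReal (D p)) * f) (w, q.2, q.1))
              (by fun_prop))]
          refine lintegral_congr fun n => ?_
          rw [lintegral_noiseKernel gU (f := fun q => ((fun p => ENNReal.ofReal (D p)) * f)
            (w, q, m * w + n)) (by fun_prop)]
          have h := lintegral_gaussianReal_mul_ratio hτ0 hρ (c * n)
            (f := fun y => f (w, c * m * w + y, m * w + n)) (by fun_prop)
          refine Eq.trans (lintegral_congr fun u => ?_) (h.symm.trans (lintegral_congr fun y => ?_))
          · congr 2; ring_nf
          · simp only [Pi.mul_apply, D]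
            congr 4 <;> ring
  have hac : P.map (fun ω => (W ω, U ω, V ω)) ≪ μ₂ := by
    rw [hμ₁]; exact withDensity_absolutelyContinuous _ _
  have hDpos : ∀ p, 0 < D p := fun p =>
    div_pos (gaussianPDFReal_pos 0 ρ _ hρ) (gaussianPDFReal_pos 0 τ _ hτ0)
  have hllr : llr (P.map (fun ω => (W ω, U ω, V ω))) μ₂
      =ᵐ[P.map (fun ω => (W ω, U ω, V ω))] fun p => Real.log (D p) := by
    have h := Measure.rnDeriv_withDensity μ₂
      (by fun_prop : Measurable fun p => ENNReal.ofReal (D p))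
    rw [← hμ₁] at h
    filter_upwards [hac.ae_le h] with p hp
    rw [llr, hp, ENNReal.toReal_ofReal (hDpos p).le]
  have hlog : ∀ ω, Real.log (D (W ω, U ω, V ω)) = 1 / 2 * Real.log (τ / ρ)
      + ((c * N ω + N' ω) ^ 2 / (2 * τ) - N' ω ^ 2 / (2 * ρ)) := fun ω => by
    have h1 : U ω - c * V ω = N' ω := by rw [hU]; ring
    have h2 : U ω - c * m * W ω = c * N ω + N' ω := by rw [hU, hV]; ring
    simp only [D, h1, h2]
    rw [Real.log_div (gaussianPDFReal_pos 0 ρ _ hρ).ne' (gaussianPDFReal_pos 0 τ _ hτ0).ne',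
      log_gaussianPDFReal hρ, log_gaussianPDFReal hτ0, Real.log_div hτp.ne' hρp.ne',
      Real.log_mul (by positivity) hτp.ne', Real.log_mul (by positivity) hρp.ne']
    ring
  have hsq : ∀ {B : Ω → ℝ} {x : ℝ≥0}, Measurable B → P.map B = gaussianReal 0 x →
      Integrable (fun ω => B ω ^ 2) P ∧ ∫ ω, B ω ^ 2 ∂P = x := fun {B x} hB h => by
    have i := integrable_sq_gaussianReal x
    have e := integral_sq_gaussianReal x
    rw [← h] at i e
    rw [integrable_map_measure (Measurable.aestronglyMeasurable (by fun_prop)) hB.aemeasurable]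
      at i
    rw [integral_map hB.aemeasurable (Measurable.aestronglyMeasurable (by fun_prop))] at e
    exact ⟨i, e⟩
  obtain ⟨i1, e1⟩ := hsq (by fun_prop) lM'
  obtain ⟨i2, e2⟩ := hsq hN' lN'
  have hiP : Integrable (fun ω => Real.log (D (W ω, U ω, V ω))) P := by
    simp only [hlog]
    exact (integrable_const _).add ((i1.div_const _).sub (i2.div_const _))
  -- Each normalised square has mean ½, so the two cancel and only the normalising constants remain.
  have hval : ∫ ω, Real.log (D (W ω, U ω, V ω)) ∂P = 1 / 2 * Real.log (τ / ρ) := by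
    simp only [hlog]
    refine (integral_add (g := fun ω => (c * N ω + N' ω) ^ 2 / (2 * (τ : ℝ)) - N' ω ^ 2 / (2 * ρ))
      (integrable_const _) ((i1.div_const _).sub (i2.div_const _))).trans ?_
    rw [integral_sub (i1.div_const _) (i2.div_const _), integral_div, integral_div, e1, e2,
      integral_const, probReal_univ, one_smul]
    field_simp
    ring
  have hmeas : AEStronglyMeasurable (fun p => Real.log (D p))
      (P.map fun ω => (W ω, U ω, V ω)) := Measurable.aestronglyMeasurable (by fun_prop)
  have hi : Integrable (llr (P.map (fun ω => (W ω, U ω, V ω))) μ₂)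
      (P.map (fun ω => (W ω, U ω, V ω))) := by
    rw [integrable_congr hllr, integrable_map_measure hmeas (by fun_prop)]
    exact hiP
  have : IsProbabilityMeasure (P.map fun ω => (W ω, U ω, V ω)) :=
    Measure.isProbabilityMeasure_map (by fun_prop)
  have : IsProbabilityMeasure μ₂ := by rw [hμ₂]; infer_instance
  rw [InformationTheory.klDiv_of_ac_of_integrable hac hi, integral_congr_ae hllr,
    integral_map (by fun_prop) hmeas, hval, probReal_univ, probReal_univ, hτ']
  simp

end GaussianInformation

/-! ### The Gaussian auxiliary variable -/

section Achieving

/-- Both cascades of Gaussian noises with Gaussian auxiliary variable `U = k X + N₀`, realised on a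
product space carrying `((Z, N₂), (N₁, N₀))`. -/
theorem exists_gaussian_auxiliary (ζ : Measure ℝ) [IsProbabilityMeasure ζ] (t r : ℝ≥0)
    (a b k : ℝ) :
    ∃ (Ω' : Type) (_ : MeasurableSpace Ω') (P' : Measure Ω') (_ : IsProbabilityMeasure P')
      (U X Y Z : Ω' → ℝ),
      Measurable U ∧ Measurable X ∧ Measurable Y ∧ Measurable Z ∧
      P'.map (fun ω => (Z ω, (Y ω - b * Z ω, X ω - a * Y ω)))
        = ζ.prod ((gaussianReal 0 t).prod (gaussianReal 0 r)) ∧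
      IsMarkovChain₄ P' U X Y Z ∧
      condMutualInfo P' U X Y = ENNReal.ofReal (1 / 2 * Real.log (1 + k ^ 2 * r)) ∧
      condMutualInfo P' U Y Z = ENNReal.ofReal
        (1 / 2 * Real.log ((1 + k ^ 2 * (a ^ 2 * t + r)) / (1 + k ^ 2 * r))) := by
  let Q : Measure ((ℝ × ℝ) × (ℝ × ℝ)) :=
    (ζ.prod (gaussianReal 0 t)).prod ((gaussianReal 0 r).prod (gaussianReal 0 1))
  have hQ : IsProbabilityMeasure Q := by simp only [Q]; infer_instance
  let Z : (ℝ × ℝ) × (ℝ × ℝ) → ℝ := fun p => p.1.1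
  let Y : (ℝ × ℝ) × (ℝ × ℝ) → ℝ := fun p => b * p.1.1 + p.1.2
  let X : (ℝ × ℝ) × (ℝ × ℝ) → ℝ := fun p => a * Y p + p.2.1
  let U : (ℝ × ℝ) × (ℝ × ℝ) → ℝ := fun p => k * X p + p.2.2
  have mZ : Measurable Z := by fun_prop
  have mY : Measurable Y := by fun_prop
  have mX : Measurable X := by fun_prop
  have mU : Measurable U := by fun_prop
  -- independence statements
  have split : ∀ {γ δ : Type} [MeasurableSpace γ] [MeasurableSpace δ] {f : ℝ × ℝ → γ}
      {g : ℝ × ℝ → δ}, Measurable f → Measurable g → Q.map (fun p => (f p.1, g p.2))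
        = (Q.map fun p => f p.1).prod (((gaussianReal 0 r).prod (gaussianReal 0 1)).map g) :=
    fun {γ δ _ _ f g} hf hg => by
      have h : Q.map (fun p => f p.1) = (ζ.prod (gaussianReal 0 t)).map f := by
        have : (fun p : (ℝ × ℝ) × (ℝ × ℝ) => f p.1) = f ∘ Prod.fst := rfl
        rw [this, ← Measure.map_map hf measurable_fst, Measure.map_fst_prod, measure_univ,
          one_smul]
      rw [h, Measure.map_prod_map _ _ hf hg]; rfl
  have assoc : Q.map (fun p => ((p.1, p.2.1), p.2.2))
      = ((ζ.prod (gaussianReal 0 t)).prod (gaussianReal 0 r)).prod (gaussianReal 0 1) := by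
    rw [← Measure.map_id (μ := ((ζ.prod (gaussianReal 0 t)).prod (gaussianReal 0 r)).prod
      (gaussianReal 0 1))]
    simp only [Q]
    rw [← Measure.prodAssoc_prod, Measure.map_map (by fun_prop) (by fun_prop)]
    rfl
  have assoc₁ : Q.map (fun p => (p.1, p.2.1))
      = (ζ.prod (gaussianReal 0 t)).prod (gaussianReal 0 r) := by
    have h := congrArg (Measure.map Prod.fst) assoc
    rw [Measure.map_map (by fun_prop) (by fun_prop), Measure.map_fst_prod, measure_univ,
      one_smul] at h
    exact h
  have lawZ : Q.map Z = ζ := by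
    have h := congrArg (Measure.map fun p : (ℝ × ℝ) × ℝ => p.1.1) assoc₁
    rw [Measure.map_map (by fun_prop) (by fun_prop)] at h
    refine h.trans ?_
    have e : (fun p : (ℝ × ℝ) × ℝ => p.1.1) = Prod.fst ∘ Prod.fst := rfl
    rw [e, ← Measure.map_map measurable_fst measurable_fst, Measure.map_fst_prod, measure_univ,
      one_smul, Measure.map_fst_prod, measure_univ, one_smul]
  have hsource : Q.map (fun ω => (Z ω, (Y ω - b * Z ω, X ω - a * Y ω)))
      = ζ.prod ((gaussianReal 0 t).prod (gaussianReal 0 r)) := by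
    have h := congrArg (Measure.map MeasurableEquiv.prodAssoc) assoc₁
    rw [Measure.map_map (by fun_prop) (by fun_prop), Measure.prodAssoc_prod] at h
    rw [← h]
    congr 1
    funext p
    simp [X, Y, Z, MeasurableEquiv.prodAssoc]
  -- Markov chains
  have mk1 : IsMarkovChain Q U X (fun ω => (Y ω, Z ω)) := by
    let F : (ℝ × ℝ) × ℝ → ℝ × (ℝ × ℝ) := fun q =>
      (a * (b * q.1.1 + q.1.2) + q.2, (b * q.1.1 + q.1.2, q.1.1))
    have hF : Measurable F := by fun_prop
    have h := congrArg (Measure.map (Prod.map F (id : ℝ → ℝ))) assoc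
    rw [Measure.map_map (by fun_prop) (by fun_prop),
      ← Measure.map_prod_map _ _ hF measurable_id, Measure.map_id, ← assoc₁,
      Measure.map_map hF (by fun_prop)] at h
    exact isMarkovChain_of_noise (N := fun p => p.2.2) mX (by fun_prop) (by fun_prop) h
      (g := fun p => k * p.1 + p.2) (by fun_prop) fun _ => rfl
  have mk2 : IsMarkovChain Q (fun ω => (U ω, X ω)) Y Z := by
    have h := split (f := fun p => (b * p.1 + p.2, p.1)) (g := id) (by fun_prop) (by fun_prop)
    rw [Measure.map_id] at h
    exact isMarkovChain_of_noise (N := fun p => p.2) mY mZ measurable_snd h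
      (g := fun p => (k * (a * p.1 + p.2.1) + p.2.2, a * p.1 + p.2.1)) (by fun_prop) fun _ => rfl
  -- informations
  have i1 : condMutualInfo Q U X Y = ENNReal.ofReal (1 / 2 * Real.log (1 + k ^ 2 * r)) := by
    have h := split (f := fun p => b * p.1 + p.2) (g := id) (by fun_prop) (by fun_prop)
    rw [Measure.map_id] at h
    rw [condMutualInfo_gaussian (N := fun p => p.2.1) (N' := fun p => p.2.2) mY (by fun_prop)
      (by fun_prop) one_ne_zero h (m := a) (c := k) (fun _ => rfl) fun _ => rfl]
    simp [add_comm]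
  have i2 : condMutualInfo Q U Y Z = ENNReal.ofReal
      (1 / 2 * Real.log ((1 + k ^ 2 * (a ^ 2 * t + r)) / (1 + k ^ 2 * r))) := by
    -- Seen from Y, U = kaY + (kN₁ + N₀), and the effective noise kN₁ + N₀ has variance k²r + 1.
    set ρ : ℝ≥0 := NNReal.mk (k ^ 2) (sq_nonneg k) * r + 1 with hρ
    have hρ' : (ρ : ℝ) = k ^ 2 * r + (1 : ℝ≥0) := by simp [hρ]
    have h : Q.map (fun p => (p.1, k * p.2.1 + p.2.2))
        = (ζ.prod (gaussianReal 0 t)).prod (gaussianReal 0 ρ) := by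
      rw [← map_prod_gaussianReal hρ']
      have h := Measure.map_prod_map (ζ.prod (gaussianReal 0 t))
        ((gaussianReal 0 r).prod (gaussianReal 0 1)) measurable_id
        (by fun_prop : Measurable fun p : ℝ × ℝ => k * p.1 + p.2)
      rw [Measure.map_id] at h
      exact h.symm
    have h2 := congrArg (Measure.map MeasurableEquiv.prodAssoc) h
    rw [Measure.map_map (by fun_prop) (by fun_prop), Measure.prodAssoc_prod, ← lawZ] at h2
    have hρ0 : ρ ≠ 0 := by simp [hρ]
    have h3 : Q.map (fun p => (Z p, (p.1.2, k * p.2.1 + p.2.2)))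
        = (Q.map Z).prod ((gaussianReal 0 t).prod (gaussianReal 0 ρ)) := h2
    rw [condMutualInfo_gaussian mZ (by fun_prop) (by fun_prop) hρ0 h3 (V := Y) (U := U) (m := b)
      (c := k * a) (fun _ => rfl) fun p => by simp only [U, X]; ring]
    rw [hρ']
    congr 4
    · simp; ring
    · simp; ring
  exact ⟨_, inferInstance, Q, hQ, U, X, Y, Z, mU, mX, mY, mZ, hsource, ⟨mk1, mk2⟩, i1, i2⟩

end Achieving

/-! ### The theorem -/

theorem corollary1 {Ω : Type*} [MeasurableSpace Ω] (P : Measure Ω) [IsProbabilityMeasure P]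
    (X Y Z : Ω → ℝ) (hX : Measurable X) (hY : Measurable Y) (hZ : Measurable Z)
    (hgauss : HasGaussianLaw (fun ω => (X ω, Y ω, Z ω)) P)
    (hX0 : P[X] = 0) (hY0 : P[Y] = 0) (hZ0 : P[Z] = 0)
    (hcov : (tripleCov P X Y Z).PosDef) (hXY : cov[X, Y; P] ≠ 0)
    (hdeg : IsMarkovChain P X Y Z)
    (Rp Rk : ℝ) (hR : (Rp, Rk) ∈ achievableRegion P X Y Z) :
    ∃ (Ω' : Type) (_ : MeasurableSpace Ω') (P' : Measure Ω') (_ : IsProbabilityMeasure P')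
      (U X' Y' Z' : Ω' → ℝ),
      Measurable U ∧ Measurable X' ∧ Measurable Y' ∧ Measurable Z' ∧
      P'.map (fun ω => (X' ω, Y' ω, Z' ω)) = P.map (fun ω => (X ω, Y ω, Z ω)) ∧
      IsMarkovChain₄ P' U X' Y' Z' ∧
      (condMutualInfo P' U X' Y' : EReal) ≤ (Rp : EReal) ∧
      (Rk : EReal) ≤ (condMutualInfo P' U Y' Z' : EReal) := by

  obtain ⟨a, b, t, r, ht, hr, hlaw⟩ :=
    exists_additive_noise hX hY hZ hgauss hX0 hY0 hZ0 hcov hdeg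
  have hζ : IsProbabilityMeasure (P.map Z) := Measure.isProbabilityMeasure_map hZ.aemeasurable
  obtain ⟨w, hw, hRp, hRk⟩ := exists_gaussian_rate_bound hX hY hZ ht hr hlaw hR
  obtain ⟨Ω', _, P', _, U, X', Y', Z', hU, hX', hY', hZ', hlaw', hm, h1, h2⟩ :=
    -- The gain √w on X against unit noise turns k² into the parameter w of the rate bound.
    exists_gaussian_auxiliary (P.map Z) t r a b (Real.sqrt w)
  refine ⟨Ω', inferInstance, P', inferInstance, U, X', Y', Z', hU, hX', hY', hZ', ?_, hm, ?_, ?_⟩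
  -- The map F rebuilds (X, Y, Z) from Z and the two residuals, so equal laws of the latter give
  -- equal laws of the triples.
  · let F : ℝ × (ℝ × ℝ) → ℝ × (ℝ × ℝ) := fun p =>
      (a * (b * p.1 + p.2.1) + p.2.2, (b * p.1 + p.2.1, p.1))
    have h := congrArg (Measure.map F) (hlaw'.trans hlaw.symm)
    rw [Measure.map_map (by fun_prop) (by fun_prop),
      Measure.map_map (by fun_prop) (by fun_prop)] at h
    simpa [F, Function.comp_def] using h
  · have h0 : 0 ≤ 1 / 2 * Real.log (1 + w * r) :=
      mul_nonneg (by norm_num) (Real.log_nonneg (by linarith [mul_nonneg hw r.coe_nonneg]))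
    rw [h1, Real.sq_sqrt hw, hRp, EReal.coe_ennreal_ofReal, max_eq_left h0]
  · rw [h2, Real.sq_sqrt hw, EReal.coe_ennreal_ofReal]
    -- The information is the real formula clipped at 0, which can only increase it.
    exact_mod_cast hRk.trans (le_max_left _ _)
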